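/- Let $d\ge 2$, let $\theta=(\theta_{kj})$ be a real skew-symmetric $d\times d$ matrix, and let $\mathbb T^d_\theta$ be the quantum torus: the von Neumann algebra generated by unitaries $U_1,\dots,U_d$ with $U_kU_j=e^{2\pi i\theta_{kj}}U_jU_k$ in the GNS representation of the trace $\tau$ given by $\tau(U^m)=\delta_{m,0}$, where $U^m=U_1^{m_1}\cdots U_d^{m_d}$, $m\in\mathbb Z^d$. For $1\le p<\infty$ let $L_p(\mathbb T^d_\theta)$ be the completion of $\mathbb T^d_\theta$ for $\|y\|_p=\tau(|y|^p)^{1/p}$, and let $L_\infty(\mathbb T^d_\theta)=\mathbb T^d_\theta$ with the operator norm. Let $\mathcal S(\mathbb T^d_\theta)$ be the space of all $\sum_m a_mU^m$ with $(a_m)$ rapidly decreasing, topologized by the seminorms $x\mapsto\|D^mx\|_\infty$, $m\in\mathbb N_0^d$, where $D^m=\partial_1^{m_1}\cdots\partial_d^{m_d}$ and $\partial_jU^n=2\pi i\,n_jU^n$. A distribution on $\mathbb T^d_\theta$ is a continuous linear functional $x$ on $\mathcal S(\mathbb T^d_\theta)$, and $\widehat x(m)=\langle x,(U^m)^*\rangle$.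 The spaces $L_p(\mathbb T^d_\theta)$ are regarded as spaces of distributions, and $\|x\|_p=\infty$ if $x\notin L_p(\mathbb T^d_\theta)$. Fix a real Schwartz function $\varphi$ on $\mathbb R^d$ with $\operatorname{supp}\varphi\subset\{\frac12\le|\xi|\le2\}$, $\varphi>0$ on $\{\frac12<|\xi|<2\}$ and $\sum_{k\in\mathbb Z}\varphi(2^{-k}\xi)=1$ for $\xi\ne0$. For a distribution $x$ put $\widetilde\varphi_k*x=\sum_m\varphi(2^{-k}m)\widehat x(m)U^m$, $$\|x\|_{B^\alpha_{p,q}}=\Big(|\widehat x(0)|^q+\sum_{k\ge0}2^{qk\alpha}\|\widetilde\varphi_k*x\|_p^q\Big)^{1/q},\qquad B^\alpha_{p,q}(\mathbb T^d_\theta)=\{x:\|x\|_{B^\alpha_{p,q}}<\infty\},$$ $$\Delta_u^nx=\sum_m(e^{2\pi i\,u\cdot m}-1)^n\,\widehat x(m)U^m\ (u\in\mathbb R^d),\qquad \omega^n_p(x,\varepsilon)=\sup_{0<|u|\le\varepsilon}\|\Delta_u^nx\|_p .$$ Theorem. Let $0<\alpha<n$ with $n\in\mathbb N$. There is a constant $C>0$,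 depending only on $d,\varphi,\alpha,n$, such that for every $\theta$ as above the following hold. (1) For all $1\le p,q\le\infty$ and every distribution $x$ on $\mathbb T^d_\theta$, $$C^{-1}\|x\|_{B^\alpha_{p,q}}\le\Big(|\widehat x(0)|^q+\int_0^1\varepsilon^{-q\alpha}\,\omega^n_p(x,\varepsilon)^q\,\frac{d\varepsilon}{\varepsilon}\Big)^{1/q}\le C\,\|x\|_{B^\alpha_{p,q}},$$ as an inequality in $[0,\infty]$ (so if one side is finite, so is the other). For $q=\infty$ sums and integrals are replaced by suprema as usual; the middle term is then $\max\big(|\widehat x(0)|,\sup_{0<\varepsilon\le1}\varepsilon^{-\alpha}\omega^n_p(x,\varepsilon)\big)$. (2) Consequently $B^\alpha_{\infty,\infty}(\mathbb T^d_\theta)$ is the quantum Zygmund class of order $\alpha$, that is, the set of all $x\in\mathbb T^d_\theta$ for which there is a constant $C_x$ with $\|\Delta_u^nx\|_\infty\le C_x|u|^\alpha$ for all $u\in\mathbb R^d$; and for every distribution $x$ $$C^{-1}\|x\|_{B^\alpha_{\infty,\infty}}\le\|x\|_\infty+\sup_{u\ne0}|u|^{-\alpha}\|\Delta_u^nx\|_\infty\le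 C\,\|x\|_{B^\alpha_{\infty,\infty}}.$$ -/

import Mathlib

open scoped ENNReal NNReal SchwartzMap

noncomputable section

namespace QTorus

/-! Part 1. The quantum torus as a von Neumann algebra with trace. -/

/-- The Hilbert space `ℓ²(ℤ^d)`. It is the GNS space of the canonical trace on the algebra of
polynomials in `U_1, …, U_d`: the basis vector `e_m` is the class of `U^m`. -/
abbrev HilbertL2 (d : ℕ) : Type := lp (fun _ : Fin d → ℤ => ℂ) 2

/-- Weighted composition `(T f)(n) = w(n) f(σ n)`, with `|w| = 1`, as a linear isometry of
`ℓ²(ℤ^d)`. -/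
def weightedShift {d : ℕ} (σ : (Fin d → ℤ) ≃ (Fin d → ℤ)) (w : (Fin d → ℤ) → ℂ)
    (hw : ∀ n, ‖w n‖ = 1) : HilbertL2 d →ₗᵢ[ℂ] HilbertL2 d where
  toFun f := ⟨fun n => w n * f (σ n), by
    have h := (lp.memℓp f).summable (by norm_num)
    refine memℓp_gen ?_
    refine (σ.summable_iff.mpr h).congr (fun n => ?_)
    simp [hw]⟩
  map_add' f g := by
    ext n
    exact mul_add _ _ _
  map_smul' c f := by
    ext n
    exact mul_left_comm _ _ _
  norm_map' f := by
    rw [lp.norm_eq_tsum_rpow (by norm_num), lp.norm_eq_tsum_rpow (by norm_num)]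
    congr 1
    rw [← σ.tsum_eq (fun n => ‖f n‖ ^ (2 : ℝ≥0∞).toReal)]
    refine tsum_congr (fun n => ?_)
    simp [hw]

/-- The phase `c(m,n)` for which `U^m U^n = c(m,n) U^(m+n)`:
`c(m,n) = exp(2πi ∑_{j<k} θ_{kj} m_k n_j)`. -/
def cocycle {d : ℕ} (θ : Matrix (Fin d) (Fin d) ℝ) (m n : Fin d → ℤ) : ℂ :=
  Complex.exp (((2 * Real.pi * ∑ k, ∑ j ∈ Finset.univ.filter (· < k),
    θ k j * (m k : ℝ) * (n j : ℝ) : ℝ) : ℂ) * Complex.I)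

theorem norm_cocycle {d : ℕ} (θ : Matrix (Fin d) (Fin d) ℝ) (m n : Fin d → ℤ) :
    ‖cocycle θ m n‖ = 1 :=
  Complex.norm_exp_ofReal_mul_I _

theorem cocycle_ne_zero {d : ℕ} (θ : Matrix (Fin d) (Fin d) ℝ) (m n : Fin d → ℤ) :
    cocycle θ m n ≠ 0 := Complex.exp_ne_zero _

theorem cocycle_add_left {d : ℕ} (θ : Matrix (Fin d) (Fin d) ℝ) (m m' n : Fin d → ℤ) :
    cocycle θ (m + m') n = cocycle θ m n * cocycle θ m' n := by
  unfold cocycle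
  rw [← Complex.exp_add, ← add_mul, ← Complex.ofReal_add, ← mul_add, ← Finset.sum_add_distrib]
  simp_rw [← Finset.sum_add_distrib]
  simp only [Pi.add_apply, Int.cast_add]
  congr 4
  refine Finset.sum_congr rfl fun k _ => Finset.sum_congr rfl fun j _ => ?_
  ring

theorem cocycle_add_right {d : ℕ} (θ : Matrix (Fin d) (Fin d) ℝ) (m n n' : Fin d → ℤ) :
    cocycle θ m (n + n') = cocycle θ m n * cocycle θ m n' := by
  unfold cocycle
  rw [← Complex.exp_add, ← add_mul, ← Complex.ofReal_add, ← mul_add, ← Finset.sum_add_distrib]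
  simp_rw [← Finset.sum_add_distrib]
  simp only [Pi.add_apply, Int.cast_add]
  congr 4
  refine Finset.sum_congr rfl fun k _ => Finset.sum_congr rfl fun j _ => ?_
  ring

theorem cocycle_zero_left {d : ℕ} (θ : Matrix (Fin d) (Fin d) ℝ) (n : Fin d → ℤ) :
    cocycle θ 0 n = 1 := by
  simp [cocycle]

theorem cocycle_zero_right {d : ℕ} (θ : Matrix (Fin d) (Fin d) ℝ) (m : Fin d → ℤ) :
    cocycle θ m 0 = 1 := by
  simp [cocycle]

theorem weightedShift_surjective {d : ℕ} (σ : (Fin d → ℤ) ≃ (Fin d → ℤ)) (w : (Fin d → ℤ) → ℂ)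
    (hw : ∀ n, ‖w n‖ = 1) : Function.Surjective (weightedShift σ w hw) := by
  intro g
  refine ⟨weightedShift σ.symm (fun n => (w (σ.symm n))⁻¹) (fun n => by simp [hw]) g, ?_⟩
  ext n
  have h0 : w n ≠ 0 := by
    intro h
    have := hw n
    simp [h] at this
  simp [weightedShift, h0]

/-- The unitary `U^m` on `ℓ²(ℤ^d)`: left multiplication by `U_1^{m_1} ⋯ U_d^{m_d}` in the GNS
representation, that is `U^m e_n = c(m,n) e_{m+n}`, or `(U^m f)(n) = c(m,n-m) f(n-m)`. -/
def monomial {d : ℕ} (θ : Matrix (Fin d) (Fin d) ℝ) (m : Fin d → ℤ) :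
    unitary (HilbertL2 d →L[ℂ] HilbertL2 d) :=
  Unitary.linearIsometryEquiv.symm
    (LinearIsometryEquiv.ofSurjective
      (weightedShift (Equiv.subRight m) (fun n => cocycle θ m (n - m))
        (fun n => norm_cocycle θ m (n - m)))
      (weightedShift_surjective _ _ _))

theorem monomial_apply {d : ℕ} (θ : Matrix (Fin d) (Fin d) ℝ) (m : Fin d → ℤ)
    (f : HilbertL2 d) (n : Fin d → ℤ) :
    (monomial θ m : HilbertL2 d →L[ℂ] HilbertL2 d) f n = cocycle θ m (n - m) * f (n - m) :=
  rfl

theorem monomial_mul {d : ℕ} (θ : Matrix (Fin d) (Fin d) ℝ) (m n : Fin d → ℤ) :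
    (monomial θ m : HilbertL2 d →L[ℂ] HilbertL2 d) * (monomial θ n : HilbertL2 d →L[ℂ] _) =
      cocycle θ m n • (monomial θ (m + n) : HilbertL2 d →L[ℂ] HilbertL2 d) := by
  ext f l
  change (monomial θ m : HilbertL2 d →L[ℂ] HilbertL2 d)
      ((monomial θ n : HilbertL2 d →L[ℂ] HilbertL2 d) f) l =
    cocycle θ m n * (monomial θ (m + n) : HilbertL2 d →L[ℂ] HilbertL2 d) f l
  rw [monomial_apply, monomial_apply, monomial_apply, cocycle_add_left]
  have h1 : l - m = n + (l - (m + n)) := by abel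
  have h2 : l - m - n = l - (m + n) := by abel
  rw [h2, h1, cocycle_add_right]
  ring

theorem monomial_zero {d : ℕ} (θ : Matrix (Fin d) (Fin d) ℝ) : monomial θ 0 = 1 := by
  ext f l
  rw [monomial_apply]
  simp [cocycle_zero_left]

/-- The generators `U_1, …, U_d`. -/
def gen {d : ℕ} (θ : Matrix (Fin d) (Fin d) ℝ) (k : Fin d) :
    unitary (HilbertL2 d →L[ℂ] HilbertL2 d) :=
  monomial θ (Pi.single k 1)

theorem cocycle_single {d : ℕ} (θ : Matrix (Fin d) (Fin d) ℝ) (k j : Fin d) (a b : ℤ) :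
    cocycle θ (Pi.single k a) (Pi.single j b) =
      Complex.exp (((2 * Real.pi * (if j < k then θ k j * a * b else 0) : ℝ) : ℂ) *
        Complex.I) := by
  unfold cocycle
  congr 4
  rw [Finset.sum_eq_single k]
  · split_ifs with h
    · rw [Finset.sum_eq_single j]
      · simp
      · intro l _ hl
        simp [hl]
      · intro hj
        simp [h] at hj
    · refine Finset.sum_eq_zero fun l hl => ?_
      have : l ≠ j := by
        rintro rfl
        simp at hl
        exact h hl
      simp [this]
  · intro l _ hl
    refine Finset.sum_eq_zero fun i _ => ?_
    simp [hl]
  · simp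

/-- The generators satisfy `U_k U_j = exp(2πi θ_{kj}) U_j U_k`. -/
theorem gen_commutation {d : ℕ} (θ : Matrix (Fin d) (Fin d) ℝ) (hθ : θ.transpose = -θ)
    (k j : Fin d) :
    (gen θ k : HilbertL2 d →L[ℂ] HilbertL2 d) * (gen θ j : HilbertL2 d →L[ℂ] _) =
      Complex.exp (2 * Real.pi * Complex.I * θ k j) •
        ((gen θ j : HilbertL2 d →L[ℂ] HilbertL2 d) * (gen θ k : HilbertL2 d →L[ℂ] _)) := by
  have hs : θ j k = -θ k j := by
    have := congrFun (congrFun hθ k) j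
    simpa using this
  unfold gen
  rw [monomial_mul, monomial_mul, smul_smul, add_comm (Pi.single j 1)]
  congr 1
  rw [cocycle_single, cocycle_single, ← Complex.exp_add]
  congr 1
  rcases lt_trichotomy k j with h | h | h
  · simp [h, h.not_gt, hs]
    ring
  · subst h
    have : θ k k = 0 := by linarith
    simp [this]
  · simp [h, h.not_gt]
    ring

theorem monomial_mul_of_cocycle {d : ℕ} (θ : Matrix (Fin d) (Fin d) ℝ) (m n : Fin d → ℤ)
    (h : cocycle θ m n = 1) : monomial θ m * monomial θ n = monomial θ (m + n) := by
  apply Subtype.ext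
  have := monomial_mul θ m n
  rw [h, one_smul] at this
  exact this

theorem gen_zpow {d : ℕ} (θ : Matrix (Fin d) (Fin d) ℝ) (k : Fin d) (z : ℤ) :
    gen θ k ^ z = monomial θ (Pi.single k z) := by
  have hmul : ∀ a b : ℤ, monomial θ (Pi.single k a) * monomial θ (Pi.single k b) =
      monomial θ (Pi.single k (a + b)) := by
    intro a b
    rw [monomial_mul_of_cocycle, Pi.single_add]
    rw [cocycle_single]
    simp
  let f : Multiplicative ℤ →* unitary (HilbertL2 d →L[ℂ] HilbertL2 d) :=
    { toFun := fun a => monomial θ (Pi.single k (Multiplicative.toAdd a))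
      map_one' := by simp [monomial_zero]
      map_mul' := fun a b => (hmul _ _).symm }
  have := map_zpow f (Multiplicative.ofAdd 1) z
  simpa [f, gen, ← ofAdd_zsmul] using this.symm

/-- `U^m = U_1^{m_1} ⋯ U_d^{m_d}` (ordered product). -/
theorem monomial_eq_prod {d : ℕ} (θ : Matrix (Fin d) (Fin d) ℝ) (m : Fin d → ℤ) :
    monomial θ m = (List.ofFn fun k => gen θ k ^ m k).prod := by
  have key : ∀ l : List (Fin d), l.Pairwise (· < ·) →
      (l.map fun k => gen θ k ^ m k).prod =
        monomial θ (l.map fun k => (Pi.single k (m k) : Fin d → ℤ)).sum := by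
    intro l
    induction l with
    | nil => simp [monomial_zero]
    | cons a l ih =>
      intro hl
      rw [List.pairwise_cons] at hl
      rw [List.map_cons, List.prod_cons, ih hl.2, gen_zpow, List.map_cons, List.sum_cons,
        monomial_mul_of_cocycle]
      have h1 : ∀ l' : List (Fin d), (∀ b ∈ l', a < b) →
          cocycle θ (Pi.single a (m a))
            (l'.map fun k => (Pi.single k (m k) : Fin d → ℤ)).sum = 1 := by
        intro l'
        induction l' with
        | nil => intro _; simp [cocycle_zero_right]
        | cons b l' ih' =>
          intro hb
          have hab : a < b := hb b (by simp)
          rw [List.map_cons, List.sum_cons, cocycle_add_right,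
            ih' (fun c hc => hb c (by simp [hc])), cocycle_single]
          simp [hab.not_gt]
      exact h1 l hl.1
  rw [List.ofFn_eq_map, key _ (List.pairwise_lt_finRange d)]
  congr 1
  rw [← List.ofFn_eq_map, List.sum_ofFn]
  exact (Finset.univ_sum_single m).symm

theorem star_monomial {d : ℕ} (θ : Matrix (Fin d) (Fin d) ℝ) (m : Fin d → ℤ) :
    star (monomial θ m : HilbertL2 d →L[ℂ] HilbertL2 d) =
      cocycle θ m m • (monomial θ (-m) : HilbertL2 d →L[ℂ] HilbertL2 d) := by
  have h1 := monomial_mul θ m (-m)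
  have hc : cocycle θ m m * cocycle θ m (-m) = 1 := by
    rw [← cocycle_add_right, add_neg_cancel, cocycle_zero_right]
  have h2 : (monomial θ m : HilbertL2 d →L[ℂ] HilbertL2 d) *
      (cocycle θ m m • (monomial θ (-m) : HilbertL2 d →L[ℂ] HilbertL2 d)) = 1 := by
    rw [mul_smul_comm, h1, smul_smul, hc, one_smul, add_neg_cancel, monomial_zero]
    rfl
  calc star (monomial θ m : HilbertL2 d →L[ℂ] HilbertL2 d)
      = star (monomial θ m : HilbertL2 d →L[ℂ] HilbertL2 d) *
        ((monomial θ m : HilbertL2 d →L[ℂ] HilbertL2 d) *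
          (cocycle θ m m • (monomial θ (-m) : HilbertL2 d →L[ℂ] HilbertL2 d))) := by
        rw [h2, mul_one]
    _ = _ := by
        rw [← mul_assoc, Unitary.coe_star_mul_self, one_mul]

/-- The quantum torus `𝕋^d_θ`: the von Neumann algebra generated by `U_1, …, U_d` on the GNS space
of the trace, i.e. the double commutant of the generators. -/
def torus {d : ℕ} (θ : Matrix (Fin d) (Fin d) ℝ) : VonNeumannAlgebra (HilbertL2 d) where
  toStarSubalgebra := StarSubalgebra.centralizer ℂ
    (StarSubalgebra.centralizer ℂ
      (Set.range fun k => (gen θ k : HilbertL2 d →L[ℂ] HilbertL2 d)) :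
        Set (HilbertL2 d →L[ℂ] HilbertL2 d))
  centralizer_centralizer' := by simp

/-- The canonical trace `τ(y) = ⟨e_0, y e_0⟩`. -/
def trace {d : ℕ} (y : HilbertL2 d →L[ℂ] HilbertL2 d) : ℂ :=
  inner ℂ (lp.single 2 0 1 : HilbertL2 d) (y (lp.single 2 0 1))

/-- The Fourier coefficient `τ((U^m)* y)` of an element of the quantum torus. -/
def opCoeff {d : ℕ} (θ : Matrix (Fin d) (Fin d) ℝ) (y : HilbertL2 d →L[ℂ] HilbertL2 d)
    (m : Fin d → ℤ) : ℂ :=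
  trace (star (monomial θ m : HilbertL2 d →L[ℂ] HilbertL2 d) * y)

/-- The trace is normalised on polynomials: `τ(U^m) = δ_{m,0}`. -/
theorem trace_monomial {d : ℕ} (θ : Matrix (Fin d) (Fin d) ℝ) (m : Fin d → ℤ) :
    trace (monomial θ m : HilbertL2 d →L[ℂ] HilbertL2 d) = if m = 0 then 1 else 0 := by
  unfold trace
  rw [lp.inner_single_left, monomial_apply]
  split_ifs with h
  · subst h
    simp [cocycle_zero_left]
  · have h' : -m ≠ 0 := by simpa using h
    simp [h']

/-! Part 2. Noncommutative `L_p`-norms. -/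

/-- The operator `|y|^p`, where `|y| = (y* y)^{1/2}`, for a bounded operator `y` on a Hilbert space
and `0 < p < ∞` (continuous functional calculus). -/
def absPow {H : Type*} [NormedAddCommGroup H] [InnerProductSpace ℂ H] [CompleteSpace H]
    (p : ℝ) (y : H →L[ℂ] H) : H →L[ℂ] H :=
  cfc (fun t : ℝ => t ^ p) (CFC.abs y)

/-- `‖y‖_p = τ(|y|^p)^{1/p}` for a bounded operator `y` in the quantum torus and `0 < p < ∞`. -/
def traceNorm {d : ℕ} (p : ℝ) (y : HilbertL2 d →L[ℂ] HilbertL2 d) : ℝ :=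
  (trace (absPow p y)).re ^ (1 / p)

/-- `HasLpNorm θ p c r`: the formal Fourier series `∑ c_m U^m` is the Fourier series of an element
of `L_p(𝕋^d_θ)` whose norm is `r`. For `p = ∞`, `L_∞` is the quantum torus itself with the operator
norm. For `p < ∞`, `L_p` is the completion of the quantum torus for `‖·‖_p`; an element of it is
given by a `‖·‖_p`-Cauchy sequence, its norm is the limit of the norms and its Fourier coefficients
are the limits of the Fourier coefficients. -/
def HasLpNorm {d : ℕ} (θ : Matrix (Fin d) (Fin d) ℝ) (p : ℝ≥0∞) (c : (Fin d → ℤ) → ℂ)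
    (r : ℝ≥0) : Prop :=
  if p = ∞ then
    ∃ y ∈ torus θ, (∀ m, opCoeff θ y m = c m) ∧ ‖y‖ = r
  else
    ∃ y : ℕ → (HilbertL2 d →L[ℂ] HilbertL2 d),
      (∀ i, y i ∈ torus θ) ∧
      (∀ ε : ℝ, 0 < ε → ∃ N, ∀ i, N ≤ i → ∀ j, N ≤ j → traceNorm p.toReal (y i - y j) < ε) ∧
      (∀ m, Filter.Tendsto (fun i => opCoeff θ (y i) m) Filter.atTop (nhds (c m))) ∧
      Filter.Tendsto (fun i => traceNorm p.toReal (y i)) Filter.atTop (nhds (r : ℝ))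

/-- The formal Fourier series `∑ c_m U^m` belongs to `L_p(𝕋^d_θ)`. -/
def MemLp {d : ℕ} (θ : Matrix (Fin d) (Fin d) ℝ) (p : ℝ≥0∞) (c : (Fin d → ℤ) → ℂ) : Prop :=
  ∃ r, HasLpNorm θ p c r

/-- The `L_p`-norm of the formal Fourier series `∑ c_m U^m`, equal to `∞` if the series is not that
of an element of `L_p(𝕋^d_θ)`. -/
def lpENorm {d : ℕ} (θ : Matrix (Fin d) (Fin d) ℝ) (p : ℝ≥0∞) (c : (Fin d → ℤ) → ℂ) : ℝ≥0∞ :=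
  ⨅ (r : ℝ≥0) (_ : HasLpNorm θ p c r), (r : ℝ≥0∞)

/-! Part 3. Smooth elements and distributions. -/

/-- Rapidly decreasing families indexed by `ℤ^d`. -/
def RapidDecay {d : ℕ} (a : (Fin d → ℤ) → ℂ) : Prop :=
  ∀ k : ℕ, ∃ C : ℝ, ∀ n, (1 + ‖n‖) ^ k * ‖a n‖ ≤ C

/-- The space of rapidly decreasing families. -/
def rapidDecay (d : ℕ) : Submodule ℂ ((Fin d → ℤ) → ℂ) where
  carrier := {a | RapidDecay a}
  zero_mem' := fun k => ⟨0, fun n => by simp⟩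
  add_mem' := by
    intro a b ha hb k
    obtain ⟨A, hA⟩ := ha k
    obtain ⟨B, hB⟩ := hb k
    refine ⟨A + B, fun n => ?_⟩
    refine le_trans ?_ (add_le_add (hA n) (hB n))
    rw [← mul_add]
    exact mul_le_mul_of_nonneg_left (norm_add_le _ _) (by positivity)
  smul_mem' := by
    intro c a ha k
    obtain ⟨A, hA⟩ := ha k
    refine ⟨‖c‖ * A, fun n => ?_⟩
    have := mul_le_mul_of_nonneg_left (hA n) (norm_nonneg c)
    simpa [mul_left_comm] using this

theorem RapidDecay.summable {d : ℕ} {a : (Fin d → ℤ) → ℂ} (ha : RapidDecay a) :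
    Summable fun n => ‖a n‖ := by
  obtain ⟨C, hC⟩ := ha (2 * d)
  have hg : Summable fun z : ℤ => ((1 + ‖z‖) ^ 2)⁻¹ := by
    have h1 : Summable fun z : ℤ => |(z : ℝ)| ^ (-2 : ℝ) + if z = 0 then (1 : ℝ) else 0 :=
      (Real.summable_abs_int_rpow (by norm_num)).add (hasSum_ite_eq 0 1).summable
    refine h1.of_nonneg_of_le (fun z => by positivity) (fun z => ?_)
    rcases eq_or_ne z 0 with rfl | hz
    · simp
    · have hz' : 0 < |(z : ℝ)| := by positivity
      rw [if_neg hz, add_zero, Real.rpow_neg hz'.le, Int.norm_eq_abs]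
      norm_cast
      gcongr
      simp
  have hprod : Summable fun n : Fin d → ℤ => ∏ j, ((1 + ‖n j‖) ^ 2)⁻¹ := by
    classical
    refine summable_of_sum_le (c := (∑' z : ℤ, ((1 + ‖z‖) ^ 2)⁻¹) ^ d)
      (fun n => Finset.prod_nonneg fun j _ => by positivity) (fun s => ?_)
    calc ∑ n ∈ s, ∏ j, ((1 + ‖n j‖) ^ 2)⁻¹
        ≤ ∑ n ∈ Fintype.piFinset (fun j : Fin d => s.image fun n => n j),
            ∏ j, ((1 + ‖n j‖) ^ 2)⁻¹ := by
          refine Finset.sum_le_sum_of_subset_of_nonneg (fun n hn => ?_)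
            (fun n _ _ => Finset.prod_nonneg fun j _ => by positivity)
          rw [Fintype.mem_piFinset]
          exact fun j => Finset.mem_image_of_mem _ hn
      _ = ∏ j : Fin d, ∑ z ∈ s.image (fun n => n j), ((1 + ‖z‖) ^ 2)⁻¹ :=
          (Finset.prod_univ_sum _ fun (_ : Fin d) (z : ℤ) => ((1 + ‖z‖) ^ 2)⁻¹).symm
      _ ≤ ∏ _j : Fin d, ∑' z : ℤ, ((1 + ‖z‖) ^ 2)⁻¹ :=
          Finset.prod_le_prod (fun j _ => Finset.sum_nonneg fun z _ => by positivity)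
            (fun j _ => hg.sum_le_tsum _ fun z _ => by positivity)
      _ = _ := by simp
  refine (hprod.mul_left C).of_nonneg_of_le (fun n => norm_nonneg _) (fun n => ?_)
  have hP : 0 < ∏ j, (1 + ‖n j‖) ^ 2 := Finset.prod_pos fun j _ => by positivity
  have hle : ∏ j, (1 + ‖n j‖) ^ 2 ≤ (1 + ‖n‖) ^ (2 * d) := by
    calc ∏ j, (1 + ‖n j‖) ^ 2 ≤ ∏ _j : Fin d, (1 + ‖n‖) ^ 2 :=
          Finset.prod_le_prod (fun j _ => by positivity)
            (fun j _ => by gcongr; exact norm_le_pi_norm n j)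
      _ = _ := by simp [pow_mul]
  rw [Finset.prod_inv_distrib, ← div_eq_mul_inv, le_div_iff₀ hP, mul_comm]
  exact (mul_le_mul_of_nonneg_right hle (norm_nonneg _)).trans (hC n)

/-- The Schwartz class `𝒮(𝕋^d_θ)` of all `∑ a_m U^m` with `a` rapidly decreasing; an element is
recorded by its family of coefficients. -/
def Smooth {d : ℕ} (_θ : Matrix (Fin d) (Fin d) ℝ) : Type := rapidDecay d

instance {d : ℕ} (θ : Matrix (Fin d) (Fin d) ℝ) : AddCommGroup (Smooth θ) :=
  inferInstanceAs (AddCommGroup (rapidDecay d))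

instance {d : ℕ} (θ : Matrix (Fin d) (Fin d) ℝ) : Module ℂ (Smooth θ) :=
  inferInstanceAs (Module ℂ (rapidDecay d))

theorem summable_smooth {d : ℕ} (θ : Matrix (Fin d) (Fin d) ℝ) {a : (Fin d → ℤ) → ℂ}
    (ha : RapidDecay a) :
    Summable fun n => a n • (monomial θ n : HilbertL2 d →L[ℂ] HilbertL2 d) := by
  refine Summable.of_norm_bounded ha.summable (fun n => ?_)
  rw [norm_smul]
  have : ‖(monomial θ n : HilbertL2 d →L[ℂ] HilbertL2 d)‖ ≤ 1 :=
    ContinuousLinearMap.opNorm_le_bound _ zero_le_one fun f => by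
      rw [one_mul]
      exact (LinearIsometry.norm_map (weightedShift _ _ fun k => norm_cocycle θ n (k - n)) f).le
  exact mul_le_of_le_one_right (norm_nonneg _) this

/-- The element `∑ a_m U^m` of the quantum torus (norm convergent sum) given by a smooth element. -/
def toOp {d : ℕ} (θ : Matrix (Fin d) (Fin d) ℝ) :
    Smooth θ →ₗ[ℂ] (HilbertL2 d →L[ℂ] HilbertL2 d) where
  toFun a := ∑' n, a.1 n • (monomial θ n : HilbertL2 d →L[ℂ] HilbertL2 d)
  map_add' a b := by
    rw [← (summable_smooth θ a.2).tsum_add (summable_smooth θ b.2)]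
    exact tsum_congr fun n => add_smul _ _ _
  map_smul' c a := by
    rw [RingHom.id_apply, ← (summable_smooth θ a.2).tsum_const_smul]
    exact tsum_congr fun n => mul_smul _ _ _

theorem RapidDecay.deriv {d : ℕ} {a : (Fin d → ℤ) → ℂ} (ha : RapidDecay a) (m : Fin d → ℕ) :
    RapidDecay fun n => (∏ j, (2 * Real.pi * Complex.I * (n j : ℂ)) ^ m j) * a n := by
  intro k
  obtain ⟨C, hC⟩ := ha (k + ∑ j, m j)
  refine ⟨(∏ j, (2 * Real.pi) ^ m j) * C, fun n => ?_⟩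
  have hle : ‖∏ j, (2 * Real.pi * Complex.I * (n j : ℂ)) ^ m j‖ ≤
      (∏ j, (2 * Real.pi) ^ m j) * (1 + ‖n‖) ^ ∑ j, m j := by
    rw [norm_prod, ← Finset.prod_pow_eq_pow_sum, ← Finset.prod_mul_distrib]
    refine Finset.prod_le_prod (fun j _ => norm_nonneg _) (fun j _ => ?_)
    rw [norm_pow, ← mul_pow]
    have h1 : ‖(2 * Real.pi * Complex.I * (n j : ℂ))‖ = 2 * Real.pi * ‖n j‖ := by
      simp [abs_of_pos Real.pi_pos, Int.norm_eq_abs]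
    rw [h1]
    have h2 : ‖n j‖ ≤ 1 + ‖n‖ := (norm_le_pi_norm n j).trans (by simp)
    have := Real.pi_pos
    gcongr
  calc (1 + ‖n‖) ^ k * ‖(∏ j, (2 * Real.pi * Complex.I * (n j : ℂ)) ^ m j) * a n‖
      ≤ (1 + ‖n‖) ^ k * (((∏ j, (2 * Real.pi) ^ m j) * (1 + ‖n‖) ^ ∑ j, m j) * ‖a n‖) := by
        rw [norm_mul]
        gcongr
    _ = (∏ j, (2 * Real.pi) ^ m j) * ((1 + ‖n‖) ^ (k + ∑ j, m j) * ‖a n‖) := by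
        rw [pow_add]; ring
    _ ≤ _ := by
        refine mul_le_mul_of_nonneg_left (hC n) ?_
        have := Real.pi_pos
        positivity

/-- The partial derivation `D^m = ∂_1^{m_1} ⋯ ∂_d^{m_d}` on the Schwartz class, where
`∂_j U^n = 2πi n_j U^n`. -/
def smoothDeriv {d : ℕ} (θ : Matrix (Fin d) (Fin d) ℝ) (m : Fin d → ℕ) :
    Smooth θ →ₗ[ℂ] Smooth θ where
  toFun a := ⟨_, a.2.deriv m⟩
  map_add' _ _ := Subtype.ext <| funext fun _ => mul_add _ _ _
  map_smul' _ _ := Subtype.ext <| funext fun _ => mul_left_comm _ _ _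

/-- The seminorms `x ↦ ‖D^m x‖_∞` on the Schwartz class. -/
def smoothSeminorms {d : ℕ} (θ : Matrix (Fin d) (Fin d) ℝ) :
    SeminormFamily ℂ (Smooth θ) (Fin d → ℕ) :=
  fun m => (normSeminorm ℂ (HilbertL2 d →L[ℂ] HilbertL2 d)).comp
    ((toOp θ).comp (smoothDeriv θ m))

/-- The locally convex topology of the Schwartz class. -/
instance {d : ℕ} (θ : Matrix (Fin d) (Fin d) ℝ) : TopologicalSpace (Smooth θ) :=
  (smoothSeminorms θ).moduleFilterBasis.topology

/-- Distributions on the quantum torus: continuous linear functionals on the Schwartz class. -/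
abbrev Distribution {d : ℕ} (θ : Matrix (Fin d) (Fin d) ℝ) : Type := Smooth θ →L[ℂ] ℂ

theorem rapidDecay_single {d : ℕ} (m : Fin d → ℤ) (c : ℂ) :
    RapidDecay (Pi.single m c : (Fin d → ℤ) → ℂ) := by
  intro k
  refine ⟨(1 + ‖m‖) ^ k * ‖c‖, fun n => ?_⟩
  rcases eq_or_ne n m with rfl | h
  · simp
  · simp only [Pi.single_eq_of_ne h, norm_zero, mul_zero]
    positivity

/-- The smooth element `(U^m)* = c(m,m) U^{-m}`. -/
def starMonomial {d : ℕ} (θ : Matrix (Fin d) (Fin d) ℝ) (m : Fin d → ℤ) : Smooth θ :=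
  ⟨Pi.single (-m) (cocycle θ m m), rapidDecay_single _ _⟩

theorem toOp_starMonomial {d : ℕ} (θ : Matrix (Fin d) (Fin d) ℝ) (m : Fin d → ℤ) :
    toOp θ (starMonomial θ m) = star (monomial θ m : HilbertL2 d →L[ℂ] HilbertL2 d) := by
  rw [star_monomial]
  change ∑' n, (Pi.single (-m) (cocycle θ m m) : (Fin d → ℤ) → ℂ) n •
    (monomial θ n : HilbertL2 d →L[ℂ] HilbertL2 d) = _
  rw [tsum_eq_single (-m)]
  · simp
  · intro n hn
    simp [hn]

/-- The Fourier coefficients `x̂(m) = ⟨x, (U^m)*⟩` of a distribution. -/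
def fourierCoeff {d : ℕ} {θ : Matrix (Fin d) (Fin d) ℝ} (x : Distribution θ) (m : Fin d → ℤ) : ℂ :=
  x (starMonomial θ m)

/-! Part 4. Besov spaces, moduli of smoothness, Zygmund classes. -/

/-- `m ∈ ℤ^d` as a point of the Euclidean space `ℝ^d`. -/
def latticePoint {d : ℕ} (m : Fin d → ℤ) : EuclideanSpace ℝ (Fin d) :=
  WithLp.toLp 2 fun j => (m j : ℝ)

/-- The Littlewood-Paley conditions on the Schwartz function `φ` on `ℝ^d`. -/
structure IsLittlewoodPaley {d : ℕ} (φ : 𝓢(EuclideanSpace ℝ (Fin d), ℝ)) : Prop where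
  support : tsupport φ ⊆ {ξ | 1 / 2 ≤ ‖ξ‖ ∧ ‖ξ‖ ≤ 2}
  pos : ∀ ξ, 1 / 2 < ‖ξ‖ → ‖ξ‖ < 2 → 0 < φ ξ
  sum_eq_one : ∀ ξ, ξ ≠ 0 → HasSum (fun k : ℤ => φ ((2 : ℝ) ^ (-k) • ξ)) 1

/-- The Fourier series of `φ̃_k * x = ∑ φ(2^{-k} m) x̂(m) U^m`. -/
def lpBlock {d : ℕ} {θ : Matrix (Fin d) (Fin d) ℝ} (φ : 𝓢(EuclideanSpace ℝ (Fin d), ℝ)) (k : ℕ)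
    (x : Distribution θ) (m : Fin d → ℤ) : ℂ :=
  (φ ((2 : ℝ) ^ (-(k : ℤ)) • latticePoint m) : ℂ) * fourierCoeff x m

/-- The Besov norm `(|x̂(0)|^q + ∑_{k ≥ 0} 2^{qkα} ‖φ̃_k * x‖_p^q)^{1/q}`, with values in `[0,∞]`
(a supremum for `q = ∞`). -/
def besovNorm {d : ℕ} {θ : Matrix (Fin d) (Fin d) ℝ} (φ : 𝓢(EuclideanSpace ℝ (Fin d), ℝ))
    (α : ℝ) (p q : ℝ≥0∞) (x : Distribution θ) : ℝ≥0∞ :=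
  if q = ∞ then
    max ‖fourierCoeff x 0‖ₑ
      (⨆ k : ℕ, ENNReal.ofReal ((2 : ℝ) ^ ((k : ℝ) * α)) * lpENorm θ p (lpBlock φ k x))
  else
    (‖fourierCoeff x 0‖ₑ ^ q.toReal +
      ∑' k : ℕ, ENNReal.ofReal ((2 : ℝ) ^ (q.toReal * ((k : ℝ) * α))) *
        lpENorm θ p (lpBlock φ k x) ^ q.toReal) ^ (1 / q.toReal)

/-- The Besov space `B^α_{p,q}(𝕋^d_θ)`. -/
def besovSpace {d : ℕ} (θ : Matrix (Fin d) (Fin d) ℝ) (φ : 𝓢(EuclideanSpace ℝ (Fin d), ℝ))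
    (α : ℝ) (p q : ℝ≥0∞) : Set (Distribution θ) :=
  {x | besovNorm φ α p q x < ∞}

/-- The Fourier series of the `n`-th difference `Δ_u^n x`, the Fourier multiplier with symbol
`(e^{2πi u·m} - 1)^n`. -/
def diffSeries {d : ℕ} {θ : Matrix (Fin d) (Fin d) ℝ} (n : ℕ) (u : EuclideanSpace ℝ (Fin d))
    (x : Distribution θ) (m : Fin d → ℤ) : ℂ :=
  (Complex.exp (((2 * Real.pi * inner ℝ u (latticePoint m) : ℝ) : ℂ) * Complex.I) - 1) ^ n *
    fourierCoeff x m

/-- The modulus of smoothness `ω_p^n(x,ε) = sup_{0 < |u| ≤ ε} ‖Δ_u^n x‖_p`. -/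
def modulus {d : ℕ} {θ : Matrix (Fin d) (Fin d) ℝ} (n : ℕ) (p : ℝ≥0∞) (x : Distribution θ)
    (ε : ℝ) : ℝ≥0∞ :=
  ⨆ (u : EuclideanSpace ℝ (Fin d)) (_ : 0 < ‖u‖ ∧ ‖u‖ ≤ ε), lpENorm θ p (diffSeries n u x)

/-- `(|x̂(0)|^q + ∫_0^1 ε^{-qα} ω_p^n(x,ε)^q dε/ε)^{1/q}`, with values in `[0,∞]`
(a supremum for `q = ∞`). -/
def differenceNorm {d : ℕ} {θ : Matrix (Fin d) (Fin d) ℝ} (n : ℕ) (α : ℝ) (p q : ℝ≥0∞)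
    (x : Distribution θ) : ℝ≥0∞ :=
  if q = ∞ then
    max ‖fourierCoeff x 0‖ₑ
      (⨆ (ε : ℝ) (_ : 0 < ε ∧ ε ≤ 1), ENNReal.ofReal (ε ^ (-α)) * modulus n p x ε)
  else
    (‖fourierCoeff x 0‖ₑ ^ q.toReal +
      ∫⁻ ε in Set.Ioc (0 : ℝ) 1, ENNReal.ofReal (ε ^ (-(q.toReal * α))) *
        modulus n p x ε ^ q.toReal * ENNReal.ofReal (1 / ε)) ^ (1 / q.toReal)

/-- The Zygmund norm of order `α` defined with differences of order `n`:
`‖x‖_∞ + sup_{u ≠ 0} |u|^{-α} ‖Δ_u^n x‖_∞`. -/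
def zygmundNorm {d : ℕ} {θ : Matrix (Fin d) (Fin d) ℝ} (n : ℕ) (α : ℝ) (x : Distribution θ) :
    ℝ≥0∞ :=
  lpENorm θ ∞ (fourierCoeff x) +
    ⨆ (u : EuclideanSpace ℝ (Fin d)) (_ : u ≠ 0),
      ENNReal.ofReal (‖u‖ ^ (-α)) * lpENorm θ ∞ (diffSeries n u x)

/-- The quantum Zygmund class of order `α`, defined with differences of order `n > α`: all `x` in
the quantum torus such that `‖Δ_u^n x‖_∞ ≤ C |u|^α` for all `u ∈ ℝ^d`. -/
def zygmundClass {d : ℕ} (θ : Matrix (Fin d) (Fin d) ℝ) (n : ℕ) (α : ℝ) : Set (Distribution θ) :=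
  {x | MemLp θ ∞ (fourierCoeff x) ∧ ∃ C : ℝ, ∀ u : EuclideanSpace ℝ (Fin d),
    lpENorm θ ∞ (diffSeries n u x) ≤ ENNReal.ofReal (C * ‖u‖ ^ α)}

end QTorus

end

/-! The theorem rests on transference. The dual action `U^m ↦ e^{2πi v·m} U^m` is implemented by
unitaries fixing the trace vector, hence preserves every `L_p`-norm. Averaging it against an
integrable `h` on `ℝ^d` gives the Fourier multiplier whose symbol is the inverse Fourier transform
of `h` at `εm`, of norm at most `‖h‖_1` for all `θ`, `p`, `ε`. Estimates for symbols thus become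
`L_1` estimates on `ℝ^d`, with constants independent of `θ` and `p`.

Blocks from differences: on the support of `φ` one can write `φ = ∑_j g_j (e^{2πi ξ_j/4} - 1)^n`
with Schwartz `g_j`, so the `k`-th block is controlled by `n`-th differences of step `2^{-k-2}`
(`exists_lpENorm_lpBlock_le_modulus`).

Differences from blocks: if `2^k|u| ≤ 1`, a Bernstein inequality bounds `Δ_u^n` on the `k`-th block
by `(K 2^k|u|)^n`; in general it is bounded by `2^n`. After weighting by `2^{jα}`, the passage from
blocks `k` to scale `j` has a kernel dominated by `ρ^{|j-k|}`, where `ρ = max(2^{-α}, 2^{α-n}) < 1`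
exactly because `0 < α < n` (`exists_modulus_le_tsum`). Schur's test then handles every `q ≥ 1`, and
monotonicity of the modulus compares the integral with its dyadic sums.

Two facts about noncommutative `L_p` are needed. Duality for the trace norm
(`IsTraceVector.vecNorm_le_of_dualBall`), obtained from Hölder's inequality by the three lines
theorem, gives the triangle inequality and contractivity of averages. For formal series, `lpENorm`
is the infimum of `∑ ‖y_k‖_p` over series of bounded operators with the prescribed coefficients;
this gives countable subadditivity and extends multiplier bounds from operators to series.

In the Zygmund case the blocks are summable in `L_∞` since `α > 0`, and steps `|u| > 1` cost only
the trivial bound `2^n`. -/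

noncomputable section

namespace QTorus

variable {d : ℕ}

/-! ### The trace and the quantum torus -/

/-- The cyclic and separating trace vector `e_0`. -/
def vac (d : ℕ) : HilbertL2 d := lp.single 2 0 1

theorem norm_vac : ‖vac d‖ = 1 := by
  simp [vac, lp.norm_single]

theorem trace_eq (y : HilbertL2 d →L[ℂ] HilbertL2 d) : trace y = inner ℂ (vac d) (y (vac d)) := rfl

theorem trace_eq_apply (y : HilbertL2 d →L[ℂ] HilbertL2 d) : trace y = y (vac d) 0 := by
  rw [trace, lp.inner_single_left]
  simp [vac]

theorem trace_star_mul (a b : HilbertL2 d →L[ℂ] HilbertL2 d) :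
    trace (star a * b) = inner ℂ (a (vac d)) (b (vac d)) := by
  rw [trace_eq, ContinuousLinearMap.star_eq_adjoint]
  exact ContinuousLinearMap.adjoint_inner_right a _ _

/-- The trace as a continuous linear functional. -/
def traceCLM (d : ℕ) : (HilbertL2 d →L[ℂ] HilbertL2 d) →L[ℂ] ℂ :=
  (innerSL ℂ (vac d)).comp (ContinuousLinearMap.apply ℂ (HilbertL2 d) (vac d))

theorem norm_trace_le (y : HilbertL2 d →L[ℂ] HilbertL2 d) : ‖trace y‖ ≤ ‖y‖ := by
  rw [trace_eq]
  refine (norm_inner_le_norm _ _).trans ?_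
  have := y.le_opNorm (vac d)
  rw [norm_vac] at *
  simpa using this

/-- The commutant of the generators is closed under adjoints, so the second half of the bicommutant
condition is automatic. -/
theorem mem_torus_iff {θ : Matrix (Fin d) (Fin d) ℝ} {y : HilbertL2 d →L[ℂ] HilbertL2 d} :
    y ∈ torus θ ↔ ∀ b : HilbertL2 d →L[ℂ] HilbertL2 d,
      (∀ k, (gen θ k : HilbertL2 d →L[ℂ] HilbertL2 d) * b = b * gen θ k) →
      (∀ k, star (gen θ k : HilbertL2 d →L[ℂ] HilbertL2 d) * b =
        b * star (gen θ k : HilbertL2 d →L[ℂ] HilbertL2 d)) → b * y = y * b := by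
  have h0 : y ∈ torus θ ↔ y ∈ StarSubalgebra.centralizer ℂ
    (StarSubalgebra.centralizer ℂ
      (Set.range fun k => (gen θ k : HilbertL2 d →L[ℂ] HilbertL2 d)) :
        Set (HilbertL2 d →L[ℂ] HilbertL2 d)) := Iff.rfl
  rw [h0, StarSubalgebra.mem_centralizer_iff]
  simp only [SetLike.mem_coe]
  constructor
  · intro h b h1 h2
    refine (h b ?_).1
    rw [StarSubalgebra.mem_centralizer_iff]
    rintro _ ⟨k, rfl⟩
    exact ⟨h1 k, h2 k⟩
  · intro h b hb
    have key : ∀ b ∈ StarSubalgebra.centralizer ℂ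
      (Set.range fun k => (gen θ k : HilbertL2 d →L[ℂ] HilbertL2 d)), b * y = y * b := by
      intro b hb
      rw [StarSubalgebra.mem_centralizer_iff] at hb
      exact h b (fun k => (hb _ ⟨k, rfl⟩).1) (fun k => (hb _ ⟨k, rfl⟩).2)
    exact ⟨key b hb, key _ (star_mem hb)⟩

theorem isClosed_torus (θ : Matrix (Fin d) (Fin d) ℝ) :
    IsClosed {y : HilbertL2 d →L[ℂ] HilbertL2 d | y ∈ torus θ} := by
  simp only [mem_torus_iff, Set.ofPred_forall]
  exact isClosed_iInter fun b => isClosed_iInter fun _ => isClosed_iInter fun _ =>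
    isClosed_eq (by fun_prop) (by fun_prop)

theorem smul_mem_torus {θ : Matrix (Fin d) (Fin d) ℝ} (c : ℂ) {y : HilbertL2 d →L[ℂ] HilbertL2 d}
    (hy : y ∈ torus θ) : c • y ∈ torus θ :=
  (torus θ).toStarSubalgebra.smul_mem hy c

/-- Right multiplication by `U^n` on the GNS space. -/
def rightMonomial (θ : Matrix (Fin d) (Fin d) ℝ) (n : Fin d → ℤ) :
    HilbertL2 d →L[ℂ] HilbertL2 d :=
  (weightedShift (Equiv.subRight n) (fun l => cocycle θ (l - n) n)
    (fun l => norm_cocycle θ (l - n) n)).toContinuousLinearMap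

theorem rightMonomial_apply (θ : Matrix (Fin d) (Fin d) ℝ) (n : Fin d → ℤ) (f : HilbertL2 d)
    (l : Fin d → ℤ) : rightMonomial θ n f l = cocycle θ (l - n) n * f (l - n) := rfl

theorem monomial_mul_rightMonomial (θ : Matrix (Fin d) (Fin d) ℝ) (m n : Fin d → ℤ) :
    (monomial θ m : HilbertL2 d →L[ℂ] HilbertL2 d) * rightMonomial θ n =
      rightMonomial θ n * monomial θ m := by
  ext f l
  change (monomial θ m : HilbertL2 d →L[ℂ] HilbertL2 d) (rightMonomial θ n f) l =
    rightMonomial θ n ((monomial θ m : HilbertL2 d →L[ℂ] HilbertL2 d) f) l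
  rw [monomial_apply, rightMonomial_apply, rightMonomial_apply, monomial_apply]
  have h1 : cocycle θ m (l - m) = cocycle θ m (l - n - m) * cocycle θ m n := by
    rw [← cocycle_add_right]; congr 1; abel
  have h2 : cocycle θ (l - n) n = cocycle θ m n * cocycle θ (l - n - m) n := by
    rw [← cocycle_add_left]; congr 1; abel
  have h3 : l - m - n = l - n - m := by abel
  rw [h1, h2, h3]
  ring

/-- Right multiplications lie in the commutant because `cocycle` is a bicharacter. Consequently an
element of the torus is determined by its value on `vac d`. -/
theorem rightMonomial_comm {θ : Matrix (Fin d) (Fin d) ℝ} {y : HilbertL2 d →L[ℂ] HilbertL2 d}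
    (hy : y ∈ torus θ) (n : Fin d → ℤ) : rightMonomial θ n * y = y * rightMonomial θ n := by
  rw [mem_torus_iff] at hy
  refine hy _ (fun k => monomial_mul_rightMonomial θ _ n) (fun k => ?_)
  rw [gen, star_monomial, smul_mul_assoc, mul_smul_comm, monomial_mul_rightMonomial]

theorem rightMonomial_vac (θ : Matrix (Fin d) (Fin d) ℝ) (n : Fin d → ℤ) :
    rightMonomial θ n (vac d) = lp.single 2 n 1 := by
  ext l
  rw [rightMonomial_apply]
  rcases eq_or_ne l n with rfl | h
  · simp [vac, cocycle_zero_left]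
  · have : l - n ≠ 0 := sub_ne_zero.2 h
    simp [vac, h, this]

theorem monomial_vac (θ : Matrix (Fin d) (Fin d) ℝ) (n : Fin d → ℤ) :
    (monomial θ n : HilbertL2 d →L[ℂ] HilbertL2 d) (vac d) = lp.single 2 n 1 := by
  ext l
  rw [monomial_apply]
  rcases eq_or_ne l n with rfl | h
  · simp [vac, cocycle_zero_right]
  · have : l - n ≠ 0 := sub_ne_zero.2 h
    simp [vac, h, this]

theorem opCoeff_eq (θ : Matrix (Fin d) (Fin d) ℝ) (y : HilbertL2 d →L[ℂ] HilbertL2 d)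
    (m : Fin d → ℤ) : opCoeff θ y m = y (vac d) m := by
  rw [opCoeff, trace_star_mul, monomial_vac, lp.inner_single_left]
  simp

theorem apply_single_of_mem_torus {θ : Matrix (Fin d) (Fin d) ℝ}
    {y : HilbertL2 d →L[ℂ] HilbertL2 d} (hy : y ∈ torus θ) (n l : Fin d → ℤ) :
    y (lp.single 2 n 1) l = cocycle θ (l - n) n * y (vac d) (l - n) := by
  have h : y (lp.single 2 n 1) = rightMonomial θ n (y (vac d)) := by
    rw [← rightMonomial_vac θ n]
    exact (DFunLike.congr_fun (rightMonomial_comm hy n) (vac d)).symm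
  rw [h, rightMonomial_apply]

theorem hasSum_trace_mul {θ : Matrix (Fin d) (Fin d) ℝ} {a b : HilbertL2 d →L[ℂ] HilbertL2 d}
    (ha : a ∈ torus θ) :
    HasSum (fun m : Fin d → ℤ => b (vac d) m * (cocycle θ (-m) m * a (vac d) (-m)))
      (trace (a * b)) := by
  have h := lp.hasSum_single (p := 2) (by norm_num) (b (vac d))
  -- This composite, built from rank-one operators, is the continuous functional `f ↦ (a f)(0)`; it
  -- is applied to the basis expansion of `b (vac d)`.
  have h2 := h.mapL (traceCLM d ∘L (ContinuousLinearMap.mul ℂ _ a) ∘L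
      ((ContinuousLinearMap.smulRightL ℂ (HilbertL2 d) (HilbertL2 d) (innerSL ℂ (vac d)))))
  have key : ∀ f : HilbertL2 d, (traceCLM d ∘L (ContinuousLinearMap.mul ℂ _ a) ∘L
      ((ContinuousLinearMap.smulRightL ℂ (HilbertL2 d) (HilbertL2 d) (innerSL ℂ (vac d))))) f =
      a f 0 := by
    intro f
    change trace (a * (ContinuousLinearMap.smulRight (innerSL ℂ (vac d)) f)) = _
    rw [trace_eq_apply]
    simp [norm_vac]
  simp only [key] at h2
  rw [trace_eq_apply]
  convert! h2 using 1
  ext m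
  have : lp.single 2 m (b (vac d) m) = b (vac d) m • (lp.single 2 m 1 : HilbertL2 d) := by
    rw [← lp.single_smul]; simp
  rw [this, map_smul]
  simp [apply_single_of_mem_torus ha]

/-- The trace property. -/
theorem trace_mul_comm {θ : Matrix (Fin d) (Fin d) ℝ} {a b : HilbertL2 d →L[ℂ] HilbertL2 d}
    (ha : a ∈ torus θ) (hb : b ∈ torus θ) : trace (a * b) = trace (b * a) := by
  refine (hasSum_trace_mul (b := b) ha).unique ?_
  -- The substitution `m ↦ -m` exchanges the two coefficient expansions, up to the symmetry `c(m,-m)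
  -- = c(-m,m)`.
  rw [← (Equiv.neg (Fin d → ℤ)).hasSum_iff]
  convert! hasSum_trace_mul (b := a) hb using 1
  ext m
  have : cocycle θ m (-m) = cocycle θ (-m) m := by
    have h1 : cocycle θ m (-m) * cocycle θ m m = 1 := by
      rw [← cocycle_add_right, neg_add_cancel, cocycle_zero_right]
    have h2 : cocycle θ (-m) m * cocycle θ m m = 1 := by
      rw [← cocycle_add_left, neg_add_cancel, cocycle_zero_left]
    exact mul_right_cancel₀ (cocycle_ne_zero θ m m) (h1.trans h2.symm)
  simp only [Function.comp, Equiv.neg_apply, neg_neg, this]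
  ring

theorem gen_mem_torus (θ : Matrix (Fin d) (Fin d) ℝ) (k : Fin d) :
    (gen θ k : HilbertL2 d →L[ℂ] HilbertL2 d) ∈ torus θ :=
  mem_torus_iff.2 fun _ h _ => (h k).symm

theorem monomial_mem_torus (θ : Matrix (Fin d) (Fin d) ℝ) (m : Fin d → ℤ) :
    (monomial θ m : HilbertL2 d →L[ℂ] HilbertL2 d) ∈ torus θ := by
  let G : Subgroup (unitary (HilbertL2 d →L[ℂ] HilbertL2 d)) :=
    { carrier := {u | (u : HilbertL2 d →L[ℂ] HilbertL2 d) ∈ torus θ}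
      mul_mem' := fun {u v} ha hb => by
        have := mul_mem (show (u : HilbertL2 d →L[ℂ] HilbertL2 d) ∈ torus θ from ha)
          (show (v : HilbertL2 d →L[ℂ] HilbertL2 d) ∈ torus θ from hb)
        exact this
      one_mem' := one_mem (torus θ)
      inv_mem' := fun {u} ha =>
        show star (u : HilbertL2 d →L[ℂ] HilbertL2 d) ∈ torus θ from star_mem ha }
  suffices h : monomial θ m ∈ G from h
  rw [monomial_eq_prod]
  refine list_prod_mem fun u hu => ?_
  obtain ⟨k, rfl⟩ := List.mem_ofFn.1 hu
  exact zpow_mem (show gen θ k ∈ G from gen_mem_torus θ k) _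

end QTorus
end

noncomputable section

namespace QTorus

/-! ### Noncommutative `L_p`-norms of a tracial vector state -/

section TracialState

variable {H : Type*} [NormedAddCommGroup H] [InnerProductSpace ℂ H]

/-- The functional `y ↦ ⟨ξ, y ξ⟩`. -/
def vecState (ξ : H) : (H →L[ℂ] H) →L[ℂ] ℂ :=
  (innerSL ℂ ξ).comp (ContinuousLinearMap.apply ℂ H ξ)

theorem vecState_apply (ξ : H) (y : H →L[ℂ] H) : vecState ξ y = inner ℂ ξ (y ξ) := rfl

theorem vecState_re_nonneg (ξ : H) {a : H →L[ℂ] H} (ha : 0 ≤ a) : 0 ≤ (vecState ξ a).re := by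
  rw [ContinuousLinearMap.nonneg_iff_isPositive] at ha
  exact ha.re_inner_nonneg_right ξ

variable [CompleteSpace H]

theorem vecState_re_mono (ξ : H) {a b : H →L[ℂ] H} (h : a ≤ b) :
    (vecState ξ a).re ≤ (vecState ξ b).re := by
  have := vecState_re_nonneg ξ (sub_nonneg.2 h)
  rw [map_sub, Complex.sub_re] at this
  linarith

/-- A unit vector inducing a trace on a von Neumann algebra. -/
structure IsTraceVector (M : VonNeumannAlgebra H) (ξ : H) : Prop where
  norm_eq : ‖ξ‖ = 1
  comm : ∀ a ∈ M, ∀ b ∈ M, vecState ξ (a * b) = vecState ξ (b * a)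

/-- `⟨ξ, |y|^p ξ⟩^{1/p}`. -/
def vecNorm (ξ : H) (p : ℝ) (y : H →L[ℂ] H) : ℝ :=
  (vecState ξ (absPow p y)).re ^ (1 / p)

theorem vecState_star_mul (ξ : H) (a b : H →L[ℂ] H) :
    vecState ξ (star a * b) = inner ℂ (a ξ) (b ξ) := by
  rw [vecState_apply, ContinuousLinearMap.star_eq_adjoint]
  exact ContinuousLinearMap.adjoint_inner_right a _ _

/-- The bicommutant theorem in the form used for functional calculus: whatever commutes with `y` and
`y*` also commutes with `|y|`, and commutation passes likewise to exponentials and continuous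
functions. -/
theorem mem_of_forall_commutant {M : VonNeumannAlgebra H} {x : H →L[ℂ] H}
    (h : ∀ b ∈ M.commutant, Commute b x) : x ∈ M := by
  rw [← VonNeumannAlgebra.commutant_commutant M, VonNeumannAlgebra.mem_commutant_iff]
  exact h

theorem commute_of_mem_commutant {M : VonNeumannAlgebra H} {x b : H →L[ℂ] H} (hx : x ∈ M)
    (hb : b ∈ M.commutant) : Commute b x := by
  rw [VonNeumannAlgebra.mem_commutant_iff] at hb
  exact (hb x hx).symm

theorem cfc_mem_vonNeumann {M : VonNeumannAlgebra H} {y : H →L[ℂ] H} (hy : y ∈ M) (f : ℝ → ℝ) :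
    cfc f y ∈ M :=
  mem_of_forall_commutant fun _ hb =>
    ((commute_of_mem_commutant hy hb).symm.cfc_real f).symm

theorem abs_mem_vonNeumann {M : VonNeumannAlgebra H} {y : H →L[ℂ] H} (hy : y ∈ M) :
    CFC.abs y ∈ M :=
  mem_of_forall_commutant fun _ hb =>
    ((commute_of_mem_commutant hy hb).symm.cfcAbs_left
      (commute_of_mem_commutant hy (star_mem hb)).symm).symm

theorem smul_mem_vonNeumann {M : VonNeumannAlgebra H} {y : H →L[ℂ] H} (c : ℂ) (hy : y ∈ M) :
    c • y ∈ M :=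
  M.toStarSubalgebra.smul_mem hy c

theorem exp_smul_mem {M : VonNeumannAlgebra H} {y : H →L[ℂ] H} (c : ℂ) (hy : y ∈ M) :
    NormedSpace.exp (c • y) ∈ M :=
  mem_of_forall_commutant fun _ hb =>
    (commute_of_mem_commutant (smul_mem_vonNeumann c hy) hb).exp_right

variable {M : VonNeumannAlgebra H} {ξ : H}

/-- Cyclicity turns `τ(s* s c)` into `⟨s*ξ, c s*ξ⟩`, where Cauchy-Schwarz applies. -/
theorem IsTraceVector.norm_vecState_mul_le (h : IsTraceVector M ξ) {s c : H →L[ℂ] H} (hs : s ∈ M)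
    (hc : c ∈ M) : ‖vecState ξ (star s * s * c)‖ ≤ ‖c‖ * (vecState ξ (star s * s)).re := by
  have hs' : star s ∈ M := star_mem hs
  have h1 : vecState ξ (star s * s * c) = inner ℂ (star s ξ) (c (star s ξ)) := by
    rw [mul_assoc, h.comm _ hs' _ (mul_mem hs hc)]
    conv_lhs => rw [← star_star s]
    rw [mul_assoc, vecState_star_mul, star_star]
    rfl
  have h2 : (vecState ξ (star s * s)).re = ‖star s ξ‖ ^ 2 := by
    rw [h.comm _ hs' _ hs]
    conv_lhs => rw [← star_star s]
    rw [vecState_star_mul, star_star]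
    exact inner_self_eq_norm_sq (𝕜 := ℂ) (star s ξ)
  rw [h1, h2]
  calc _ ≤ ‖star s ξ‖ * ‖c (star s ξ)‖ := norm_inner_le_norm _ _
    _ ≤ ‖star s ξ‖ * (‖c‖ * ‖star s ξ‖) := by gcongr; exact c.le_opNorm _
    _ = _ := by ring

theorem isSelfAdjoint_ofReal_smul {L : H →L[ℂ] H} (hL : IsSelfAdjoint L) (t : ℝ) :
    IsSelfAdjoint ((t : ℂ) • L) := by
  rw [isSelfAdjoint_iff, star_smul, hL.star_eq]
  simp

theorem norm_unitary_le (u : unitary (H →L[ℂ] H)) : ‖(u : H →L[ℂ] H)‖ ≤ 1 := by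
  have h1 : ‖(u : H →L[ℂ] H)‖ * ‖(u : H →L[ℂ] H)‖ ≤ 1 := by
    rw [← CStarRing.norm_star_mul_self, Unitary.coe_star_mul_self]
    exact ContinuousLinearMap.norm_id_le
  nlinarith [norm_nonneg (u : H →L[ℂ] H)]

theorem norm_exp_I_smul_le {L : H →L[ℂ] H} (hL : IsSelfAdjoint L) (t : ℝ) :
    ‖NormedSpace.exp (((t : ℂ) * Complex.I) • L)‖ ≤ 1 := by
  have h := isSelfAdjoint_ofReal_smul hL t
  have := selfAdjoint.expUnitary_coe (⟨(t : ℂ) • L, h⟩ : selfAdjoint (H →L[ℂ] H))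
  rw [mul_comm, ← smul_smul]
  rw [← this]
  exact norm_unitary_le _

theorem exp_add_smul (L : H →L[ℂ] H) (z w : ℂ) :
    NormedSpace.exp ((z + w) • L) = NormedSpace.exp (z • L) * NormedSpace.exp (w • L) := by
  let +nondep : NormedAlgebra ℚ (H →L[ℂ] H) := .restrictScalars ℚ ℂ (H →L[ℂ] H)
  rw [add_smul, NormedSpace.exp_add_of_commute]
  exact ((Commute.refl L).smul_left z).smul_right w

theorem star_exp_ofReal_smul {L : H →L[ℂ] H} (hL : IsSelfAdjoint L) (t : ℝ) :
    star (NormedSpace.exp ((t : ℂ) • L)) = NormedSpace.exp ((t : ℂ) • L) := by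
  rw [NormedSpace.star_exp]
  have h := isSelfAdjoint_ofReal_smul hL t
  rw [h.star_eq]

/-- The boundary estimate for the interpolation argument: `e^{tL} = s* s` with `s = e^{tL/2}`. -/
theorem IsTraceVector.norm_vecState_exp_mul_le (h : IsTraceVector M ξ) {L c : H →L[ℂ] H}
    (hL : IsSelfAdjoint L) (hLM : L ∈ M) (hc : c ∈ M) (hc1 : ‖c‖ ≤ 1) (t : ℝ) :
    ‖vecState ξ (NormedSpace.exp ((t : ℂ) • L) * c)‖ ≤
      (vecState ξ (NormedSpace.exp ((t : ℂ) • L))).re := by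
  have h1 : NormedSpace.exp ((t : ℂ) • L) =
      star (NormedSpace.exp (((t / 2 : ℝ) : ℂ) • L)) * NormedSpace.exp (((t / 2 : ℝ) : ℂ) • L) := by
    rw [star_exp_ofReal_smul hL, ← exp_add_smul]
    congr 2
    push_cast
    ring
  have h2 := h.norm_vecState_mul_le (exp_smul_mem ((t / 2 : ℝ) : ℂ) hLM) hc
  have h3 : 0 ≤ (vecState ξ (NormedSpace.exp ((t : ℂ) • L))).re := by
    rw [h1]
    exact vecState_re_nonneg ξ (star_mul_self_nonneg _)
  rw [← h1] at h2
  exact h2.trans (mul_le_of_le_one_left h3 hc1)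

/-- Hölder's inequality, by complex interpolation. -/
theorem IsTraceVector.holder (h : IsTraceVector M ξ) {L₁ L₂ c : H →L[ℂ] H}
    (hL₁ : IsSelfAdjoint L₁) (hL₂ : IsSelfAdjoint L₂) (hM₁ : L₁ ∈ M) (hM₂ : L₂ ∈ M) (hc : c ∈ M)
    (hc1 : ‖c‖ ≤ 1) {p : ℝ} (hp : 1 ≤ p) :
    ‖vecState ξ (NormedSpace.exp (((p - 1 : ℝ) : ℂ) • L₁) * c * NormedSpace.exp L₂)‖ ≤
      (vecState ξ (NormedSpace.exp ((p : ℂ) • L₁))).re ^ (1 - 1 / p) *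
        (vecState ξ (NormedSpace.exp ((p : ℂ) • L₂))).re ^ (1 / p) := by
  have hp0 : 0 < p := by linarith
  -- The analytic family equals the left-hand side at `z = 1/p`, and only one real exponential
  -- survives on each of the lines `Re z = 0` and `Re z = 1`.
  let F : ℂ → ℂ := fun z => vecState ξ
    (NormedSpace.exp ((p * (1 - z)) • L₁) * c * NormedSpace.exp ((p * z) • L₂))
  have hdiff : Differentiable ℂ F := by
    have e : ∀ (L : H →L[ℂ] H), Differentiable ℂ fun z : ℂ => NormedSpace.exp (z • L) :=
      fun L z => (hasDerivAt_exp_smul_const L z).differentiableAt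
    refine (vecState ξ).differentiable.comp ?_
    have e1 : Differentiable ℂ fun z : ℂ => NormedSpace.exp ((p * (1 - z)) • L₁) :=
      (e L₁).comp (f := fun z : ℂ => (p : ℂ) * (1 - z)) (by fun_prop)
    have e2 : Differentiable ℂ fun z : ℂ => NormedSpace.exp ((p * z) • L₂) :=
      (e L₂).comp (f := fun z : ℂ => (p : ℂ) * z) (by fun_prop)
    exact (e1.mul_const c).mul e2
  -- The imaginary parts of the exponents give unitaries in `M`, which are absorbed into the
  -- contraction in the middle.
  have hmid : ∀ z : ℂ, ∃ c' ∈ M, ‖c'‖ ≤ 1 ∧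
      NormedSpace.exp ((p * (1 - z)) • L₁) * c * NormedSpace.exp ((p * z) • L₂) =
        NormedSpace.exp (((p * (1 - z.re) : ℝ) : ℂ) • L₁) * c' *
          NormedSpace.exp (((p * z.re : ℝ) : ℂ) • L₂) := by
    intro z
    refine ⟨NormedSpace.exp ((((-(p * z.im) : ℝ) : ℂ) * Complex.I) • L₁) * c *
      NormedSpace.exp ((((p * z.im : ℝ) : ℂ) * Complex.I) • L₂),
      mul_mem (mul_mem (exp_smul_mem _ hM₁) hc) (exp_smul_mem _ hM₂), ?_, ?_⟩
    · refine (norm_mul_le _ _).trans (mul_le_one₀ ((norm_mul_le _ _).trans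
        (mul_le_one₀ (norm_exp_I_smul_le hL₁ _) (norm_nonneg _) hc1)) (norm_nonneg _)
        (norm_exp_I_smul_le hL₂ _))
    · have e1 : (p * (1 - z) : ℂ) = ((p * (1 - z.re) : ℝ) : ℂ) +
          ((-(p * z.im) : ℝ) : ℂ) * Complex.I := by
        nth_rw 1 [← Complex.re_add_im z]; push_cast; ring
      have e2 : (p * z : ℂ) = ((p * z.im : ℝ) : ℂ) * Complex.I + ((p * z.re : ℝ) : ℂ) := by
        nth_rw 1 [← Complex.re_add_im z]; push_cast; ring
      rw [e1, e2, exp_add_smul, exp_add_smul]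
      simp only [mul_assoc]
  have hz : ((1 / p : ℝ) : ℂ) ∈ Complex.HadamardThreeLines.verticalClosedStrip 0 1 := by
    change ((1 / p : ℝ) : ℂ).re ∈ Set.Icc (0 : ℝ) 1
    rw [Complex.ofReal_re]
    exact ⟨by positivity, (div_le_one hp0).2 hp⟩
  have key := Complex.HadamardThreeLines.norm_le_interp_of_mem_verticalClosedStrip' (f := F)
    (z := ((1 / p : ℝ) : ℂ)) (a := (vecState ξ (NormedSpace.exp ((p : ℂ) • L₁))).re)
    (b := (vecState ξ (NormedSpace.exp ((p : ℂ) • L₂))).re) (l := 0) (u := 1) one_pos hz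
    hdiff.diffContOnCl ?_ ?_ ?_
  · simp only [Complex.ofReal_re, sub_zero, div_one] at key
    convert! key using 3
    have e1 : ((p - 1 : ℝ) : ℂ) = p * (1 - ((1 / p : ℝ) : ℂ)) := by
      have : (p : ℂ) ≠ 0 := by exact_mod_cast hp0.ne'
      push_cast; field_simp
    have e2 : (p : ℂ) * ((1 / p : ℝ) : ℂ) = 1 := by
      have : (p : ℂ) ≠ 0 := by exact_mod_cast hp0.ne'
      push_cast; field_simp
    rw [e1, e2, one_smul]
  -- By `hmid`, boundedness on the strip involves only real exponents from the compact interval `[0,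
  -- p]`.
  · have hE : ∀ L : H →L[ℂ] H, ∃ C, ∀ t : ℝ, 0 ≤ t → t ≤ p →
        ‖NormedSpace.exp ((t : ℂ) • L)‖ ≤ C := by
      intro L
      have hcont : Continuous fun t : ℝ => NormedSpace.exp ((t : ℂ) • L) :=
        (continuous_iff_continuousAt.2 fun z : ℂ =>
          (hasDerivAt_exp_smul_const L z).continuousAt).comp Complex.continuous_ofReal
      obtain ⟨C, hC⟩ := isCompact_Icc.exists_bound_of_continuousOn (s := Set.Icc 0 p)
        hcont.continuousOn
      exact ⟨C, fun t h0 h1 => hC t ⟨h0, h1⟩⟩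
    obtain ⟨C₁, hC₁⟩ := hE L₁
    obtain ⟨C₂, hC₂⟩ := hE L₂
    have hC₁0 : 0 ≤ C₁ := (norm_nonneg _).trans (hC₁ 0 le_rfl hp0.le)
    refine ⟨‖vecState ξ‖ * (C₁ * 1 * C₂), ?_⟩
    rintro _ ⟨z, hz, rfl⟩
    obtain ⟨hz0, hz1⟩ : 0 ≤ z.re ∧ z.re ≤ 1 := hz
    obtain ⟨c', -, hc', he⟩ := hmid z
    simp only [Function.comp, F, he]
    refine ((vecState ξ).le_opNorm _).trans ?_
    gcongr
    refine (norm_mul_le _ _).trans ?_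
    gcongr
    · refine (norm_mul_le _ _).trans ?_
      gcongr
      exact hC₁ _ (mul_nonneg hp0.le (by linarith)) (mul_le_of_le_one_right hp0.le (by linarith))
    · exact hC₂ _ (mul_nonneg hp0.le (by linarith)) (mul_le_of_le_one_right hp0.le (by linarith))
  · intro z hz
    have hz : z.re = 0 := hz
    obtain ⟨c', hc'M, hc', he⟩ := hmid z
    simp only [F, he, hz]
    simpa using h.norm_vecState_exp_mul_le hL₁ hM₁ hc'M hc' p
  · intro z hz
    have hz : z.re = 1 := hz
    obtain ⟨c', hc'M, hc', he⟩ := hmid z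
    simp only [F, he, hz]
    have := h.norm_vecState_exp_mul_le hL₂ hM₂ hc'M hc' p
    rw [h.comm _ (exp_smul_mem _ hM₂) _ hc'M] at this
    simpa using this

end TracialState

end QTorus
end

noncomputable section

namespace QTorus

/-! ### Duality for the norm of a tracial vector state. -/

section TracialStateDuality

variable {H : Type*} [NormedAddCommGroup H] [InnerProductSpace ℂ H] [CompleteSpace H]

/-- The operator `(|y| + δ)^s`. -/
def shiftPow (δ s : ℝ) (y : H →L[ℂ] H) : H →L[ℂ] H :=
  cfc (fun t : ℝ => (t + δ) ^ s) (CFC.abs y)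

theorem spectrum_abs_nonneg (y : H →L[ℂ] H) {t : ℝ} (ht : t ∈ spectrum ℝ (CFC.abs y)) : 0 ≤ t :=
  spectrum_nonneg_of_nonneg (CFC.abs_nonneg y) ht

theorem shiftPow_zero_left (s : ℝ) (y : H →L[ℂ] H) : shiftPow 0 s y = absPow s y := by
  simp [shiftPow, absPow]

theorem continuousOn_shift_rpow {δ : ℝ} (hδ : 0 < δ) (s : ℝ) (y : H →L[ℂ] H) :
    ContinuousOn (fun t : ℝ => (t + δ) ^ s) (spectrum ℝ (CFC.abs y)) := by
  refine ContinuousOn.rpow_const (by fun_prop) fun t ht => Or.inl ?_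
  have := spectrum_abs_nonneg y ht
  linarith

theorem isSelfAdjoint_shiftPow (δ s : ℝ) (y : H →L[ℂ] H) : IsSelfAdjoint (shiftPow δ s y) :=
  cfc_predicate _ _

theorem shiftPow_add {δ : ℝ} (hδ : 0 < δ) (s t : ℝ) (y : H →L[ℂ] H) :
    shiftPow δ (s + t) y = shiftPow δ s y * shiftPow δ t y := by
  rw [shiftPow, shiftPow, shiftPow, ← cfc_mul _ _ _ (continuousOn_shift_rpow hδ s y)
    (continuousOn_shift_rpow hδ t y)]
  refine cfc_congr fun r hr => ?_
  have := spectrum_abs_nonneg y hr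
  exact Real.rpow_add (by linarith) _ _

theorem shiftPow_zero_right (δ : ℝ) (y : H →L[ℂ] H) : shiftPow δ 0 y = 1 := by
  simp only [shiftPow, Real.rpow_zero]
  exact cfc_const_one ℝ _ 

/-- The operator `log (|y| + δ)`. -/
def shiftLog (δ : ℝ) (y : H →L[ℂ] H) : H →L[ℂ] H :=
  cfc (fun t : ℝ => Real.log (t + δ)) (CFC.abs y)

theorem isSelfAdjoint_shiftLog (δ : ℝ) (y : H →L[ℂ] H) : IsSelfAdjoint (shiftLog δ y) :=
  cfc_predicate _ _

/-- The shift `δ > 0` makes `|y| + δ` invertible, so its powers are exponentials of a bounded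
self-adjoint operator, the form required by `IsTraceVector.holder`. -/
theorem exp_smul_shiftLog {δ : ℝ} (hδ : 0 < δ) (s : ℝ) (y : H →L[ℂ] H) :
    NormedSpace.exp ((s : ℂ) • shiftLog δ y) = shiftPow δ s y := by
  have hcont : ContinuousOn (fun t : ℝ => Real.log (t + δ)) (spectrum ℝ (CFC.abs y)) := by
    refine ContinuousOn.log (by fun_prop) fun t ht => ?_
    have := spectrum_abs_nonneg y ht
    linarith
  have h1 : (s : ℂ) • shiftLog δ y = cfc (fun t : ℝ => s * Real.log (t + δ)) (CFC.abs y) := by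
    rw [cfc_const_mul _ _ _ hcont]
    rfl
  rw [h1, ← CFC.real_exp_eq_normedSpace_exp (cfc_predicate _ _), ← cfc_comp' Real.exp _ _
    (by fun_prop) (hcont.const_mul s |>.congr fun _ _ => rfl), shiftPow]
  refine cfc_congr fun r hr => ?_
  have := spectrum_abs_nonneg y hr
  rw [Real.rpow_def_of_pos (by linarith), mul_comm]

/-- The operator `b = y (|y| + δ)^{-1}` replaces the partial isometry of the polar decomposition: `y
= b (|y| + δ)` holds exactly, and `b* b = (|y|/(|y| + δ))^2 ≤ 1`. -/
theorem norm_mul_shiftPow_neg_one_le {δ : ℝ} (hδ : 0 < δ) (y : H →L[ℂ] H) :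
    ‖y * shiftPow δ (-1) y‖ ≤ 1 := by
  have hid : CFC.abs y = cfc (fun t : ℝ => t) (CFC.abs y) := (cfc_id' ℝ (CFC.abs y)).symm
  have h1 : star (y * shiftPow δ (-1) y) * (y * shiftPow δ (-1) y) =
      cfc (fun t : ℝ => (t + δ) ^ (-1 : ℝ) * t * (t * (t + δ) ^ (-1 : ℝ))) (CFC.abs y) := by
    have hc := continuousOn_shift_rpow hδ (-1) y
    rw [cfc_mul (fun t : ℝ => (t + δ) ^ (-1 : ℝ) * t) (fun t : ℝ => t * (t + δ) ^ (-1 : ℝ)) _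
      (hc.mul continuousOn_id) (continuousOn_id.mul hc),
      cfc_mul _ (fun t : ℝ => t) _ hc continuousOn_id,
      cfc_mul (fun t : ℝ => t) _ _ continuousOn_id hc, ← hid, star_mul, (isSelfAdjoint_shiftPow _ _ _).star_eq]
    change shiftPow δ (-1) y * star y * _ = shiftPow δ (-1) y * _ * (_ * shiftPow δ (-1) y)
    rw [mul_assoc, ← mul_assoc (star y), ← CFC.abs_mul_abs]
    simp only [mul_assoc]
  have h2 : ‖y * shiftPow δ (-1) y‖ * ‖y * shiftPow δ (-1) y‖ ≤ 1 := by
    rw [← CStarRing.norm_star_mul_self, h1]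
    refine norm_cfc_le zero_le_one fun t ht => ?_
    have h0 := spectrum_abs_nonneg y ht
    have h3 : 0 ≤ t * (t + δ) ^ (-1 : ℝ) := by positivity
    have h4 : t * (t + δ) ^ (-1 : ℝ) ≤ 1 := by
      rw [Real.rpow_neg_one, ← div_eq_mul_inv, div_le_one (by linarith)]
      linarith
    rw [mul_comm _ t, Real.norm_of_nonneg (mul_nonneg h3 h3)]
    exact mul_le_one₀ h4 h3 h4
  nlinarith [norm_nonneg (y * shiftPow δ (-1) y)]

theorem mul_shiftPow_neg_one_mul {δ : ℝ} (hδ : 0 < δ) (y : H →L[ℂ] H) :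
    y * shiftPow δ (-1) y * shiftPow δ 1 y = y := by
  rw [mul_assoc, ← shiftPow_add hδ, neg_add_cancel, shiftPow_zero_right, mul_one]

/-- For `s ≥ 0` the function `(t + δ)^s` is jointly continuous, so it converges uniformly on the
compact spectrum as `δ → 0`. -/
theorem tendsto_shiftPow {s : ℝ} (hs : 0 ≤ s) (y : H →L[ℂ] H) :
    Filter.Tendsto (fun δ => shiftPow δ s y) (nhdsWithin 0 (Set.Ioi 0)) (nhds (absPow s y)) := by
  rw [← shiftPow_zero_left]
  have hcont : Continuous (Function.uncurry fun δ t : ℝ => (t + δ) ^ s) := by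
    refine Continuous.rpow_const (by fun_prop) fun _ => Or.inr hs
  refine (tendsto_cfc_fun (F := fun δ t : ℝ => (t + δ) ^ s) ?_ ?_).mono_left nhdsWithin_le_nhds
  · intro u hu
    obtain ⟨v, hv, h⟩ := (ContinuousFunctionalCalculus.isCompact_spectrum
      (R := ℝ) (CFC.abs y)).mem_uniformity_of_prod
        (s := Set.univ) hcont.continuousOn (Set.mem_univ (0 : ℝ)) (symm_le_uniformity hu)
    rw [nhdsWithin_univ] at hv
    filter_upwards [hv] with δ hδ t ht using h δ hδ t ht
  · exact Filter.Eventually.of_forall fun δ =>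
      (Continuous.rpow_const (by fun_prop) fun _ => Or.inr hs).continuousOn

variable {M : VonNeumannAlgebra H} {ξ : H}

theorem shiftPow_mem {y : H →L[ℂ] H} (hy : y ∈ M) (δ s : ℝ) : shiftPow δ s y ∈ M :=
  cfc_mem_vonNeumann (abs_mem_vonNeumann hy) _

theorem shiftLog_mem {y : H →L[ℂ] H} (hy : y ∈ M) (δ : ℝ) : shiftLog δ y ∈ M :=
  cfc_mem_vonNeumann (abs_mem_vonNeumann hy) _

theorem vecNorm_nonneg (ξ : H) (p : ℝ) (y : H →L[ℂ] H) : 0 ≤ vecNorm ξ p y :=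
  Real.rpow_nonneg (vecState_re_nonneg ξ (cfc_nonneg fun _ ht =>
    Real.rpow_nonneg (spectrum_abs_nonneg y ht) p)) _

theorem tendsto_vecState_shiftPow {s : ℝ} (hs : 0 ≤ s) (y : H →L[ℂ] H) :
    Filter.Tendsto (fun δ => (vecState ξ (shiftPow δ s y)).re) (nhdsWithin 0 (Set.Ioi 0))
      (nhds (vecState ξ (absPow s y)).re) :=
  (Complex.continuous_re.tendsto _).comp (((vecState ξ).continuous.tendsto _).comp
    (tendsto_shiftPow hs y))

/-- Writing `w = b (|w| + δ)` with a contraction `b`, Hölder's inequality applies with `c b` in the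
middle; then `δ → 0`. -/
theorem IsTraceVector.norm_vecState_exp_mul_le_vecNorm (h : IsTraceVector M ξ)
    {L c w : H →L[ℂ] H} (hL : IsSelfAdjoint L) (hLM : L ∈ M) (hc : c ∈ M) (hc1 : ‖c‖ ≤ 1)
    (hw : w ∈ M) {p : ℝ} (hp : 1 ≤ p) :
    ‖vecState ξ (NormedSpace.exp (((p - 1 : ℝ) : ℂ) • L) * c * w)‖ ≤
      (vecState ξ (NormedSpace.exp ((p : ℂ) • L))).re ^ (1 - 1 / p) * vecNorm ξ p w := by
  have hp0 : 0 < p := by linarith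
  have hlim := ((tendsto_vecState_shiftPow (ξ := ξ) hp0.le w).rpow_const (p := 1 / p)
    (Or.inr (by positivity))).const_mul
      ((vecState ξ (NormedSpace.exp ((p : ℂ) • L))).re ^ (1 - 1 / p))
  refine ge_of_tendsto hlim ?_
  filter_upwards [self_mem_nhdsWithin] with δ hδ
  have hδ : 0 < δ := hδ
  have h1 := h.holder hL (isSelfAdjoint_shiftLog δ w) hLM (shiftLog_mem hw δ)
    (mul_mem hc (mul_mem hw (shiftPow_mem hw δ (-1))))
    ((norm_mul_le _ _).trans (mul_le_one₀ hc1 (norm_nonneg _)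
      (norm_mul_shiftPow_neg_one_le hδ w))) hp
  have h2 := exp_smul_shiftLog hδ 1 w
  rw [Complex.ofReal_one, one_smul] at h2
  rw [h2, exp_smul_shiftLog hδ, mul_assoc, mul_assoc c, mul_shiftPow_neg_one_mul hδ,
    ← mul_assoc] at h1
  exact h1

theorem IsTraceVector.norm_vecState_mul_le_vecNorm (h : IsTraceVector M ξ)
    {c w : H →L[ℂ] H} (hc : c ∈ M) (hc1 : ‖c‖ ≤ 1) (hw : w ∈ M) {p : ℝ} (hp : 1 ≤ p) :
    ‖vecState ξ (c * w)‖ ≤ vecNorm ξ p w := by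
  have h1 := h.norm_vecState_exp_mul_le_vecNorm (IsSelfAdjoint.zero _) (zero_mem M) hc hc1 hw hp
  have h2 : vecState ξ (1 : H →L[ℂ] H) = 1 := by
    simp [vecState_apply, h.norm_eq]
  simpa [h2] using h1

/-- The unit ball of the dual norm of `vecNorm ξ p`. -/
def dualBall (M : VonNeumannAlgebra H) (ξ : H) (p : ℝ) : Set (H →L[ℂ] H) :=
  {z | z ∈ M ∧ ∀ w ∈ M, ‖vecState ξ (star z * w)‖ ≤ vecNorm ξ p w}

theorem zero_mem_dualBall (p : ℝ) : (0 : H →L[ℂ] H) ∈ dualBall M ξ p :=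
  ⟨zero_mem M, fun w _ => by simpa using vecNorm_nonneg ξ p w⟩

theorem IsTraceVector.vecState_shiftPow_pos (h : IsTraceVector M ξ) {δ : ℝ} (hδ : 0 < δ) {s : ℝ}
    (hs : 0 ≤ s) (y : H →L[ℂ] H) : 0 < (vecState ξ (shiftPow δ s y)).re := by
  have h1 : algebraMap ℝ (H →L[ℂ] H) (δ ^ s) ≤ shiftPow δ s y := by
    rw [← cfc_const (δ ^ s) (CFC.abs y)]
    refine cfc_mono (fun t ht => ?_) (by fun_prop) (continuousOn_shift_rpow hδ s y)
    have := spectrum_abs_nonneg y ht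
    exact Real.rpow_le_rpow hδ.le (by linarith) hs
  refine lt_of_lt_of_le ?_ (vecState_re_mono ξ h1)
  have h2 : vecState ξ (algebraMap ℝ (H →L[ℂ] H) (δ ^ s)) = ((δ ^ s : ℝ) : ℂ) := by
    rw [Algebra.algebraMap_eq_smul_one, vecState_apply]
    change inner ℂ ξ (((δ ^ s : ℝ) : ℂ) • ξ) = _
    rw [inner_smul_right, inner_self_eq_norm_sq_to_K, h.norm_eq]
    simp
  rw [h2, Complex.ofReal_re]
  positivity

theorem star_smul_mul_shiftPow_mul (K δ s : ℝ) (y b w : H →L[ℂ] H) :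
    star ((K : ℂ) • (b * shiftPow δ s y)) * w = (K : ℂ) • (shiftPow δ s y * star b * w) := by
  rw [star_smul, star_mul, (isSelfAdjoint_shiftPow _ _ _).star_eq, smul_mul_assoc]
  congr 1
  exact Complex.conj_ofReal K

/-- The regularised extremal functional for `y`: classically one pairs with `sgn(y) |y|^{p-1} /
‖y‖_p^{p-1}`. -/
theorem IsTraceVector.normalized_mem_dualBall (h : IsTraceVector M ξ) {p : ℝ} (hp : 1 ≤ p)
    {δ : ℝ} (hδ : 0 < δ) {y : H →L[ℂ] H} (hy : y ∈ M) :
    ((((vecState ξ (shiftPow δ p y)).re ^ (1 - 1 / p))⁻¹ : ℝ) : ℂ) •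
      (y * shiftPow δ (-1) y * shiftPow δ (p - 1) y) ∈ dualBall M ξ p := by
  have hp0 : 0 < p := by linarith
  have hb : y * shiftPow δ (-1) y ∈ M := mul_mem hy (shiftPow_mem hy _ _)
  refine ⟨smul_mem_vonNeumann _ (mul_mem hb (shiftPow_mem hy _ _)), fun w hw => ?_⟩
  have hpos := Real.rpow_pos_of_pos (h.vecState_shiftPow_pos hδ hp0.le y) (1 - 1 / p)
  have h1 := h.norm_vecState_exp_mul_le_vecNorm (isSelfAdjoint_shiftLog δ y) (shiftLog_mem hy δ)
    (star_mem hb) ((norm_star _).trans_le (norm_mul_shiftPow_neg_one_le hδ y)) hw hp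
  rw [exp_smul_shiftLog hδ, exp_smul_shiftLog hδ] at h1
  rw [star_smul_mul_shiftPow_mul, map_smul, norm_smul, Complex.norm_real, norm_inv,
    Real.norm_of_nonneg hpos.le, inv_mul_le_iff₀ hpos]
  exact h1

/-- The right-hand side is the state of `(|y| + δ)^{p-2} |y|^2`, and `t^2 ≥ (t + δ)^2 - 2δ(t + δ)`.
The correction vanishes as `δ → 0`. -/
theorem le_vecState_shiftPow_mul {δ : ℝ} (hδ : 0 < δ) (p : ℝ) (y : H →L[ℂ] H) :
    (vecState ξ (shiftPow δ p y)).re - 2 * δ * (vecState ξ (shiftPow δ (p - 1) y)).re ≤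
      (vecState ξ (shiftPow δ (p - 1) y * star (y * shiftPow δ (-1) y) * y)).re := by
  have hc := continuousOn_shift_rpow hδ (p - 2) y
  have hid : CFC.abs y = cfc (fun t : ℝ => t) (CFC.abs y) := (cfc_id' ℝ (CFC.abs y)).symm
  have h1 : shiftPow δ (p - 1) y * star (y * shiftPow δ (-1) y) * y =
      cfc (fun t : ℝ => (t + δ) ^ (p - 2) * (t * t)) (CFC.abs y) := by
    have e1 : cfc (fun t : ℝ => t * t) (CFC.abs y) = star y * y := by
      rw [cfc_mul (fun t : ℝ => t) (fun t : ℝ => t) _, ← hid, CFC.abs_mul_abs]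
    rw [cfc_mul _ (fun t : ℝ => t * t) _ hc (by fun_prop), e1, star_mul,
      (isSelfAdjoint_shiftPow _ _ _).star_eq, ← mul_assoc, ← shiftPow_add hδ, mul_assoc]
    congr 2
    ring
  have h2 : shiftPow δ p y - (2 * δ) • shiftPow δ (p - 1) y ≤
      cfc (fun t : ℝ => (t + δ) ^ (p - 2) * (t * t)) (CFC.abs y) := by
    have hc1 : ContinuousOn (fun t : ℝ => 2 * δ * (t + δ) ^ (p - 1)) (spectrum ℝ (CFC.abs y)) :=
      continuousOn_const.mul (continuousOn_shift_rpow hδ (p - 1) y)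
    rw [shiftPow, shiftPow, ← cfc_const_mul _ _ _ (continuousOn_shift_rpow hδ (p - 1) y),
      ← cfc_sub _ _ _ (continuousOn_shift_rpow hδ p y)
        hc1]
    refine cfc_mono (fun t ht => ?_) ((continuousOn_shift_rpow hδ p y).sub hc1)
      (hc.mul (by fun_prop))
    have ht0 := spectrum_abs_nonneg y ht
    have hu : 0 < t + δ := by linarith
    have e1 : (t + δ) ^ p = (t + δ) ^ (p - 2) * (t + δ) ^ 2 := by
      rw [← Real.rpow_natCast, ← Real.rpow_add hu]; congr 1; push_cast; ring
    have e2 : (t + δ) ^ (p - 1) = (t + δ) ^ (p - 2) * (t + δ) := by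
      rw [← Real.rpow_add_one hu.ne']; congr 1; ring
    have e3 : 0 ≤ (t + δ) ^ (p - 2) * δ ^ 2 := by positivity
    rw [e1, e2]
    nlinarith
  have h3 := vecState_re_mono ξ h2
  rw [← h1] at h3
  refine le_trans (le_of_eq ?_) h3
  have : ((2 * δ) • shiftPow δ (p - 1) y : H →L[ℂ] H) =
      ((2 * δ : ℝ) : ℂ) • shiftPow δ (p - 1) y := rfl
  rw [this, map_sub, map_smul, Complex.sub_re, smul_eq_mul, Complex.re_ofReal_mul]

/-- The norm is attained on the unit ball of the dual norm. -/
theorem IsTraceVector.vecNorm_le_of_dualBall (h : IsTraceVector M ξ) {p : ℝ} (hp : 1 ≤ p)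
    {y : H →L[ℂ] H} (hy : y ∈ M) {r : ℝ}
    (hr : ∀ z ∈ dualBall M ξ p, ‖vecState ξ (star z * y)‖ ≤ r) : vecNorm ξ p y ≤ r := by
  have hp0 : 0 < p := by linarith
  have hr0 : 0 ≤ r := (norm_nonneg _).trans (hr 0 (zero_mem_dualBall p))
  set a := (vecState ξ (absPow p y)).re with ha
  have ha0 : 0 ≤ a := vecState_re_nonneg ξ (cfc_nonneg fun t ht =>
    Real.rpow_nonneg (spectrum_abs_nonneg y ht) p)
  have hexp : 0 ≤ 1 - 1 / p := by
    rw [sub_nonneg, div_le_one hp0]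
    exact hp
  -- Test `hr` on the regularised extremal element and let `δ → 0`. Division by `a ^ (1 - 1 / p)`
  -- then gives the claim when `a > 0`.
  have key : a ≤ r * a ^ (1 - 1 / p) := by
    have l1 := tendsto_vecState_shiftPow (ξ := ξ) hp0.le y
    have l2 := tendsto_vecState_shiftPow (ξ := ξ) (sub_nonneg.2 hp) y
    have l3 : Filter.Tendsto (fun δ : ℝ => 2 * δ) (nhdsWithin 0 (Set.Ioi 0)) (nhds (2 * 0)) :=
      ((continuous_const.mul continuous_id).tendsto (0 : ℝ)).mono_left nhdsWithin_le_nhds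
    have l4 := l1.sub (l3.mul l2)
    have l5 := (l1.rpow_const (p := 1 - 1 / p) (Or.inr hexp)).const_mul r
    rw [mul_zero, zero_mul, sub_zero] at l4
    refine le_of_tendsto_of_tendsto l4 l5 ?_
    filter_upwards [self_mem_nhdsWithin] with δ hδ
    have hδ : 0 < δ := hδ
    have hpos := Real.rpow_pos_of_pos (h.vecState_shiftPow_pos hδ hp0.le y) (1 - 1 / p)
    have h1 := hr _ (h.normalized_mem_dualBall hp hδ hy)
    rw [star_smul_mul_shiftPow_mul, map_smul, norm_smul, Complex.norm_real, norm_inv,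
      Real.norm_of_nonneg hpos.le, inv_mul_le_iff₀ hpos] at h1
    calc _ ≤ _ := le_vecState_shiftPow_mul hδ p y
      _ ≤ _ := Complex.re_le_norm _
      _ ≤ _ := h1
      _ = _ := mul_comm _ _
  rcases ha0.eq_or_lt with h0 | h0
  · rw [vecNorm, ← ha, ← h0, Real.zero_rpow (by positivity)]
    exact hr0
  · rw [vecNorm, ← ha]
    refine le_of_mul_le_mul_right ?_ (Real.rpow_pos_of_pos h0 (1 - 1 / p))
    rwa [← Real.rpow_add h0, add_sub_cancel, Real.rpow_one]

/-- By duality the norm is a supremum of moduli of linear functionals. -/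
theorem IsTraceVector.vecNorm_add_le (h : IsTraceVector M ξ) {p : ℝ} (hp : 1 ≤ p)
    {a b : H →L[ℂ] H} (ha : a ∈ M) (hb : b ∈ M) :
    vecNorm ξ p (a + b) ≤ vecNorm ξ p a + vecNorm ξ p b := by
  refine h.vecNorm_le_of_dualBall hp (add_mem ha hb) fun z hz => ?_
  rw [mul_add, map_add]
  exact (norm_add_le _ _).trans (add_le_add (hz.2 a ha) (hz.2 b hb))

theorem IsTraceVector.vecNorm_smul_le (h : IsTraceVector M ξ) {p : ℝ} (hp : 1 ≤ p) (c : ℂ)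
    {a : H →L[ℂ] H} (ha : a ∈ M) : vecNorm ξ p (c • a) ≤ ‖c‖ * vecNorm ξ p a := by
  refine h.vecNorm_le_of_dualBall hp (smul_mem_vonNeumann c ha) fun z hz => ?_
  rw [mul_smul_comm, map_smul, norm_smul]
  exact mul_le_mul_of_nonneg_left (hz.2 a ha) (norm_nonneg c)

/-- Conjugation by a unitary fixing the trace vector preserves the norm. -/
theorem vecNorm_conj (u : unitary (H →L[ℂ] H))
    (hu : star (u : H →L[ℂ] H) ξ = ξ) (p : ℝ) (hp : 0 ≤ p) (y : H →L[ℂ] H) :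
    vecNorm ξ p (u * y * star (u : H →L[ℂ] H)) = vecNorm ξ p y := by
  have hstate : ∀ x : H →L[ℂ] H, vecState ξ (u * x * star (u : H →L[ℂ] H)) = vecState ξ x := by
    intro x
    have := vecState_star_mul ξ (star (u : H →L[ℂ] H)) (x * star (u : H →L[ℂ] H))
    rw [star_star, ← mul_assoc] at this
    rw [this]
    change inner ℂ (star (u : H →L[ℂ] H) ξ) (x (star (u : H →L[ℂ] H) ξ)) = _
    rw [hu]
    rfl
  let Φ := Unitary.conjStarAlgAut ℂ (H →L[ℂ] H) u
  have hΦ : ∀ x, Φ x = u * x * star (u : H →L[ℂ] H) := fun x => rfl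
  have hΦc : Continuous Φ := by
    change Continuous fun x => (u : H →L[ℂ] H) * x * star (u : H →L[ℂ] H)
    fun_prop
  -- Uniqueness of the positive square root; the functional calculus then commutes with the
  -- automorphism `Φ`.
  have habs : CFC.abs (Φ y) = Φ (CFC.abs y) := by
    have h1 : 0 ≤ Φ (CFC.abs y) := by
      rw [hΦ]
      simpa using star_left_conjugate_nonneg (CFC.abs_nonneg y) (star (u : H →L[ℂ] H))
    rw [CFC.abs, CFC.sqrt_eq_iff _ _ (star_mul_self_nonneg _) h1, ← map_mul, CFC.abs_mul_abs,
      map_mul, map_star]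
  have hpow : absPow p (Φ y) = Φ (absPow p y) := by
    rw [absPow, absPow, habs]
    refine (StarAlgHomClass.map_cfc (S := ℂ) Φ _ _ ?_ hΦc ?_ ?_).symm
    · exact (Continuous.rpow_const continuous_id fun _ => Or.inr hp).continuousOn
    · exact (CFC.abs_nonneg y).isSelfAdjoint
    · exact habs ▸ (CFC.abs_nonneg (Φ y)).isSelfAdjoint
  rw [vecNorm, vecNorm, ← hΦ, hpow, hΦ, hstate]

end TracialStateDuality
end QTorus
end

noncomputable section

namespace QTorus

variable {d : ℕ}

/-! ### The dual action of the torus and its averages -/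

/-- The character `e^{2πi v·m}`. -/
def phase (v : EuclideanSpace ℝ (Fin d)) (m : Fin d → ℤ) : ℂ :=
  Complex.exp (((2 * Real.pi * inner ℝ v (latticePoint m) : ℝ) : ℂ) * Complex.I)

theorem norm_phase (v : EuclideanSpace ℝ (Fin d)) (m : Fin d → ℤ) : ‖phase v m‖ = 1 :=
  Complex.norm_exp_ofReal_mul_I _

theorem latticePoint_zero : latticePoint (0 : Fin d → ℤ) = 0 := by
  ext j
  simp [latticePoint]

theorem latticePoint_add (m n : Fin d → ℤ) :
    latticePoint (m + n) = latticePoint m + latticePoint n := by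
  ext j
  simp [latticePoint]

theorem phase_zero_right (v : EuclideanSpace ℝ (Fin d)) : phase v 0 = 1 := by
  simp [phase, latticePoint_zero]

theorem phase_zero_left (m : Fin d → ℤ) : phase 0 m = 1 := by
  simp [phase]

theorem phase_add_right (v : EuclideanSpace ℝ (Fin d)) (m n : Fin d → ℤ) :
    phase v (m + n) = phase v m * phase v n := by
  rw [phase, phase, phase, ← Complex.exp_add, latticePoint_add, inner_add_right]
  congr 1
  push_cast
  ring

theorem phase_add_left (v w : EuclideanSpace ℝ (Fin d)) (m : Fin d → ℤ) :
    phase (v + w) m = phase v m * phase w m := by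
  rw [phase, phase, phase, ← Complex.exp_add, inner_add_left]
  congr 1
  push_cast
  ring

theorem phase_neg_left_mul (v : EuclideanSpace ℝ (Fin d)) (m : Fin d → ℤ) :
    phase (-v) m * phase v m = 1 := by
  rw [← phase_add_left, neg_add_cancel, phase_zero_left]

theorem continuous_phase (m : Fin d → ℤ) :
    Continuous fun v : EuclideanSpace ℝ (Fin d) => phase v m := by
  unfold phase
  fun_prop

/-- The diagonal unitary `e_m ↦ e^{2πi v·m} e_m` implementing the dual action. -/
def dualUnitary (v : EuclideanSpace ℝ (Fin d)) : unitary (HilbertL2 d →L[ℂ] HilbertL2 d) :=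
  Unitary.linearIsometryEquiv.symm
    (LinearIsometryEquiv.ofSurjective
      (weightedShift (Equiv.refl _) (phase v) (norm_phase v))
      (weightedShift_surjective _ _ _))

theorem dualUnitary_apply (v : EuclideanSpace ℝ (Fin d)) (f : HilbertL2 d) (m : Fin d → ℤ) :
    (dualUnitary v : HilbertL2 d →L[ℂ] HilbertL2 d) f m = phase v m * f m := rfl

theorem norm_dualUnitary_apply (v : EuclideanSpace ℝ (Fin d)) (f : HilbertL2 d) :
    ‖(dualUnitary v : HilbertL2 d →L[ℂ] HilbertL2 d) f‖ = ‖f‖ :=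
  (weightedShift (Equiv.refl _) (phase v) (norm_phase v)).norm_map f

theorem star_dualUnitary (v : EuclideanSpace ℝ (Fin d)) :
    star (dualUnitary v : HilbertL2 d →L[ℂ] HilbertL2 d) = dualUnitary (-v) := by
  have h : (dualUnitary (d := d) (-v) : HilbertL2 d →L[ℂ] HilbertL2 d) * dualUnitary v = 1 := by
    ext f m
    change phase (-v) m * (phase v m * f m) = f m
    rw [← mul_assoc, phase_neg_left_mul, one_mul]
  calc star (dualUnitary v : HilbertL2 d →L[ℂ] HilbertL2 d)
      = (dualUnitary (d := d) (-v) : HilbertL2 d →L[ℂ] HilbertL2 d) * dualUnitary v *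
        star (dualUnitary v : HilbertL2 d →L[ℂ] HilbertL2 d) := by rw [h, one_mul]
    _ = _ := by rw [mul_assoc, Unitary.mul_star_self_of_mem (dualUnitary v).2, mul_one]

theorem dualUnitary_vac (v : EuclideanSpace ℝ (Fin d)) :
    (dualUnitary v : HilbertL2 d →L[ℂ] HilbertL2 d) (vac d) = vac d := by
  ext m
  rw [dualUnitary_apply]
  rcases eq_or_ne m 0 with rfl | h
  · rw [phase_zero_right, one_mul]
  · simp [vac, h]

theorem dualUnitary_mul_monomial (θ : Matrix (Fin d) (Fin d) ℝ) (v : EuclideanSpace ℝ (Fin d))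
    (m : Fin d → ℤ) : (dualUnitary v : HilbertL2 d →L[ℂ] HilbertL2 d) * monomial θ m =
      phase v m • ((monomial θ m : HilbertL2 d →L[ℂ] HilbertL2 d) * dualUnitary v) := by
  ext f l
  change phase v l * (cocycle θ m (l - m) * f (l - m)) =
    phase v m * (cocycle θ m (l - m) * (phase v (l - m) * f (l - m)))
  have : phase v l = phase v m * phase v (l - m) := by
    rw [← phase_add_right, add_sub_cancel]
  rw [this]
  ring

/-- The dual action `U^m ↦ e^{2πi v·m} U^m`. -/
def dualAction (v : EuclideanSpace ℝ (Fin d)) (y : HilbertL2 d →L[ℂ] HilbertL2 d) :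
    HilbertL2 d →L[ℂ] HilbertL2 d :=
  (dualUnitary v : HilbertL2 d →L[ℂ] HilbertL2 d) * y *
    star (dualUnitary v : HilbertL2 d →L[ℂ] HilbertL2 d)

theorem monomial_mul_dualAction (θ : Matrix (Fin d) (Fin d) ℝ) (v : EuclideanSpace ℝ (Fin d))
    (m : Fin d → ℤ) (b : HilbertL2 d →L[ℂ] HilbertL2 d)
    (h : (monomial θ m : HilbertL2 d →L[ℂ] HilbertL2 d) * b = b * monomial θ m) :
    (monomial θ m : HilbertL2 d →L[ℂ] HilbertL2 d) * dualAction v b =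
      dualAction v b * monomial θ m := by
  have h1 := dualUnitary_mul_monomial θ v m
  have h2 := dualUnitary_mul_monomial θ (-v) m
  have hne : phase v m ≠ 0 := by
    rw [← norm_ne_zero_iff, norm_phase]; exact one_ne_zero
  have h1' : (monomial θ m : HilbertL2 d →L[ℂ] HilbertL2 d) * dualUnitary v =
      phase (-v) m • ((dualUnitary v : HilbertL2 d →L[ℂ] HilbertL2 d) * monomial θ m) := by
    rw [h1, smul_smul, phase_neg_left_mul, one_smul]
  rw [dualAction, star_dualUnitary, ← mul_assoc, ← mul_assoc, h1', mul_assoc _ _ (monomial θ m :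
    HilbertL2 d →L[ℂ] HilbertL2 d), h2, smul_mul_assoc, smul_mul_assoc, mul_smul_comm,
    mul_assoc _ _ b, h]
  simp only [mul_assoc]

/-- Conjugation by `dualUnitary v` multiplies each monomial by a scalar, so it preserves the
commutant of the generators and hence the bicommutant. -/
theorem dualAction_mem {θ : Matrix (Fin d) (Fin d) ℝ} {y : HilbertL2 d →L[ℂ] HilbertL2 d}
    (hy : y ∈ torus θ) (v : EuclideanSpace ℝ (Fin d)) : dualAction v y ∈ torus θ := by
  rw [mem_torus_iff] at hy ⊢
  intro b hb1 hb2
  have hb2' : ∀ k, (monomial θ (-Pi.single k 1) : HilbertL2 d →L[ℂ] HilbertL2 d) * b =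
      b * monomial θ (-Pi.single k 1) := by
    intro k
    have := hb2 k
    rw [gen, star_monomial, smul_mul_assoc, mul_smul_comm] at this
    exact smul_right_injective _ (cocycle_ne_zero θ _ _) this
  have h := hy (dualAction (-v) b) (fun k => monomial_mul_dualAction θ _ _ b (hb1 k))
    (fun k => by
      rw [gen, star_monomial, smul_mul_assoc, mul_smul_comm,
        monomial_mul_dualAction θ _ _ b (hb2' k)])
  have e1 : star (dualUnitary v : HilbertL2 d →L[ℂ] HilbertL2 d) * dualUnitary v = 1 :=
    Unitary.coe_star_mul_self _
  have e2 : (dualUnitary v : HilbertL2 d →L[ℂ] HilbertL2 d) *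
      star (dualUnitary v : HilbertL2 d →L[ℂ] HilbertL2 d) = 1 := Unitary.coe_mul_star_self _
  rw [dualAction, ← star_dualUnitary, star_star] at h
  rw [dualAction]
  set V := (dualUnitary v : HilbertL2 d →L[ℂ] HilbertL2 d)
  calc b * (V * y * star V) = V * (star V * b * V * y) * star V := by
        simp only [← mul_assoc, e2, one_mul]
    _ = V * (y * (star V * b * V)) * star V := by rw [h]
    _ = V * y * star V * b := by
        simp only [mul_assoc, e2, mul_one]

theorem isTraceVector_vac (θ : Matrix (Fin d) (Fin d) ℝ) : IsTraceVector (torus θ) (vac d) where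
  norm_eq := norm_vac
  comm _ ha _ hb := trace_mul_comm ha hb

theorem traceNorm_dualAction {p : ℝ} (hp : 0 ≤ p) (v : EuclideanSpace ℝ (Fin d))
    (y : HilbertL2 d →L[ℂ] HilbertL2 d) : traceNorm p (dualAction v y) = traceNorm p y :=
  vecNorm_conj (ξ := vac d) (dualUnitary v)
    (by rw [star_dualUnitary]; exact dualUnitary_vac _) p hp y

theorem norm_dualAction_apply_le (v : EuclideanSpace ℝ (Fin d))
    (y : HilbertL2 d →L[ℂ] HilbertL2 d) (f : HilbertL2 d) : ‖dualAction v y f‖ ≤ ‖y‖ * ‖f‖ := by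
  rw [dualAction, star_dualUnitary]
  refine (norm_dualUnitary_apply v _).trans_le ((y.le_opNorm _).trans_eq ?_)
  exact congrArg (‖y‖ * ·) (norm_dualUnitary_apply (-v) f)

theorem dualAction_vac (v : EuclideanSpace ℝ (Fin d)) (y : HilbertL2 d →L[ℂ] HilbertL2 d)
    (m : Fin d → ℤ) : dualAction v y (vac d) m = phase v m * y (vac d) m := by
  rw [dualAction, star_dualUnitary]
  change (dualUnitary v : HilbertL2 d →L[ℂ] HilbertL2 d)
    (y ((dualUnitary (d := d) (-v) : HilbertL2 d →L[ℂ] HilbertL2 d) (vac d))) m = _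
  rw [dualUnitary_vac, dualUnitary_apply]

/-- Dominated convergence in `ℓ²`. Strong continuity is enough to define averages of the dual action
vector by vector. -/
theorem continuous_dualUnitary_apply (f : HilbertL2 d) :
    Continuous fun v : EuclideanSpace ℝ (Fin d) => (dualUnitary v : HilbertL2 d →L[ℂ] HilbertL2 d) f := by
  rw [continuous_iff_continuousAt]
  intro v₀
  rw [ContinuousAt, tendsto_iff_norm_sub_tendsto_zero]
  have hsq : Filter.Tendsto (fun v : EuclideanSpace ℝ (Fin d) =>
      ‖(dualUnitary v : HilbertL2 d →L[ℂ] HilbertL2 d) f -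
      (dualUnitary v₀ : HilbertL2 d →L[ℂ] HilbertL2 d) f‖ ^ 2) (nhds v₀) (nhds 0) := by
    have e : ∀ v : EuclideanSpace ℝ (Fin d), ‖(dualUnitary v : HilbertL2 d →L[ℂ] HilbertL2 d) f -
        (dualUnitary v₀ : HilbertL2 d →L[ℂ] HilbertL2 d) f‖ ^ 2 =
        ∑' m, ‖(phase v m - phase v₀ m) * f m‖ ^ 2 := by
      intro v
      have := lp.norm_rpow_eq_tsum (p := 2) (by norm_num)
        ((dualUnitary v : HilbertL2 d →L[ℂ] HilbertL2 d) f -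
          (dualUnitary v₀ : HilbertL2 d →L[ℂ] HilbertL2 d) f)
      simp only [ENNReal.toReal_ofNat, Real.rpow_ofNat] at this
      rw [this]
      refine tsum_congr fun m => ?_
      congr 2
      rw [sub_mul]
      rfl
    simp only [e]
    have h0 : (0 : ℝ) = ∑' m : Fin d → ℤ, ‖(phase v₀ m - phase v₀ m) * f m‖ ^ 2 := by simp
    rw [h0]
    have hf := (lp.memℓp f).summable (by norm_num)
    simp only [ENNReal.toReal_ofNat, Real.rpow_ofNat] at hf
    refine tendsto_tsum_of_dominated_convergence (bound := fun m => 4 * ‖f m‖ ^ 2)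
      (hf.mul_left 4) (fun m => ?_) (Filter.Eventually.of_forall fun v m => ?_)
    · exact ((((continuous_phase m).sub continuous_const).mul continuous_const).norm.pow 2).tendsto _
    · rw [norm_pow, norm_norm, norm_mul, mul_pow]
      have : ‖phase v m - phase v₀ m‖ ≤ 2 := by
        refine (norm_sub_le _ _).trans ?_
        rw [norm_phase, norm_phase]
        norm_num
      have h2 : ‖phase v m - phase v₀ m‖ ^ 2 ≤ 4 := by
        nlinarith [norm_nonneg (phase v m - phase v₀ m)]
      gcongr
  have := hsq.sqrt
  simpa [Real.sqrt_sq] using this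

theorem continuous_dualAction_apply (y : HilbertL2 d →L[ℂ] HilbertL2 d) (f : HilbertL2 d) :
    Continuous fun v : EuclideanSpace ℝ (Fin d) => dualAction v y f := by
  have e : ∀ v : EuclideanSpace ℝ (Fin d), dualAction v y f = (dualUnitary v : HilbertL2 d →L[ℂ] HilbertL2 d)
      (y ((dualUnitary (d := d) (-v) : HilbertL2 d →L[ℂ] HilbertL2 d) f)) := by
    intro v
    rw [dualAction, star_dualUnitary]
    rfl
  simp only [e]
  set g := fun v : EuclideanSpace ℝ (Fin d) => y ((dualUnitary (d := d) (-v) : HilbertL2 d →L[ℂ] HilbertL2 d) f)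
  have hg : Continuous g := y.continuous.comp ((continuous_dualUnitary_apply f).comp continuous_neg)
  rw [continuous_iff_continuousAt]
  intro v₀
  rw [ContinuousAt, tendsto_iff_norm_sub_tendsto_zero]
  have h1 : Filter.Tendsto (fun v => ‖g v - g v₀‖ +
      ‖(dualUnitary v : HilbertL2 d →L[ℂ] HilbertL2 d) (g v₀) -
        (dualUnitary v₀ : HilbertL2 d →L[ℂ] HilbertL2 d) (g v₀)‖) (nhds v₀) (nhds (0 + 0)) :=
    (tendsto_iff_norm_sub_tendsto_zero.1 (hg.tendsto v₀)).add
      (tendsto_iff_norm_sub_tendsto_zero.1 ((continuous_dualUnitary_apply (g v₀)).tendsto v₀))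
  rw [add_zero] at h1
  refine squeeze_zero (fun _ => norm_nonneg _) (fun v => ?_) h1
  have h2 : ‖(dualUnitary v : HilbertL2 d →L[ℂ] HilbertL2 d) (g v) -
      (dualUnitary v : HilbertL2 d →L[ℂ] HilbertL2 d) (g v₀)‖ = ‖g v - g v₀‖ := by
    rw [← map_sub, norm_dualUnitary_apply]
  rw [← h2]
  exact norm_sub_le_norm_sub_add_norm_sub _ _ _

/-! ### Averages of the dual action against integrable functions. -/

open MeasureTheory

theorem integrable_dualAction_apply {h : EuclideanSpace ℝ (Fin d) → ℂ} (hh : Integrable h) (ε : ℝ)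
    (y : HilbertL2 d →L[ℂ] HilbertL2 d) (f : HilbertL2 d) :
    Integrable fun v => h v • dualAction (ε • v) y f := by
  refine Integrable.mono' (hh.norm.mul_const (‖y‖ * ‖f‖)) ?_
    (Filter.Eventually.of_forall fun v => ?_)
  · exact hh.aestronglyMeasurable.smul ((continuous_dualAction_apply y f).comp
      (continuous_const_smul ε)).aestronglyMeasurable
  · rw [norm_smul]
    exact mul_le_mul_of_nonneg_left (norm_dualAction_apply_le _ y f) (norm_nonneg _)

/-- The average `∫ h(v) T_{εv} y dv` of the dual action, as a strong integral. -/
def average {h : EuclideanSpace ℝ (Fin d) → ℂ} (hh : Integrable h) (ε : ℝ)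
    (y : HilbertL2 d →L[ℂ] HilbertL2 d) : HilbertL2 d →L[ℂ] HilbertL2 d :=
  LinearMap.mkContinuous
    { toFun := fun f => ∫ v, h v • dualAction (ε • v) y f
      map_add' := fun f g => by
        rw [← integral_add (integrable_dualAction_apply hh ε y f)
          (integrable_dualAction_apply hh ε y g)]
        simp only [map_add, smul_add]
      map_smul' := fun c f => by
        rw [RingHom.id_apply, ← integral_smul]
        simp only [map_smul, smul_comm c] }
    ((∫ v, ‖h v‖) * ‖y‖) fun f => by
      refine (norm_integral_le_integral_norm _).trans ?_
      rw [mul_assoc, ← integral_mul_const]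
      refine integral_mono (integrable_dualAction_apply hh ε y f).norm (hh.norm.mul_const _)
        fun v => ?_
      simp only [norm_smul]
      exact mul_le_mul_of_nonneg_left (norm_dualAction_apply_le _ y f) (norm_nonneg _)

variable {h : EuclideanSpace ℝ (Fin d) → ℂ} (hh : Integrable h) (ε : ℝ)

theorem average_apply (y : HilbertL2 d →L[ℂ] HilbertL2 d) (f : HilbertL2 d) :
    average hh ε y f = ∫ v, h v • dualAction (ε • v) y f := rfl

theorem norm_average_le (y : HilbertL2 d →L[ℂ] HilbertL2 d) :
    ‖average hh ε y‖ ≤ (∫ v, ‖h v‖) * ‖y‖ :=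
  LinearMap.mkContinuous_norm_le _
    (mul_nonneg (integral_nonneg fun _ => norm_nonneg _) (norm_nonneg _)) _

theorem average_mem {θ : Matrix (Fin d) (Fin d) ℝ} {y : HilbertL2 d →L[ℂ] HilbertL2 d}
    (hy : y ∈ torus θ) : average hh ε y ∈ torus θ := by
  rw [mem_torus_iff]
  intro b hb1 hb2
  ext1 f
  change b (average hh ε y f) = average hh ε y (b f)
  rw [average_apply, average_apply, ← b.integral_comp_comm (integrable_dualAction_apply hh ε y f)]
  refine integral_congr_ae (Filter.Eventually.of_forall fun v => ?_)
  have := mem_torus_iff.1 (dualAction_mem hy (ε • v)) b hb1 hb2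
  simp only [map_smul]
  congr 1
  exact DFunLike.congr_fun this f

theorem inner_average_vac (y : HilbertL2 d →L[ℂ] HilbertL2 d) (g : HilbertL2 d) :
    inner ℂ g (average hh ε y (vac d)) = ∫ v, h v * inner ℂ g (dualAction (ε • v) y (vac d)) := by
  rw [average_apply, ← integral_inner (integrable_dualAction_apply hh ε y (vac d))]
  simp only [inner_smul_right]

/-- This identifies averages as Fourier multipliers: the symbol is the inverse Fourier transform of
`h` at `εm`. -/
theorem opCoeff_average (θ : Matrix (Fin d) (Fin d) ℝ) (y : HilbertL2 d →L[ℂ] HilbertL2 d)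
    (m : Fin d → ℤ) :
    opCoeff θ (average hh ε y) m = (∫ v, h v * phase (ε • v) m) * opCoeff θ y m := by
  rw [opCoeff, trace_star_mul, inner_average_vac, monomial_vac, ← integral_mul_const]
  congr 1
  ext v
  rw [opCoeff_eq, lp.inner_single_left, dualAction_vac]
  simp [mul_assoc]

/-- Pairing with an element of the dual ball reduces this to a scalar integral, whose integrand is
controlled by invariance of the norm under the dual action. No integration in `L_p` is needed. -/
theorem traceNorm_average_le {θ : Matrix (Fin d) (Fin d) ℝ} {p : ℝ} (hp : 1 ≤ p)
    {y : HilbertL2 d →L[ℂ] HilbertL2 d} (hy : y ∈ torus θ) :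
    traceNorm p (average hh ε y) ≤ (∫ v, ‖h v‖) * traceNorm p y := by
  refine (isTraceVector_vac θ).vecNorm_le_of_dualBall hp (average_mem hh ε hy) fun z hz => ?_
  rw [vecState_star_mul, inner_average_vac, ← integral_mul_const]
  refine norm_integral_le_of_norm_le (hh.norm.mul_const _) (Filter.Eventually.of_forall fun v => ?_)
  rw [norm_mul, ← vecState_star_mul]
  refine mul_le_mul_of_nonneg_left ?_ (norm_nonneg _)
  exact (hz.2 _ (dualAction_mem hy _)).trans_eq (traceNorm_dualAction (by linarith) _ _)

end QTorus
end

noncomputable section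

namespace QTorus

variable {d : ℕ}

/-! ### The extended `L_p`-norm of a formal Fourier series -/

/-- The `L_p`-norm of a bounded operator in the quantum torus, `1 ≤ p ≤ ∞`. -/
def torusNorm (p : ℝ≥0∞) (y : HilbertL2 d →L[ℂ] HilbertL2 d) : ℝ :=
  if p = ∞ then ‖y‖ else traceNorm p.toReal y

section TorusNorm

variable {θ : Matrix (Fin d) (Fin d) ℝ} {p : ℝ≥0∞}

theorem one_le_toReal (hp : 1 ≤ p) (h : p ≠ ∞) : 1 ≤ p.toReal := by
  simpa using (ENNReal.toReal_le_toReal (by simp) h).2 hp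

theorem torusNorm_nonneg (p : ℝ≥0∞) (y : HilbertL2 d →L[ℂ] HilbertL2 d) : 0 ≤ torusNorm p y := by
  rw [torusNorm]
  split_ifs
  · exact norm_nonneg y
  · exact vecNorm_nonneg (vac d) _ y

theorem torusNorm_add_le (hp : 1 ≤ p) {a b : HilbertL2 d →L[ℂ] HilbertL2 d} (ha : a ∈ torus θ)
    (hb : b ∈ torus θ) : torusNorm p (a + b) ≤ torusNorm p a + torusNorm p b := by
  simp only [torusNorm]
  split_ifs with h
  · exact norm_add_le a b
  · exact (isTraceVector_vac θ).vecNorm_add_le (one_le_toReal hp h) ha hb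

theorem torusNorm_smul_le (hp : 1 ≤ p) (c : ℂ) {a : HilbertL2 d →L[ℂ] HilbertL2 d}
    (ha : a ∈ torus θ) : torusNorm p (c • a) ≤ ‖c‖ * torusNorm p a := by
  simp only [torusNorm]
  split_ifs with h
  · exact norm_smul_le c a
  · exact (isTraceVector_vac θ).vecNorm_smul_le (one_le_toReal hp h) c ha

theorem torusNorm_zero (hp : 1 ≤ p) : torusNorm p (0 : HilbertL2 d →L[ℂ] HilbertL2 d) = 0 := by
  refine le_antisymm ?_ (torusNorm_nonneg p _)
  simpa using torusNorm_smul_le (θ := 0) hp 0 (zero_mem (torus (0 : Matrix (Fin d) (Fin d) ℝ)))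

theorem torusNorm_neg_le (hp : 1 ≤ p) {a : HilbertL2 d →L[ℂ] HilbertL2 d} (ha : a ∈ torus θ) :
    torusNorm p (-a) ≤ torusNorm p a := by
  simpa using torusNorm_smul_le hp (-1) ha

theorem torusNorm_sum_le (hp : 1 ≤ p) {ι : Type*} (s : Finset ι)
    {y : ι → HilbertL2 d →L[ℂ] HilbertL2 d} (hy : ∀ i, y i ∈ torus θ) :
    torusNorm p (∑ i ∈ s, y i) ≤ ∑ i ∈ s, torusNorm p (y i) := by
  classical
  induction s using Finset.induction_on with
  | empty => simp [torusNorm_zero hp]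
  | insert a s ha ih =>
    rw [Finset.sum_insert ha, Finset.sum_insert ha]
    exact (torusNorm_add_le hp (hy a) (sum_mem fun i _ => hy i)).trans (by gcongr)

/-- Since `(U^m)*` is a contraction, coefficients are dominated by the norm; summability in norm
therefore forces absolute summability of each coefficient. -/
theorem norm_opCoeff_le (hp : 1 ≤ p) {y : HilbertL2 d →L[ℂ] HilbertL2 d} (hy : y ∈ torus θ)
    (m : Fin d → ℤ) : ‖opCoeff θ y m‖ ≤ torusNorm p y := by
  have hu : ‖star (monomial θ m : HilbertL2 d →L[ℂ] HilbertL2 d)‖ ≤ 1 :=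
    norm_unitary_le (star (monomial θ m))
  rw [torusNorm]
  split_ifs with h
  · refine (norm_trace_le _).trans ((norm_mul_le _ _).trans ?_)
    exact mul_le_of_le_one_left (norm_nonneg y) hu
  · exact (isTraceVector_vac θ).norm_vecState_mul_le_vecNorm
      (star_mem (monomial_mem_torus θ m)) hu hy (one_le_toReal hp h)

theorem torusNorm_dualAction_le (hp : 1 ≤ p) (v : EuclideanSpace ℝ (Fin d))
    (y : HilbertL2 d →L[ℂ] HilbertL2 d) : torusNorm p (dualAction v y) ≤ torusNorm p y := by
  simp only [torusNorm]
  split_ifs with h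
  · exact ContinuousLinearMap.opNorm_le_bound _ (norm_nonneg y) (norm_dualAction_apply_le v y)
  · exact (traceNorm_dualAction (zero_le_one.trans (one_le_toReal hp h)) v y).le

theorem torusNorm_average_le (hp : 1 ≤ p) {h : EuclideanSpace ℝ (Fin d) → ℂ}
    (hh : MeasureTheory.Integrable h) (ε : ℝ) {y : HilbertL2 d →L[ℂ] HilbertL2 d}
    (hy : y ∈ torus θ) : torusNorm p (average hh ε y) ≤ (∫ v, ‖h v‖) * torusNorm p y := by
  simp only [torusNorm]
  split_ifs with hp'
  · exact norm_average_le hh ε y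
  · exact traceNorm_average_le hh ε (one_le_toReal hp hp') hy

end TorusNorm

/-- The Fourier coefficient as a continuous linear functional. -/
def opCoeffCLM (θ : Matrix (Fin d) (Fin d) ℝ) (m : Fin d → ℤ) :
    (HilbertL2 d →L[ℂ] HilbertL2 d) →L[ℂ] ℂ :=
  (traceCLM d).comp (ContinuousLinearMap.mul ℂ (HilbertL2 d →L[ℂ] HilbertL2 d)
    (star (monomial θ m : HilbertL2 d →L[ℂ] HilbertL2 d)))

theorem opCoeffCLM_apply (θ : Matrix (Fin d) (Fin d) ℝ) (m : Fin d → ℤ)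
    (y : HilbertL2 d →L[ℂ] HilbertL2 d) : opCoeffCLM θ m y = opCoeff θ y m := rfl

variable {θ : Matrix (Fin d) (Fin d) ℝ} {p : ℝ≥0∞}

theorem lpENorm_le_of_hasLpNorm {c : (Fin d → ℤ) → ℂ} {r : ℝ≥0} (h : HasLpNorm θ p c r) :
    lpENorm θ p c ≤ r :=
  iInf₂_le r h

theorem lpENorm_lt_iff {c : (Fin d → ℤ) → ℂ} {a : ℝ≥0∞} :
    lpENorm θ p c < a ↔ ∃ r, HasLpNorm θ p c r ∧ (r : ℝ≥0∞) < a := by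
  simp only [lpENorm, iInf_lt_iff, exists_prop]

theorem memLp_iff {c : (Fin d → ℤ) → ℂ} : MemLp θ p c ↔ lpENorm θ p c < ∞ := by
  simp [lpENorm_lt_iff, MemLp]

/-- The partial sums realise `c` as an element of `L_p`. Together with `exists_series_of_lpENorm_lt`
this describes `lpENorm` as an infimum over series of operators, the form in which it is used below.
-/
theorem lpENorm_le_tsum_nat (hp : 1 ≤ p) {c : (Fin d → ℤ) → ℂ}
    {y : ℕ → HilbertL2 d →L[ℂ] HilbertL2 d} (hy : ∀ k, y k ∈ torus θ)
    (hc : ∀ m, HasSum (fun k => opCoeff θ (y k) m) (c m)) :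
    lpENorm θ p c ≤ ∑' k, ENNReal.ofReal (torusNorm p (y k)) := by
  by_cases hfin : ∑' k, ENNReal.ofReal (torusNorm p (y k)) = ∞
  · rw [hfin]; exact le_top
  have hs : Summable fun k => torusNorm p (y k) := by
    have := ENNReal.summable_toReal hfin
    simpa only [ENNReal.toReal_ofReal (torusNorm_nonneg p _)] using this
  rw [← ENNReal.ofReal_tsum_of_nonneg (fun k => torusNorm_nonneg p _) hs]
  have hbound : ∀ N, ∑ k ∈ Finset.range N, torusNorm p (y k) ≤ ∑' k, torusNorm p (y k) :=
    fun N => hs.sum_le_tsum _ fun k _ => torusNorm_nonneg p _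
  by_cases hpt : p = ∞
  · have hs' : Summable fun k => ‖y k‖ := by simpa [torusNorm, hpt] using hs
    have hsum : HasSum y (∑' k, y k) := hs'.of_norm.hasSum
    have hmem : (∑' k, y k) ∈ torus θ :=
      (isClosed_torus θ).mem_of_tendsto hsum.tendsto_sum_nat
        (Filter.Eventually.of_forall fun N => sum_mem fun k _ => hy k)
    have h1 : HasLpNorm θ p c ‖∑' k, y k‖₊ := by
      rw [HasLpNorm, if_pos hpt]
      refine ⟨∑' k, y k, hmem, fun m => ?_, rfl⟩
      exact (hsum.mapL (opCoeffCLM θ m)).unique (hc m)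
    refine (lpENorm_le_of_hasLpNorm h1).trans ?_
    rw [ENNReal.le_ofReal_iff_toReal_le (by simp) (tsum_nonneg fun k => torusNorm_nonneg p _)]
    simpa [torusNorm, hpt] using norm_tsum_le_tsum_norm hs'
  · set S : ℕ → HilbertL2 d →L[ℂ] HilbertL2 d := fun N => ∑ k ∈ Finset.range N, y k with hS
    -- The real sequence `G` dominates all increments of `S`, so both `S` and the norms of `S`
    -- inherit its Cauchy property.
    set G : ℕ → ℝ := fun N => ∑ k ∈ Finset.range N, torusNorm p (y k) with hG
    have hSm : ∀ N, S N ∈ torus θ := fun N => sum_mem fun k _ => hy k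
    have hmono : ∀ i j, i ≤ j → torusNorm p (S j - S i) ≤ G j - G i := by
      intro i j hij
      have e1 : S j - S i = ∑ k ∈ Finset.Ico i j, y k := by
        rw [hS]; simp only [Finset.sum_Ico_eq_sub _ hij]
      have e2 : G j - G i = ∑ k ∈ Finset.Ico i j, torusNorm p (y k) := by
        rw [hG]; simp only [Finset.sum_Ico_eq_sub _ hij]
      rw [e1, e2]
      exact torusNorm_sum_le hp _ hy
    have hdist : ∀ i j, torusNorm p (S i - S j) ≤ |G i - G j| := by
      intro i j
      rcases le_total i j with hij | hij
      · rw [← neg_sub (S j)]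
        refine (torusNorm_neg_le hp (sub_mem (hSm j) (hSm i))).trans ((hmono i j hij).trans ?_)
        rw [abs_sub_comm]
        exact le_abs_self _
      · exact (hmono j i hij).trans (le_abs_self _)
    have hGc : CauchySeq G := hs.hasSum.tendsto_sum_nat.cauchySeq
    have hrev : ∀ i j, |torusNorm p (S i) - torusNorm p (S j)| ≤ |G i - G j| := by
      intro i j
      have tri : ∀ i j, torusNorm p (S i) ≤ torusNorm p (S j) + |G i - G j| := by
        intro i j
        have := torusNorm_add_le hp (hSm j) (sub_mem (hSm i) (hSm j))
        rw [add_sub_cancel] at this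
        linarith [hdist i j]
      rw [abs_le]
      have h1 := tri i j
      have h2 := tri j i
      rw [abs_sub_comm (G j)] at h2
      constructor <;> linarith
    have hnc : CauchySeq fun N => torusNorm p (S N) := by
      rw [Metric.cauchySeq_iff'] at hGc ⊢
      intro ε hε
      obtain ⟨N, hN⟩ := hGc ε hε
      exact ⟨N, fun n hn => (hrev n N).trans_lt (hN n hn)⟩
    obtain ⟨r, hr⟩ := cauchySeq_tendsto_of_complete hnc
    have hr0 : 0 ≤ r := ge_of_tendsto' hr fun N => torusNorm_nonneg p _
    lift r to ℝ≥0 using hr0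
    have hrle : r ≤ ∑' k, torusNorm p (y k) :=
      le_of_tendsto' hr fun N => (torusNorm_sum_le hp _ hy).trans (hbound N)
    have htn : ∀ a : HilbertL2 d →L[ℂ] HilbertL2 d, traceNorm p.toReal a = torusNorm p a := by
      intro a; rw [torusNorm, if_neg hpt]
    have h1 : HasLpNorm θ p c r := by
      rw [HasLpNorm, if_neg hpt]
      refine ⟨S, hSm, fun ε hε => ?_, fun m => ?_, ?_⟩
      · obtain ⟨N, hN⟩ := Metric.cauchySeq_iff.1 hGc ε hε
        exact ⟨N, fun i hi j hj => by
          rw [htn]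
          exact (hdist i j).trans_lt (hN i hi j hj)⟩
      · refine (hc m).tendsto_sum_nat.congr fun N => ?_
        simp only [hS, ← opCoeffCLM_apply, map_sum]
      · simp only [htn]
        exact hr
    refine (lpENorm_le_of_hasLpNorm h1).trans ?_
    rw [ENNReal.le_ofReal_iff_toReal_le (by simp) (tsum_nonneg fun k => torusNorm_nonneg p _)]
    exact hrle

theorem lpENorm_le_tsum (hp : 1 ≤ p) {κ : Type*} [Denumerable κ] {c : (Fin d → ℤ) → ℂ}
    {y : κ → HilbertL2 d →L[ℂ] HilbertL2 d} (hy : ∀ k, y k ∈ torus θ)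
    (hc : ∀ m, HasSum (fun k => opCoeff θ (y k) m) (c m)) :
    lpENorm θ p c ≤ ∑' k, ENNReal.ofReal (torusNorm p (y k)) := by
  let e : ℕ ≃ κ := (Denumerable.eqv κ).symm
  rw [← e.tsum_eq fun k => ENNReal.ofReal (torusNorm p (y k))]
  refine lpENorm_le_tsum_nat hp (y := fun k => y (e k)) (fun k => hy _) fun m => ?_
  exact (e.hasSum_iff (f := fun k => opCoeff θ (y k) m)).2 (hc m)

/-- For `p < ∞`, telescope a rapidly convergent subsequence of a Cauchy sequence representing `c`;
for `p = ∞` a single term suffices. -/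
theorem exists_series_of_lpENorm_lt (hp : 1 ≤ p) {c : (Fin d → ℤ) → ℂ} {a : ℝ≥0∞}
    (h : lpENorm θ p c < a) : ∃ y : ℕ → HilbertL2 d →L[ℂ] HilbertL2 d, (∀ k, y k ∈ torus θ) ∧
      (∀ m, HasSum (fun k => opCoeff θ (y k) m) (c m)) ∧
      ∑' k, ENNReal.ofReal (torusNorm p (y k)) < a := by
  obtain ⟨r, hr, hra⟩ := lpENorm_lt_iff.1 h
  by_cases hpt : p = ∞
  · rw [HasLpNorm, if_pos hpt] at hr
    obtain ⟨y, hy, hyc, hyn⟩ := hr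
    refine ⟨fun k => if k = 0 then y else 0, fun k => ?_, fun m => ?_, ?_⟩
    · dsimp only
      split_ifs
      exacts [hy, zero_mem _]
    · rw [← hyc m]
      convert! hasSum_ite_eq (0 : ℕ) (opCoeff θ y m) using 1
      ext k
      split_ifs with hk
      · simp [hk]
      · simp [hk, ← opCoeffCLM_apply]
    · rw [tsum_eq_single 0]
      · simpa [torusNorm, hpt, hyn] using hra
      · intro k hk
        simp [hk, torusNorm_zero hp]
  · rw [HasLpNorm, if_neg hpt] at hr
    obtain ⟨y, hy, hcauchy, hcoeff, hlim⟩ := hr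
    have htn : ∀ a : HilbertL2 d →L[ℂ] HilbertL2 d, traceNorm p.toReal a = torusNorm p a := by
      intro a; rw [torusNorm, if_neg hpt]
    simp only [htn] at hcauchy hlim
    obtain ⟨δ, hδ, hδa⟩ : ∃ δ : ℝ, 0 < δ ∧ ENNReal.ofReal (r + δ) < a := by
      obtain ⟨b, hb1, hb2⟩ := ENNReal.lt_iff_exists_nnreal_btwn.1 hra
      have hb1 : r < b := by exact_mod_cast hb1
      refine ⟨b - r, sub_pos.2 (by exact_mod_cast hb1), ?_⟩
      simpa using hb2
    -- The increments cost `δ/2` in total and the first term at most `r + δ/4`, so the sum stays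
    -- below `r + δ`.
    have hεpos : ∀ k : ℕ, 0 < δ / 4 * (1 / 2 : ℝ) ^ k := fun k => by positivity
    choose N hN using fun k : ℕ => hcauchy _ (hεpos k)
    -- This index is monotone, at least `N k`, and tends to infinity.
    let n : ℕ → ℕ := fun k => k + ∑ l ∈ Finset.range (k + 1), N l
    have hnN : ∀ k, N k ≤ n k := fun k =>
      (Finset.single_le_sum (fun _ _ => Nat.zero_le _) (Finset.self_mem_range_succ k)).trans
        (Nat.le_add_left _ _)
    have hnmono : ∀ k, n k ≤ n (k + 1) := fun k => by
      simp only [n]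
      rw [Finset.sum_range_succ _ (k + 1)]
      omega
    have hntop : Filter.Tendsto n Filter.atTop Filter.atTop :=
      Filter.tendsto_atTop_mono (fun k => Nat.le_add_right _ _) Filter.tendsto_id
    let z : ℕ → HilbertL2 d →L[ℂ] HilbertL2 d := fun k =>
      Nat.casesOn k (y (n 0)) fun k => y (n (k + 1)) - y (n k)
    have hz : ∀ k, z k ∈ torus θ := by
      intro k
      cases k with
      | zero => exact hy _
      | succ k => exact sub_mem (hy _) (hy _)
    have hzsum : ∀ K, ∑ k ∈ Finset.range (K + 1), z k = y (n K) := by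
      intro K
      rw [Finset.sum_range_succ']
      change ∑ k ∈ Finset.range K, (y (n (k + 1)) - y (n k)) + y (n 0) = _
      rw [Finset.sum_range_sub fun k => y (n k)]
      abel
    have hz0 : torusNorm p (z 0) ≤ r + δ / 4 := by
      refine le_of_tendsto_of_tendsto' tendsto_const_nhds
        ((hlim.comp (Filter.tendsto_add_atTop_nat (n 0))).add_const (δ / 4)) fun i => ?_
      have h1 := torusNorm_add_le hp (hy (i + n 0)) (sub_mem (hy (n 0)) (hy (i + n 0)))
      have h2 := hN 0 (n 0) (hnN 0) (i + n 0) ((hnN 0).trans (Nat.le_add_left _ _))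
      rw [add_sub_cancel] at h1
      simp only [pow_zero, mul_one] at h2
      change torusNorm p (y (n 0)) ≤ torusNorm p (y (i + n 0)) + δ / 4
      linarith
    have hzk : ∀ k, torusNorm p (z (k + 1)) ≤ δ / 4 * (1 / 2 : ℝ) ^ k := fun k =>
      (hN k (n (k + 1)) ((hnN k).trans (hnmono k)) (n k) (hnN k)).le
    have hg : HasSum (fun k : ℕ => δ / 4 * (1 / 2 : ℝ) ^ k) (δ / 4 * 2) :=
      hasSum_geometric_two.mul_left _
    have hs1 : Summable fun k => torusNorm p (z (k + 1)) :=
      hg.summable.of_nonneg_of_le (fun k => torusNorm_nonneg p _) hzk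
    have hs : Summable fun k => torusNorm p (z k) := (summable_nat_add_iff 1).1 hs1
    refine ⟨z, hz, fun m => ?_, ?_⟩
    · have hcs : Summable fun k => opCoeff θ (z k) m :=
        Summable.of_norm_bounded hs fun k => norm_opCoeff_le hp (hz k) m
      have h1 := hcs.hasSum.tendsto_sum_nat.comp (Filter.tendsto_add_atTop_nat 1)
      have h2 := (hcoeff m).comp hntop
      have h3 : (∑' k, opCoeff θ (z k) m) = c m := by
        refine tendsto_nhds_unique h1 (h2.congr fun K => ?_)
        simp only [Function.comp]
        rw [← hzsum K]
        simp only [← opCoeffCLM_apply, map_sum]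
      exact h3 ▸ hcs.hasSum
    · rw [← ENNReal.ofReal_tsum_of_nonneg (fun k => torusNorm_nonneg p _) hs]
      refine lt_of_le_of_lt (ENNReal.ofReal_le_ofReal ?_) hδa
      rw [hs.tsum_eq_zero_add]
      have := hs1.tsum_le_tsum hzk hg.summable
      rw [hg.tsum_eq] at this
      linarith

/-- Countable subadditivity of the `L_p`-norm. -/
theorem lpENorm_le_tsum_lpENorm (hp : 1 ≤ p) {ι : Type*} [Countable ι] [Nonempty ι]
    {c : ι → (Fin d → ℤ) → ℂ} {c₀ : (Fin d → ℤ) → ℂ} (hc : ∀ m, HasSum (fun i => c i m) (c₀ m)) :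
    lpENorm θ p c₀ ≤ ∑' i, lpENorm θ p (c i) := by
  refine ENNReal.le_of_forall_pos_le_add fun ε hε hfin => ?_
  obtain ⟨ε', hε', hsum⟩ := ENNReal.exists_pos_sum_of_countable (ENNReal.coe_ne_zero.2 hε.ne') ι
  have hlt : ∀ i, lpENorm θ p (c i) < lpENorm θ p (c i) + ε' i := fun i =>
    ENNReal.lt_add_right (ENNReal.ne_top_of_tsum_ne_top hfin.ne i)
      (ENNReal.coe_ne_zero.2 (hε' i).ne')
  choose y hy hyc hyn using fun i => exists_series_of_lpENorm_lt hp (hlt i)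
  have htot : ∑' q : ι × ℕ, ENNReal.ofReal (torusNorm p (y q.1 q.2)) ≤
      ∑' i, lpENorm θ p (c i) + ε := by
    rw [ENNReal.tsum_prod (f := fun i k => ENNReal.ofReal (torusNorm p (y i k)))]
    calc _ ≤ ∑' i, (lpENorm θ p (c i) + ε' i) := ENNReal.tsum_le_tsum fun i => (hyn i).le
      _ = ∑' i, lpENorm θ p (c i) + ∑' i, (ε' i : ℝ≥0∞) := ENNReal.tsum_add
      _ ≤ _ := by gcongr
  have hne : ∑' q : ι × ℕ, ENNReal.ofReal (torusNorm p (y q.1 q.2)) ≠ ∞ :=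
    (htot.trans_lt (ENNReal.add_lt_top.2 ⟨hfin, ENNReal.coe_lt_top⟩)).ne
  have hs : Summable fun q : ι × ℕ => torusNorm p (y q.1 q.2) := by
    have := ENNReal.summable_toReal hne
    simpa only [ENNReal.toReal_ofReal (torusNorm_nonneg p _)] using this
  have : Encodable ι := Encodable.ofCountable ι
  have : Denumerable (ι × ℕ) := Denumerable.ofEncodableOfInfinite _
  refine (lpENorm_le_tsum hp (y := fun q : ι × ℕ => y q.1 q.2) (fun q => hy _ _)
    fun m => ?_).trans htot
  have hcs : Summable fun q : ι × ℕ => opCoeff θ (y q.1 q.2) m :=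
    Summable.of_norm_bounded hs fun q => norm_opCoeff_le hp (hy _ _) m
  -- Absolute summability over `ι × ℕ` allows the double series of coefficients to be summed row by
  -- row.
  have h1 := hcs.hasSum.prod_fiberwise fun i => hyc i m
  exact (h1.unique (hc m)) ▸ hcs.hasSum

/-- Applying `Φ` to each term of a nearly optimal series extends a multiplier bound from operators
to formal series; linearity of `Φ` plays no role. -/
theorem lpENorm_mul_le (hp : 1 ≤ p) (Φ : (HilbertL2 d →L[ℂ] HilbertL2 d) →
    HilbertL2 d →L[ℂ] HilbertL2 d) {K : ℝ} (hK : 0 < K) {a : (Fin d → ℤ) → ℂ}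
    (hmem : ∀ y ∈ torus θ, Φ y ∈ torus θ)
    (hnorm : ∀ y ∈ torus θ, torusNorm p (Φ y) ≤ K * torusNorm p y)
    (hcoeff : ∀ y ∈ torus θ, ∀ m, opCoeff θ (Φ y) m = a m * opCoeff θ y m)
    (c : (Fin d → ℤ) → ℂ) :
    lpENorm θ p (fun m => a m * c m) ≤ ENNReal.ofReal K * lpENorm θ p c := by
  have hK' : ENNReal.ofReal K ≠ 0 := by simpa using hK
  rw [mul_comm, ← ENNReal.div_le_iff hK' ENNReal.ofReal_ne_top]
  refine le_of_forall_gt fun b hb => ?_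
  obtain ⟨y, hy, hyc, hyn⟩ := exists_series_of_lpENorm_lt hp hb
  refine lt_of_le_of_lt ?_ hyn
  rw [ENNReal.div_le_iff hK' ENNReal.ofReal_ne_top, ← ENNReal.tsum_mul_right]
  refine (lpENorm_le_tsum_nat hp (y := fun k => Φ (y k)) (fun k => hmem _ (hy k))
    fun m => ?_).trans (ENNReal.tsum_le_tsum fun k => ?_)
  · simp only [hcoeff _ (hy _)]
    exact (hyc m).mul_left _
  · rw [← ENNReal.ofReal_mul (torusNorm_nonneg p _), mul_comm]
    exact ENNReal.ofReal_le_ofReal (hnorm _ (hy k))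

theorem lpENorm_average_le (hp : 1 ≤ p) {h : EuclideanSpace ℝ (Fin d) → ℂ}
    (hh : MeasureTheory.Integrable h) (ε : ℝ) {K : ℝ} (hK : 0 < K) (hhK : ∫ v, ‖h v‖ ≤ K)
    (c : (Fin d → ℤ) → ℂ) :
    lpENorm θ p (fun m => (∫ v, h v * phase (ε • v) m) * c m) ≤
      ENNReal.ofReal K * lpENorm θ p c :=
  lpENorm_mul_le hp (average hh ε) hK (fun _ hy => average_mem hh ε hy)
    (fun y hy => (torusNorm_average_le hp hh ε hy).trans
      (mul_le_mul_of_nonneg_right hhK (torusNorm_nonneg p y)))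
    (fun y _ m => opCoeff_average hh ε θ y m) c

theorem lpENorm_zero (hp : 1 ≤ p) : lpENorm θ p 0 = 0 := by
  refine le_antisymm ?_ zero_le
  refine (lpENorm_le_tsum_nat hp (y := fun _ => 0) (fun _ => zero_mem _) fun m => ?_).trans_eq ?_
  · simp [← opCoeffCLM_apply, hasSum_zero]
  · simp [torusNorm_zero hp]

theorem lpENorm_add_le (hp : 1 ≤ p) (a b : (Fin d → ℤ) → ℂ) :
    lpENorm θ p (fun m => a m + b m) ≤ lpENorm θ p a + lpENorm θ p b := by
  refine (lpENorm_le_tsum_lpENorm (ι := Bool) hp (c := fun i => cond i a b) fun m => ?_).trans_eq ?_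
  · convert! hasSum_fintype (fun i : Bool => (cond i a b) m) using 1
    simp
  · simp [tsum_fintype]

theorem lpENorm_sum_le (hp : 1 ≤ p) {ι : Type*} (s : Finset ι) (c : ι → (Fin d → ℤ) → ℂ) :
    lpENorm θ p (fun m => ∑ i ∈ s, c i m) ≤ ∑ i ∈ s, lpENorm θ p (c i) := by
  classical
  induction s using Finset.induction_on with
  | empty => simpa using! (lpENorm_zero (θ := θ) hp).le
  | insert a s ha ih =>
    simp only [Finset.sum_insert ha]
    exact (lpENorm_add_le hp _ _).trans (by gcongr)

theorem enorm_le_lpENorm (hp : 1 ≤ p) (c : (Fin d → ℤ) → ℂ) (m : Fin d → ℤ) :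
    ‖c m‖ₑ ≤ lpENorm θ p c := by
  refine le_of_forall_gt fun b hb => ?_
  obtain ⟨y, hy, hyc, hyn⟩ := exists_series_of_lpENorm_lt hp hb
  refine lt_of_le_of_lt ?_ hyn
  rw [← (hyc m).tsum_eq]
  refine (enorm_tsum_le_tsum_enorm).trans (ENNReal.tsum_le_tsum fun k => ?_)
  rw [← ofReal_norm]
  exact ENNReal.ofReal_le_ofReal (norm_opCoeff_le hp (hy k) m)

theorem lpENorm_top_single_le (a : ℂ) :
    lpENorm θ ∞ (Pi.single 0 a) ≤ ‖a‖ₑ := by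
  have h1 : HasLpNorm θ ∞ (Pi.single 0 a) ‖a • (1 : HilbertL2 d →L[ℂ] HilbertL2 d)‖₊ := by
    rw [HasLpNorm, if_pos rfl]
    refine ⟨a • 1, smul_mem_torus a (one_mem _), fun m => ?_, rfl⟩
    rw [opCoeff_eq]
    change a * (vac d) m = _
    rcases eq_or_ne m 0 with rfl | hm
    · simp [vac]
    · simp [vac, hm]
  refine (lpENorm_le_of_hasLpNorm h1).trans ?_
  change ‖a • (1 : HilbertL2 d →L[ℂ] HilbertL2 d)‖ₑ ≤ _
  rw [← ofReal_norm, ← ofReal_norm]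
  refine ENNReal.ofReal_le_ofReal ?_
  have h2 := torusNorm_smul_le (p := ∞) le_top a (one_mem (torus θ))
  simp only [torusNorm, if_true] at h2
  exact h2.trans (mul_le_of_le_one_right (norm_nonneg a) ContinuousLinearMap.norm_id_le)

end QTorus
end

noncomputable section

namespace QTorus

variable {d : ℕ}

/-! ### Fourier multipliers -/

section Multipliers

open MeasureTheory FourierTransform

/-- Fourier inversion: every dilated Schwartz symbol is the symbol of an average. -/
theorem apply_eq_integral_fourier (g : 𝓢(EuclideanSpace ℝ (Fin d), ℂ)) (ε : ℝ) (m : Fin d → ℤ) :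
    g (ε • latticePoint m) = ∫ v, 𝓕 g v * phase (ε • v) m := by
  have h : 𝓕⁻ (𝓕 g) = g := fourierInv_fourier_eq g
  conv_lhs => rw [← h, SchwartzMap.fourierInv_coe, Real.fourierInv_eq']
  congr 1
  ext v
  rw [smul_eq_mul, mul_comm, phase, inner_smul_left, inner_smul_right]
  rfl

/-- Dilates of a Schwartz function are uniformly bounded Fourier multipliers. -/
theorem exists_lpENorm_schwartz_mul_le (g : 𝓢(EuclideanSpace ℝ (Fin d), ℂ)) :
    ∃ K : ℝ, 0 < K ∧ ∀ (θ : Matrix (Fin d) (Fin d) ℝ) (p : ℝ≥0∞), 1 ≤ p → ∀ (ε : ℝ)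
      (c : (Fin d → ℤ) → ℂ), lpENorm θ p (fun m => g (ε • latticePoint m) * c m) ≤
        ENNReal.ofReal K * lpENorm θ p c := by
  refine ⟨(∫ v, ‖𝓕 g v‖) + 1, by positivity, fun θ p hp ε c => ?_⟩
  have := lpENorm_average_le (θ := θ) hp (𝓕 g).integrable ε
    (K := (∫ v, ‖𝓕 g v‖) + 1) (by positivity) (by linarith) c
  simpa only [apply_eq_integral_fourier g ε] using this

/-- The mean value inequality on a unit ball, with decay of order `d + 1` of the derivative to make
the bound integrable. -/
theorem exists_integral_norm_translate_sub_le (f : 𝓢(EuclideanSpace ℝ (Fin d), ℂ)) :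
    ∃ K : ℝ, 0 < K ∧ ∀ w : EuclideanSpace ℝ (Fin d), ‖w‖ ≤ 1 →
      ∫ v, ‖f (v - w) - f v‖ ≤ K * ‖w‖ := by
  set N := d + 1
  obtain ⟨C, hC0, hC⟩ : ∃ C : ℝ, 0 < C ∧ ∀ x, (1 + ‖x‖) ^ N * ‖fderiv ℝ f x‖ ≤ C := by
    refine ⟨2 ^ N * ((Finset.Iic (N, 1)).sup fun m => SchwartzMap.seminorm ℝ m.1 m.2) f + 1,
      by positivity, fun x => ?_⟩
    have := SchwartzMap.one_add_le_sup_seminorm_apply (𝕜 := ℝ) (m := (N, 1)) (k := N) (n := 1)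
      le_rfl le_rfl f x
    rw [norm_iteratedFDeriv_one] at this
    linarith
  have hint : Integrable fun x : EuclideanSpace ℝ (Fin d) => (1 + ‖x‖) ^ (-(N : ℝ)) :=
    integrable_one_add_norm (by simp [N])
  refine ⟨C * 2 ^ N * ((∫ x : EuclideanSpace ℝ (Fin d), (1 + ‖x‖) ^ (-(N : ℝ))) + 1),
    by positivity, fun w hw => ?_⟩
  have hpt : ∀ v, ‖f (v - w) - f v‖ ≤ C * 2 ^ N * ‖w‖ * (1 + ‖v‖) ^ (-(N : ℝ)) := by
    intro v
    -- Within distance `1` of `v` the weights `1 + ‖x‖` and `1 + ‖v‖` agree up to a factor `2`,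
    -- whence `2 ^ N`.
    have hb : ∀ x ∈ Metric.closedBall v 1,
        ‖fderiv ℝ f x‖ ≤ C * 2 ^ N * (1 + ‖v‖) ^ (-(N : ℝ)) := by
      intro x hx
      rw [mem_closedBall_iff_norm] at hx
      have h1 : ‖v‖ ≤ ‖x‖ + 1 := by
        have := norm_sub_norm_le v x
        rw [norm_sub_rev] at this
        linarith
      have h2 : (1 + ‖v‖) ^ N ≤ 2 ^ N * (1 + ‖x‖) ^ N := by
        rw [← mul_pow]
        exact pow_le_pow_left₀ (by positivity) (by linarith [norm_nonneg x]) _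
      rw [Real.rpow_neg (by positivity), Real.rpow_natCast, ← div_eq_mul_inv,
        le_div_iff₀ (by positivity)]
      calc ‖fderiv ℝ f x‖ * (1 + ‖v‖) ^ N ≤ ‖fderiv ℝ f x‖ * (2 ^ N * (1 + ‖x‖) ^ N) := by gcongr
        _ = 2 ^ N * ((1 + ‖x‖) ^ N * ‖fderiv ℝ f x‖) := by ring
        _ ≤ 2 ^ N * C := by gcongr; exact hC x
        _ = _ := by ring
    have := (convex_closedBall v 1).norm_image_sub_le_of_norm_fderiv_le
      (f := f) (fun x _ => f.differentiableAt) hb (Metric.mem_closedBall_self zero_le_one)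
      (y := v - w) (by simpa [mem_closedBall_iff_norm] using hw)
    refine this.trans_eq ?_
    rw [sub_sub_cancel_left, norm_neg]
    ring
  calc ∫ v, ‖f (v - w) - f v‖ ≤ ∫ v : EuclideanSpace ℝ (Fin d),
        C * 2 ^ N * ‖w‖ * (1 + ‖v‖) ^ (-(N : ℝ)) :=
        integral_mono_of_nonneg (Filter.Eventually.of_forall fun _ => norm_nonneg _)
          (hint.const_mul _) (Filter.Eventually.of_forall hpt)
    _ = C * 2 ^ N * (∫ x : EuclideanSpace ℝ (Fin d), (1 + ‖x‖) ^ (-(N : ℝ))) * ‖w‖ := by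
        rw [integral_const_mul]; ring
    _ ≤ _ := by gcongr; linarith

/-- A Bernstein inequality for first differences. -/
theorem exists_lpENorm_diff_schwartz_mul_le (g : 𝓢(EuclideanSpace ℝ (Fin d), ℂ)) :
    ∃ K : ℝ, 0 < K ∧ ∀ (θ : Matrix (Fin d) (Fin d) ℝ) (p : ℝ≥0∞), 1 ≤ p →
      ∀ (ε : ℝ) (w : EuclideanSpace ℝ (Fin d)), 0 < ‖w‖ → ‖w‖ ≤ 1 → ∀ (c : (Fin d → ℤ) → ℂ),
        lpENorm θ p (fun m => (phase (ε • w) m - 1) * g (ε • latticePoint m) * c m) ≤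
          ENNReal.ofReal (K * ‖w‖) * lpENorm θ p c := by
  obtain ⟨K, hK, h⟩ := exists_integral_norm_translate_sub_le (𝓕 g)
  refine ⟨K, hK, fun θ p hp ε w hw0 hw c => ?_⟩
  have hi1 : Integrable fun v => 𝓕 g (v - w) := (𝓕 g).integrable.comp_sub_right w
  have hi : Integrable fun v => 𝓕 g (v - w) - 𝓕 g v := hi1.sub (𝓕 g).integrable
  have := lpENorm_average_le (θ := θ) hp hi ε (mul_pos hK hw0) (h w hw) c
  -- Multiplying the symbol by a character translates its Fourier transform, so the difference has
  -- kernel `𝓕 g (· - w) - 𝓕 g`, small in `L_1`.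
  suffices key : ∀ m, (phase (ε • w) m - 1) * g (ε • latticePoint m) =
      ∫ v, (𝓕 g (v - w) - 𝓕 g v) * phase (ε • v) m by
    simpa only [key] using this
  intro m
  have hc : Continuous fun v : EuclideanSpace ℝ (Fin d) => phase (ε • v) m :=
    (continuous_phase m).comp (continuous_const_smul ε)
  have hint : ∀ {f : EuclideanSpace ℝ (Fin d) → ℂ}, Integrable f →
      Integrable fun v => f v * phase (ε • v) m := fun hf =>
    hf.mul_bdd hc.aestronglyMeasurable (c := 1)
      (Filter.Eventually.of_forall fun v => (norm_phase _ m).le)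
  have hshift : ∫ v, 𝓕 g v * phase (ε • v) m = ∫ v, 𝓕 g (v - w) * phase (ε • (v - w)) m :=
    (integral_sub_right_eq_self (fun v => 𝓕 g v * phase (ε • v) m) w).symm
  simp only [sub_mul]
  rw [integral_sub (hint hi1) (hint (𝓕 g).integrable), apply_eq_integral_fourier, one_mul]
  congr 1
  rw [hshift, ← integral_const_mul]
  refine integral_congr_ae (Filter.Eventually.of_forall fun v => ?_)
  have : phase (ε • v) m = phase (ε • w) m * phase (ε • (v - w)) m := by
    rw [← phase_add_left, ← smul_add, add_sub_cancel]
  simp only [this]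
  ring

/-- A first difference is the dual action minus the identity, of norm at most `2`; iterate. -/
theorem lpENorm_phase_sub_one_pow_mul_le {θ : Matrix (Fin d) (Fin d) ℝ} {p : ℝ≥0∞} (hp : 1 ≤ p)
    (n : ℕ) (u : EuclideanSpace ℝ (Fin d)) (c : (Fin d → ℤ) → ℂ) :
    lpENorm θ p (fun m => (phase u m - 1) ^ n * c m) ≤
      ENNReal.ofReal (2 ^ n) * lpENorm θ p c := by
  have h1 : ∀ c : (Fin d → ℤ) → ℂ, lpENorm θ p (fun m => (phase u m - 1) * c m) ≤
      ENNReal.ofReal 2 * lpENorm θ p c := by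
    refine lpENorm_mul_le hp (fun y => dualAction u y + -y) two_pos
      (fun y hy => add_mem (dualAction_mem hy u) (neg_mem hy)) (fun y hy => ?_) (fun y _ m => ?_)
    · refine (torusNorm_add_le hp (dualAction_mem hy u) (neg_mem hy)).trans ?_
      linarith [torusNorm_dualAction_le hp u y, torusNorm_neg_le hp hy]
    · rw [← opCoeffCLM_apply, map_add, map_neg, opCoeffCLM_apply, opCoeffCLM_apply, opCoeff_eq,
        dualAction_vac, opCoeff_eq]
      ring
  induction n with
  | zero => simp
  | succ n ih =>
    have := h1 fun m => (phase u m - 1) ^ n * c m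
    simp only [← mul_assoc, ← pow_succ'] at this
    refine this.trans ((mul_le_mul_right ih _).trans_eq ?_)
    rw [← mul_assoc, ← ENNReal.ofReal_mul (by norm_num), ← pow_succ']

/-- A bump equal to `1` on the ball of radius `2` contains the support of `φ`. Its dilates act as
the identity on blocks, so a smooth cutoff can be inserted before each difference. -/
theorem lpENorm_lpBlock_cutoff (φ : 𝓢(EuclideanSpace ℝ (Fin d), ℝ)) (hφ : IsLittlewoodPaley φ) :
    ∃ η : 𝓢(EuclideanSpace ℝ (Fin d), ℂ), ∀ ξ, η ξ * (φ ξ : ℂ) = φ ξ := by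
  let b : ContDiffBump (0 : EuclideanSpace ℝ (Fin d)) := ⟨2, 3, by norm_num, by norm_num⟩
  have hs : HasCompactSupport fun ξ => ((b ξ : ℝ) : ℂ) :=
    b.hasCompactSupport.comp_left (g := fun t : ℝ => (t : ℂ)) Complex.ofReal_zero
  have hc : ContDiff ℝ ((⊤ : ℕ∞) : WithTop ℕ∞) fun ξ => ((b ξ : ℝ) : ℂ) :=
    Complex.ofRealCLM.contDiff.comp b.contDiff
  refine ⟨hs.toSchwartzMap hc, fun ξ => ?_⟩
  by_cases h : φ ξ = 0
  · simp [h]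
  · have hξ := hφ.support (subset_tsupport _ h)
    have : b ξ = 1 := b.one_of_mem_closedBall (by simpa [b] using hξ.2)
    change ((b ξ : ℝ) : ℂ) * _ = _
    rw [this, Complex.ofReal_one, one_mul]

/-- A Bernstein inequality for differences of Littlewood-Paley blocks. -/
theorem exists_lpENorm_diff_lpBlock_le (φ : 𝓢(EuclideanSpace ℝ (Fin d), ℝ))
    (hφ : IsLittlewoodPaley φ) (n : ℕ) :
    ∃ K : ℝ, 0 < K ∧ ∀ (θ : Matrix (Fin d) (Fin d) ℝ) (p : ℝ≥0∞), 1 ≤ p →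
      ∀ (x : Distribution θ) (k : ℕ) (u : EuclideanSpace ℝ (Fin d)), 0 < ‖u‖ →
        2 ^ k * ‖u‖ ≤ 1 →
        lpENorm θ p (fun m => (phase u m - 1) ^ n * lpBlock φ k x m) ≤
          ENNReal.ofReal ((K * (2 ^ k * ‖u‖)) ^ n) * lpENorm θ p (lpBlock φ k x) := by
  obtain ⟨η, hη⟩ := lpENorm_lpBlock_cutoff φ hφ
  obtain ⟨K, hK, h⟩ := exists_lpENorm_diff_schwartz_mul_le η
  refine ⟨K, hK, fun θ p hp x k u hu hku => ?_⟩
  -- Rescaling: at dilation `2^{-k}` the step `u` becomes `w`, and the hypothesis on `u` says `‖w‖ ≤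
  -- 1`.
  set w : EuclideanSpace ℝ (Fin d) := (2 : ℝ) ^ k • u
  have hw : ‖w‖ = 2 ^ k * ‖u‖ := by simp [w, norm_smul]
  have huw : ((2 : ℝ) ^ (-(k : ℤ))) • w = u := by
    rw [smul_smul, zpow_neg, zpow_natCast, inv_mul_cancel₀ (by positivity), one_smul]
  have hblock : ∀ m, η ((2 : ℝ) ^ (-(k : ℤ)) • latticePoint m) * lpBlock φ k x m =
      lpBlock φ k x m := by
    intro m
    rw [lpBlock, ← mul_assoc, hη]
  induction n with
  | zero => simp
  | succ n ih =>
    have h1 := h θ p hp ((2 : ℝ) ^ (-(k : ℤ))) w (by rw [hw]; positivity) (hw ▸ hku)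
      fun m => (phase u m - 1) ^ n * lpBlock φ k x m
    rw [huw, hw] at h1
    have e : (fun m => (phase u m - 1) * η ((2 : ℝ) ^ (-(k : ℤ)) • latticePoint m) *
        ((phase u m - 1) ^ n * lpBlock φ k x m)) =
        fun m => (phase u m - 1) ^ (n + 1) * lpBlock φ k x m := by
      ext m
      nth_rw 2 [← hblock m]
      ring
    rw [e] at h1
    refine h1.trans ((mul_le_mul_right ih _).trans_eq ?_)
    rw [← mul_assoc, ← ENNReal.ofReal_mul (by positivity), ← pow_succ']

/-- The character `e^{2πi v·ξ}` on `ℝ^d`, minus one. -/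
def charSubOne (v ξ : EuclideanSpace ℝ (Fin d)) : ℂ :=
  Complex.exp (((2 * Real.pi * inner ℝ v ξ : ℝ) : ℂ) * Complex.I) - 1

theorem contDiff_charSubOne (v : EuclideanSpace ℝ (Fin d)) :
    ContDiff ℝ ((⊤ : ℕ∞) : WithTop ℕ∞) (charSubOne v) := by
  unfold charSubOne
  refine ContDiff.sub (ContDiff.cexp (ContDiff.mul ?_ contDiff_const)) contDiff_const
  exact Complex.ofRealCLM.contDiff.comp (contDiff_const.mul (contDiff_const.inner ℝ contDiff_id))

theorem charSubOne_ne_zero {v ξ : EuclideanSpace ℝ (Fin d)} (h0 : inner ℝ v ξ ≠ 0)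
    (h1 : |inner ℝ v ξ| < 1) : charSubOne v ξ ≠ 0 := by
  intro h
  rw [charSubOne, sub_eq_zero, Complex.exp_eq_one_iff] at h
  obtain ⟨n, hn⟩ := h
  have h2 : (inner ℝ v ξ : ℝ) = n := by
    have h3 : ((inner ℝ v ξ : ℝ) : ℂ) * (2 * Real.pi * Complex.I) =
        (n : ℂ) * (2 * Real.pi * Complex.I) := by
      rw [← hn]; push_cast; ring
    have h4 := mul_right_cancel₀ Complex.two_pi_I_ne_zero h3
    exact_mod_cast h4
  rw [h2] at h0 h1
  have h5 : |n| < 1 := by exact_mod_cast h1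
  have h6 : n ≠ 0 := by exact_mod_cast h0
  exact h6 (Int.abs_lt_one_iff.1 h5)

/-- The steps `e_j / 4`. -/
def quarterStep (j : Fin d) : EuclideanSpace ℝ (Fin d) := EuclideanSpace.single j (1 / 4)

theorem norm_quarterStep (j : Fin d) : ‖quarterStep j‖ = 1 / 4 := by
  simp [quarterStep]

theorem inner_quarterStep (j : Fin d) (ξ : EuclideanSpace ℝ (Fin d)) :
    inner ℝ (quarterStep j) ξ = ξ j / 4 := by
  simp [quarterStep, EuclideanSpace.inner_single_left]
  ring

/-- `∑_j |e^{2πi u_j·ξ} - 1|^{2n}` for the steps `u_j = e_j / 4`. -/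
def stepSum (n : ℕ) (ξ : EuclideanSpace ℝ (Fin d)) : ℂ :=
  ∑ j, (starRingEnd ℂ (charSubOne (quarterStep j) ξ) * charSubOne (quarterStep j) ξ) ^ n

/-- With steps of length `1/4` the phases are `ξ_j/4`, of modulus less than `1`, so a nonzero
coordinate contributes a strictly positive term. The region covers the support of `φ`, where `1/2 ≤
‖ξ‖ ≤ 2`. -/
theorem stepSum_ne_zero (n : ℕ) {ξ : EuclideanSpace ℝ (Fin d)} (h0 : ξ ≠ 0) (h4 : ‖ξ‖ < 4) :
    stepSum n ξ ≠ 0 := by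
  obtain ⟨j, hj⟩ : ∃ j, ξ j ≠ 0 := by
    by_contra! h
    exact h0 (by ext j; simpa using h j)
  have hs : stepSum n ξ =
      ((∑ j, Complex.normSq (charSubOne (quarterStep j) ξ) ^ n : ℝ) : ℂ) := by
    rw [stepSum]
    push_cast
    simp only [Complex.normSq_eq_conj_mul_self]
  have hpos : 0 < Complex.normSq (charSubOne (quarterStep j) ξ) ^ n := by
    refine pow_pos (Complex.normSq_pos.2 (charSubOne_ne_zero ?_ ?_)) n
    · rw [inner_quarterStep]
      exact div_ne_zero hj four_ne_zero
    · rw [inner_quarterStep, abs_div, abs_of_pos (zero_lt_four : (0 : ℝ) < 4),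
        div_lt_one zero_lt_four]
      exact (PiLp.norm_apply_le ξ j).trans_lt h4
  have hsum : 0 < ∑ j, Complex.normSq (charSubOne (quarterStep j) ξ) ^ n :=
    Finset.sum_pos' (fun i _ => pow_nonneg (Complex.normSq_nonneg _) n)
      ⟨j, Finset.mem_univ j, hpos⟩
  rw [hs]
  exact Complex.ofReal_ne_zero.2 hsum.ne'

/-- Division of `φ` by differences: no single `(e^{2πi ξ_j/4} - 1)^n` need be nonzero throughout the
support, but the sum of their squared moduli is. -/
theorem exists_schwartz_decomposition (φ : 𝓢(EuclideanSpace ℝ (Fin d), ℝ))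
    (hφ : IsLittlewoodPaley φ) (n : ℕ) :
    ∃ g : Fin d → 𝓢(EuclideanSpace ℝ (Fin d), ℂ), ∀ ξ,
      (φ ξ : ℂ) = ∑ j, g j ξ * charSubOne (quarterStep j) ξ ^ n := by
  have hne : ∀ ξ ∈ tsupport φ, stepSum n ξ ≠ 0 := by
    intro ξ hξ
    obtain ⟨h1, h2⟩ := hφ.support hξ
    refine stepSum_ne_zero n ?_ (by linarith)
    rw [← norm_pos_iff]
    linarith
  have hφc : HasCompactSupport φ :=
    HasCompactSupport.of_support_subset_isCompact (isCompact_closedBall 0 2) fun ξ hξ => by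
      simpa using (hφ.support (subset_tsupport _ hξ)).2
  have hφc' : HasCompactSupport fun ξ => (φ ξ : ℂ) :=
    hφc.comp_left (g := fun t : ℝ => (t : ℂ)) Complex.ofReal_zero
  have htsupp : tsupport (fun ξ => (φ ξ : ℂ)) ⊆ tsupport φ :=
    closure_mono fun ξ hξ => by
      simpa using hξ
  have hconj : ∀ j : Fin d, ContDiff ℝ ((⊤ : ℕ∞) : WithTop ℕ∞)
      fun ξ => starRingEnd ℂ (charSubOne (quarterStep j) ξ) := fun j =>
    Complex.conjCLE.contDiff.comp (contDiff_charSubOne _)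
  have hS : ContDiff ℝ ((⊤ : ℕ∞) : WithTop ℕ∞) (stepSum (d := d) n) :=
    ContDiff.sum fun j _ => ((hconj j).mul (contDiff_charSubOne _)).pow n
  let G : Fin d → EuclideanSpace ℝ (Fin d) → ℂ := fun j ξ =>
    (φ ξ : ℂ) * (starRingEnd ℂ (charSubOne (quarterStep j) ξ) ^ n * (stepSum n ξ)⁻¹)
  have hGs : ∀ j, HasCompactSupport (G j) := fun j => hφc'.mul_right
  have hGc : ∀ j, ContDiff ℝ ((⊤ : ℕ∞) : WithTop ℕ∞) (G j) := by
    intro j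
    refine contDiff_iff_contDiffAt.2 fun ξ => ?_
    -- Off its support `G j` is locally zero; on it the denominator does not vanish.
    by_cases hξ : ξ ∈ tsupport (G j)
    swap
    · exact contDiffAt_const.congr_of_eventuallyEq (notMem_tsupport_iff_eventuallyEq.1 hξ)
    have hξ' : ξ ∈ tsupport φ := htsupp (tsupport_mul_subset_left hξ)
    exact ((Complex.ofRealCLM.contDiff.comp (φ.smooth ⊤)).contDiffAt).mul
      (((hconj j).pow n).contDiffAt.mul (hS.contDiffAt.inv (hne ξ hξ')))
  refine ⟨fun j => (hGs j).toSchwartzMap (hGc j), fun ξ => ?_⟩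
  change (φ ξ : ℂ) = ∑ j, (φ ξ : ℂ) *
    (starRingEnd ℂ (charSubOne (quarterStep j) ξ) ^ n * (stepSum n ξ)⁻¹) *
      charSubOne (quarterStep j) ξ ^ n
  by_cases h : φ ξ = 0
  · simp [h]
  · have h1 := hne ξ (subset_tsupport _ h)
    have e : ∀ j, (φ ξ : ℂ) *
        (starRingEnd ℂ (charSubOne (quarterStep j) ξ) ^ n * (stepSum n ξ)⁻¹) *
          charSubOne (quarterStep j) ξ ^ n = (φ ξ : ℂ) * (stepSum n ξ)⁻¹ *
            (starRingEnd ℂ (charSubOne (quarterStep j) ξ) *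
              charSubOne (quarterStep j) ξ) ^ n := by
      intro j
      rw [mul_pow]
      ring
    simp only [e]
    rw [← Finset.mul_sum]
    change _ = _ * stepSum n ξ
    rw [mul_assoc, inv_mul_cancel₀ h1, mul_one]

theorem diffSeries_eq {θ : Matrix (Fin d) (Fin d) ℝ} (n : ℕ) (u : EuclideanSpace ℝ (Fin d))
    (x : Distribution θ) (m : Fin d → ℤ) :
    diffSeries n u x m = (phase u m - 1) ^ n * fourierCoeff x m := rfl

/-- Littlewood-Paley blocks are controlled by the modulus of smoothness. -/
theorem exists_lpENorm_lpBlock_le_modulus (φ : 𝓢(EuclideanSpace ℝ (Fin d), ℝ))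
    (hφ : IsLittlewoodPaley φ) (n : ℕ) :
    ∃ K : ℝ, 0 < K ∧ ∀ (θ : Matrix (Fin d) (Fin d) ℝ) (p : ℝ≥0∞), 1 ≤ p →
      ∀ (x : Distribution θ) (k : ℕ),
        lpENorm θ p (lpBlock φ k x) ≤ ENNReal.ofReal K * modulus n p x ((1 / 2) ^ (k + 2)) := by
  obtain ⟨g, hg⟩ := exists_schwartz_decomposition φ hφ n
  choose K hK hKg using fun j => exists_lpENorm_schwartz_mul_le (g j)
  have hK0 : 0 ≤ ∑ j, K j := Finset.sum_nonneg fun j _ => (hK j).le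
  refine ⟨∑ j, K j + 1, by linarith, fun θ p hp x k => ?_⟩
  set ε : ℝ := (2 : ℝ) ^ (-(k : ℤ)) with hε
  have hε' : ε = (1 / 2) ^ k := by rw [hε, zpow_neg, zpow_natCast, one_div, inv_pow]
  have e : lpBlock φ k x = fun m => ∑ j, g j (ε • latticePoint m) *
      diffSeries n (ε • quarterStep j) x m := by
    ext m
    rw [lpBlock, hg, Finset.sum_mul]
    refine Finset.sum_congr rfl fun j _ => ?_
    have : phase (ε • quarterStep j) m - 1 = charSubOne (quarterStep j) (ε • latticePoint m) := by
      rw [phase, charSubOne, inner_smul_left, inner_smul_right]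
      rfl
    rw [diffSeries_eq, this]
    ring
  rw [e]
  have hmod : ∀ j, lpENorm θ p (diffSeries n (ε • quarterStep j) x) ≤
      modulus n p x ((1 / 2) ^ (k + 2)) := by
    intro j
    -- Steps of length `2^{-k} / 4`, the source of the exponent `k + 2`.
    have hn : ‖ε • quarterStep j‖ = (1 / 2) ^ (k + 2) := by
      rw [norm_smul, norm_quarterStep, hε', Real.norm_of_nonneg (by positivity), pow_add]
      norm_num
    exact le_iSup₂_of_le (f := fun u (_ : 0 < ‖u‖ ∧ ‖u‖ ≤ (1 / 2 : ℝ) ^ (k + 2)) =>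
      lpENorm θ p (diffSeries n u x)) (ε • quarterStep j)
      ⟨hn ▸ by positivity, hn.le⟩ le_rfl
  calc _ ≤ ∑ j, lpENorm θ p (fun m => g j (ε • latticePoint m) *
        diffSeries n (ε • quarterStep j) x m) := lpENorm_sum_le hp _ _
    _ ≤ ∑ j, ENNReal.ofReal (K j) * modulus n p x ((1 / 2) ^ (k + 2)) :=
        Finset.sum_le_sum fun j _ => (hKg j θ p hp ε _).trans (mul_le_mul_right (hmod j) _)
    _ ≤ _ := by
        rw [← Finset.sum_mul, ← ENNReal.ofReal_sum_of_nonneg fun j _ => (hK j).le]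
        gcongr
        linarith

end Multipliers

end QTorus
end

noncomputable section

namespace QTorus

/-! ### Sequence inequalities and dyadic decomposition of integrals -/

section Sequences

/-- With truncated subtraction the exponent is `|j - k|`. It takes each value at most twice,
according to the side on which `k` lies, so the sum is at most two geometric series. -/
theorem tsum_pow_dist_le (r : ℝ≥0∞) (j : ℕ) :
    ∑' k : ℕ, r ^ ((j - k) + (k - j)) ≤ 2 * (1 - r)⁻¹ := by
  have hinj : Function.Injective fun k : ℕ => ((j - k) + (k - j), decide (k < j)) := by
    intro a b hab
    simp only [Prod.mk.injEq, decide_eq_decide] at hab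
    omega
  calc ∑' k : ℕ, r ^ ((j - k) + (k - j)) ≤ ∑' q : ℕ × Bool, r ^ q.1 :=
        ENNReal.tsum_comp_le_tsum_of_injective hinj fun q : ℕ × Bool => r ^ q.1
    _ = 2 * (1 - r)⁻¹ := by
        rw [ENNReal.tsum_prod (f := fun i (_ : Bool) => r ^ i)]
        simp only [tsum_fintype, Fintype.univ_bool, Finset.sum_const, nsmul_eq_mul]
        rw [ENNReal.tsum_mul_left, ENNReal.tsum_geometric]
        norm_num

theorem rpow_tsum_mul_le {q : ℝ} (hq : 1 ≤ q) (w b : ℕ → ℝ≥0∞) {A : ℝ≥0∞}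
    (hA : ∑' k, w k ≤ A) : (∑' k, w k * b k) ^ q ≤ A ^ (q - 1) * ∑' k, w k * b k ^ q := by
  have hq0 : 0 < q := by linarith
  have h1 : ∑' k, w k * b k ≤ A ^ (1 - q⁻¹) * (∑' k, w k * b k ^ q) ^ q⁻¹ := by
    rw [ENNReal.tsum_eq_iSup_sum]
    refine iSup_le fun s => ?_
    refine (ENNReal.inner_le_weight_mul_Lp_of_nonneg s hq w b).trans ?_
    have : 0 ≤ 1 - q⁻¹ := sub_nonneg.2 (inv_le_one_of_one_le₀ hq)
    gcongr
    · exact (ENNReal.sum_le_tsum s).trans hA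
    · exact ENNReal.sum_le_tsum s
  refine (ENNReal.rpow_le_rpow h1 hq0.le).trans_eq ?_
  rw [ENNReal.mul_rpow_of_nonneg _ _ hq0.le, ← ENNReal.rpow_mul, ← ENNReal.rpow_mul,
    inv_mul_cancel₀ hq0.ne', ENNReal.rpow_one, sub_mul, inv_mul_cancel₀ hq0.ne', one_mul]

/-- Schur's test on sequences. -/
theorem tsum_rpow_tsum_mul_le {q : ℝ} (hq : 1 ≤ q) (w : ℕ → ℕ → ℝ≥0∞) (b : ℕ → ℝ≥0∞) {A : ℝ≥0∞}
    (hrow : ∀ j, ∑' k, w j k ≤ A) (hcol : ∀ k, ∑' j, w j k ≤ A) :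
    ∑' j, (∑' k, w j k * b k) ^ q ≤ A ^ q * ∑' k, b k ^ q := by
  calc ∑' j, (∑' k, w j k * b k) ^ q ≤ ∑' j, A ^ (q - 1) * ∑' k, w j k * b k ^ q :=
        ENNReal.tsum_le_tsum fun j => rpow_tsum_mul_le hq (w j) b (hrow j)
    _ = A ^ (q - 1) * ∑' k, (∑' j, w j k) * b k ^ q := by
        rw [ENNReal.tsum_mul_left, ENNReal.tsum_comm]
        simp only [ENNReal.tsum_mul_right]
    _ ≤ A ^ (q - 1) * ∑' k, A * b k ^ q := by
        gcongr with k
        exact hcol k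
    _ = A ^ q * ∑' k, b k ^ q := by
        rw [ENNReal.tsum_mul_left, ← mul_assoc]
        congr 1
        nth_rw 2 [← ENNReal.rpow_one A]
        rw [← ENNReal.rpow_add_of_nonneg _ _ (by linarith) zero_le_one, sub_add_cancel]

/-- The constant enters as `D ^ q` and leaves as `D`, hence independent of `q`; `1 ≤ D` takes care
of the mean term. -/
theorem rpow_add_rpow_le {q : ℝ} (hq : 1 ≤ q) {c S T D : ℝ≥0∞} (hD : 1 ≤ D)
    (h : T ≤ D ^ q * S) : (c ^ q + T) ^ (1 / q) ≤ D * (c ^ q + S) ^ (1 / q) := by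
  have hq0 : 0 < q := by linarith
  have h1 : c ^ q + T ≤ D ^ q * (c ^ q + S) := by
    rw [mul_add]
    refine add_le_add (le_mul_of_one_le_left zero_le ?_) h
    exact ENNReal.one_le_rpow hD hq0
  refine (ENNReal.rpow_le_rpow h1 (by positivity)).trans_eq ?_
  rw [ENNReal.mul_rpow_of_nonneg _ _ (by positivity), ← ENNReal.rpow_mul, mul_one_div_cancel hq0.ne',
    ENNReal.rpow_one]

theorem iUnion_Ioc_half_pow :
    ⋃ j : ℕ, Set.Ioc ((1 / 2 : ℝ) ^ (j + 1)) ((1 / 2) ^ j) = Set.Ioc 0 1 := by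
  ext ε
  simp only [Set.mem_iUnion, Set.mem_Ioc]
  constructor
  · rintro ⟨j, h1, h2⟩
    exact ⟨lt_trans (by positivity) h1, h2.trans (pow_le_one₀ (by norm_num) (by norm_num))⟩
  · rintro ⟨h1, h2⟩
    exact exists_nat_pow_near_of_lt_one h1 h2 (by norm_num) (by norm_num)

theorem lintegral_Ioc_eq_tsum (f : ℝ → ℝ≥0∞) : ∫⁻ ε in Set.Ioc (0 : ℝ) 1, f ε =
    ∑' j : ℕ, ∫⁻ ε in Set.Ioc ((1 / 2 : ℝ) ^ (j + 1)) ((1 / 2) ^ j), f ε := by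
  rw [← iUnion_Ioc_half_pow, MeasureTheory.lintegral_iUnion fun _ => measurableSet_Ioc]
  have : Antitone fun j : ℕ => (1 / 2 : ℝ) ^ j :=
    pow_right_anti₀ (by norm_num) (by norm_num)
  exact this.pairwise_disjoint_on_Ioc_succ

variable {α q : ℝ} {ω : ℝ → ℝ≥0∞}

theorem ofReal_rpow_neg_antitone (hα : 0 < α) {s t : ℝ} (hs : 0 < s) (hst : s ≤ t) :
    ENNReal.ofReal (t ^ (-α)) ≤ ENNReal.ofReal (s ^ (-α)) :=
  ENNReal.ofReal_le_ofReal (Real.rpow_le_rpow_of_nonpos hs hst (by linarith))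

theorem ofReal_half_pow_rpow_neg (α : ℝ) (j : ℕ) :
    ENNReal.ofReal (((1 / 2 : ℝ) ^ j) ^ (-α)) = ENNReal.ofReal ((2 : ℝ) ^ ((j : ℝ) * α)) := by
  congr 1
  rw [one_div, inv_pow, Real.inv_rpow (by positivity), Real.rpow_neg (by positivity), inv_inv,
    ← Real.rpow_natCast, ← Real.rpow_mul (by norm_num)]

theorem dyadic_integrand_eq (hq : 0 ≤ q) {ε : ℝ} (hε : 0 < ε) :
    ENNReal.ofReal (ε ^ (-(q * α))) * ω ε ^ q * ENNReal.ofReal (1 / ε) =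
      (ENNReal.ofReal (ε ^ (-α)) * ω ε) ^ q * ENNReal.ofReal (1 / ε) := by
  rw [ENNReal.mul_rpow_of_nonneg _ _ hq, ENNReal.ofReal_rpow_of_nonneg (by positivity) hq,
    ← Real.rpow_mul hε.le]
  congr 4
  ring

/-- On each dyadic interval the power is largest at the left end and `ω` at the right end. The bound
`1/ε ≤ 2^{j+1}` times the length `2^{-j-1}` is `1`. -/
theorem lintegral_dyadic_le (hα : 0 < α) (hq : 0 ≤ q) (hω : Monotone ω) :
    ∫⁻ ε in Set.Ioc (0 : ℝ) 1, ENNReal.ofReal (ε ^ (-(q * α))) * ω ε ^ q * ENNReal.ofReal (1 / ε) ≤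
      ∑' j : ℕ, (ENNReal.ofReal (((1 / 2 : ℝ) ^ (j + 1)) ^ (-α)) * ω ((1 / 2) ^ j)) ^ q := by
  rw [lintegral_Ioc_eq_tsum]
  refine ENNReal.tsum_le_tsum fun j => ?_
  have hpos : (0 : ℝ) < (1 / 2) ^ (j + 1) := by positivity
  calc _ ≤ ∫⁻ _ in Set.Ioc ((1 / 2 : ℝ) ^ (j + 1)) ((1 / 2) ^ j),
        (ENNReal.ofReal (((1 / 2 : ℝ) ^ (j + 1)) ^ (-α)) * ω ((1 / 2) ^ j)) ^ q *
          ENNReal.ofReal (1 / (1 / 2) ^ (j + 1)) := by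
        refine MeasureTheory.setLIntegral_mono' measurableSet_Ioc fun ε hε => ?_
        have hε0 : 0 < ε := hpos.trans hε.1
        rw [dyadic_integrand_eq hq hε0]
        exact mul_le_mul'
          (ENNReal.rpow_le_rpow
            (mul_le_mul' (ofReal_rpow_neg_antitone hα hpos hε.1.le) (hω hε.2)) hq)
          (ENNReal.ofReal_le_ofReal (one_div_le_one_div_of_le hpos hε.1.le))
    _ = _ := by
        rw [MeasureTheory.setLIntegral_const, Real.volume_Ioc, mul_assoc,
          ← ENNReal.ofReal_mul (by positivity)]
        have : (1 / (1 / 2) ^ (j + 1) : ℝ) * ((1 / 2) ^ j - (1 / 2) ^ (j + 1)) = 1 := by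
          rw [pow_succ]; field_simp; norm_num
        rw [this, ENNReal.ofReal_one, mul_one]

/-- The endpoints exchange roles, and `1/ε ≥ 2^j` gives each interval mass at least `1/2`, whence
the factor `2`. -/
theorem tsum_dyadic_le_lintegral (hα : 0 < α) (hq : 0 ≤ q) (hω : Monotone ω) :
    ∑' j : ℕ, (ENNReal.ofReal (((1 / 2 : ℝ) ^ j) ^ (-α)) * ω ((1 / 2) ^ (j + 1))) ^ q ≤
      2 * ∫⁻ ε in Set.Ioc (0 : ℝ) 1,
        ENNReal.ofReal (ε ^ (-(q * α))) * ω ε ^ q * ENNReal.ofReal (1 / ε) := by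
  rw [lintegral_Ioc_eq_tsum, ← ENNReal.tsum_mul_left]
  refine ENNReal.tsum_le_tsum fun j => ?_
  have hpos : (0 : ℝ) < (1 / 2) ^ (j + 1) := by positivity
  calc (ENNReal.ofReal (((1 / 2 : ℝ) ^ j) ^ (-α)) * ω ((1 / 2) ^ (j + 1))) ^ q
      = 2 * ∫⁻ _ in Set.Ioc ((1 / 2 : ℝ) ^ (j + 1)) ((1 / 2) ^ j),
        (ENNReal.ofReal (((1 / 2 : ℝ) ^ j) ^ (-α)) * ω ((1 / 2) ^ (j + 1))) ^ q *
          ENNReal.ofReal (1 / (1 / 2) ^ j) := by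
        rw [MeasureTheory.setLIntegral_const, Real.volume_Ioc, mul_assoc,
          ← ENNReal.ofReal_mul (by positivity)]
        have : (1 / (1 / 2) ^ j : ℝ) * ((1 / 2) ^ j - (1 / 2) ^ (j + 1)) = 1 / 2 := by
          rw [pow_succ]; field_simp; norm_num
        rw [this, mul_left_comm, ← ENNReal.ofReal_ofNat, ← ENNReal.ofReal_mul (by norm_num)]
        norm_num
    _ ≤ _ := by
        gcongr 2 * ?_
        refine MeasureTheory.setLIntegral_mono' measurableSet_Ioc fun ε hε => ?_
        have hε0 : 0 < ε := hpos.trans hε.1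
        rw [dyadic_integrand_eq hq hε0]
        exact mul_le_mul'
          (ENNReal.rpow_le_rpow
            (mul_le_mul' (ofReal_rpow_neg_antitone hα hε0 hε.2) (hω hε.1.le)) hq)
          (ENNReal.ofReal_le_ofReal (one_div_le_one_div_of_le hε0 hε.2))

end Sequences

/-! ### Littlewood-Paley decomposition and comparison of the norms -/

variable {d : ℕ}

/-- The support condition leaves the sphere `‖ξ‖ = 2` open; there the value vanishes by continuity
along the ray from outside. -/
theorem IsLittlewoodPaley.eq_zero_of_two_le {φ : 𝓢(EuclideanSpace ℝ (Fin d), ℝ)}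
    (hφ : IsLittlewoodPaley φ) {ξ : EuclideanSpace ℝ (Fin d)} (h : 2 ≤ ‖ξ‖) : φ ξ = 0 := by
  have hlim : Filter.Tendsto (fun t : ℝ => φ (t • ξ)) (nhdsWithin 1 (Set.Ioi 1)) (nhds (φ ξ)) := by
    have hc : Continuous fun t : ℝ => φ (t • ξ) := φ.continuous.comp (by fun_prop)
    have := hc.tendsto 1
    rw [one_smul] at this
    exact this.mono_left nhdsWithin_le_nhds
  refine tendsto_nhds_unique hlim (tendsto_const_nhds.congr' ?_)
  filter_upwards [self_mem_nhdsWithin] with t ht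
  have ht : 1 < t := ht
  by_contra hne
  have := (hφ.support (subset_tsupport _ (Ne.symm hne))).2
  rw [norm_smul, Real.norm_of_nonneg (by linarith)] at this
  nlinarith

theorem one_le_norm_latticePoint {m : Fin d → ℤ} (hm : m ≠ 0) : 1 ≤ ‖latticePoint m‖ := by
  obtain ⟨j, hj⟩ : ∃ j, m j ≠ 0 := by
    by_contra! h
    exact hm (funext h)
  refine le_trans ?_ (PiLp.norm_apply_le (latticePoint m) j)
  change 1 ≤ ‖(m j : ℝ)‖
  rw [Real.norm_eq_abs]
  exact_mod_cast Int.one_le_abs hj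

/-- Nonzero lattice points have norm at least `1`, so the terms with `k < 0` of the partition of
unity vanish at them; all blocks vanish at `m = 0`. -/
theorem hasSum_lpBlock {φ : 𝓢(EuclideanSpace ℝ (Fin d), ℝ)} (hφ : IsLittlewoodPaley φ)
    {θ : Matrix (Fin d) (Fin d) ℝ} (x : Distribution θ) (m : Fin d → ℤ) :
    HasSum (fun k : ℕ => lpBlock φ k x m) (if m = 0 then 0 else fourierCoeff x m) := by
  split_ifs with hm
  · subst hm
    have h0 : φ 0 = 0 := by
      by_contra hne
      have := (hφ.support (subset_tsupport _ hne)).1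
      rw [norm_zero] at this
      norm_num at this
    have : (fun k : ℕ => lpBlock φ k x 0) = fun _ => 0 := by
      ext k
      simp [lpBlock, latticePoint_zero, h0]
    rw [this]
    exact hasSum_zero
  · have h1 := one_le_norm_latticePoint hm
    have hne : latticePoint m ≠ 0 := by
      rw [← norm_pos_iff]; linarith
    have h2 := hφ.sum_eq_one _ hne
    rw [← Nat.cast_injective.hasSum_iff (g := fun k : ℕ => (k : ℤ))] at h2
    · have h3 := (Complex.hasSum_ofReal.2 h2).mul_right (fourierCoeff x m)
      simpa [lpBlock] using h3
    · intro k hk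
      apply hφ.eq_zero_of_two_le
      have hk' : ∃ l : ℕ, -k = l + 1 := by
        rcases le_or_gt 0 k with h | h
        · exact absurd ⟨k.toNat, Int.toNat_of_nonneg h⟩ hk
        · exact ⟨(-k - 1).toNat, by omega⟩
      obtain ⟨l, hl⟩ := hk'
      rw [norm_smul, hl, Real.norm_of_nonneg (by positivity), zpow_add_one₀ (by norm_num),
        zpow_natCast]
      have : (1 : ℝ) ≤ 2 ^ l := one_le_pow₀ (by norm_num)
      nlinarith

theorem modulus_mono {θ : Matrix (Fin d) (Fin d) ℝ} (n : ℕ) (p : ℝ≥0∞) (x : Distribution θ) :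
    Monotone (modulus n p x) := fun _ _ hst =>
  iSup₂_mono' fun u hu => ⟨u, ⟨hu.1, hu.2.trans hst⟩, le_rfl⟩

theorem lpENorm_diffSeries_le_modulus {θ : Matrix (Fin d) (Fin d) ℝ} (n : ℕ) (p : ℝ≥0∞)
    (x : Distribution θ) {u : EuclideanSpace ℝ (Fin d)} {ε : ℝ} (hu : 0 < ‖u‖) (hε : ‖u‖ ≤ ε) :
    lpENorm θ p (diffSeries n u x) ≤ modulus n p x ε :=
  le_iSup₂_of_le (f := fun u (_ : 0 < ‖u‖ ∧ ‖u‖ ≤ ε) => lpENorm θ p (diffSeries n u x)) u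
    ⟨hu, hε⟩ le_rfl

/-- The blocks miss only the mean of `x`, which a difference of order `n ≠ 0` annihilates. -/
theorem lpENorm_diffSeries_le_tsum {φ : 𝓢(EuclideanSpace ℝ (Fin d), ℝ)} (hφ : IsLittlewoodPaley φ)
    {θ : Matrix (Fin d) (Fin d) ℝ} {n : ℕ} (hn : n ≠ 0) {p : ℝ≥0∞} (hp : 1 ≤ p)
    (x : Distribution θ) (u : EuclideanSpace ℝ (Fin d)) :
    lpENorm θ p (diffSeries n u x) ≤
      ∑' k : ℕ, lpENorm θ p (fun m => (phase u m - 1) ^ n * lpBlock φ k x m) := by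
  refine lpENorm_le_tsum_lpENorm hp fun m => ?_
  have := (hasSum_lpBlock hφ x m).mul_left ((phase u m - 1) ^ n)
  convert! this using 1
  rw [diffSeries_eq]
  split_ifs with hm
  · subst hm
    simp [phase_zero_right, hn]
  · rfl

/-- Used with `β = 2^α`. Low frequencies `k ≤ j` gain `2^{α-n}` per scale from the Bernstein
inequality, high frequencies gain `2^{-α}` from the weight. -/
theorem weight_le {β ρ K : ℝ} {n : ℕ} (hβ : 1 < β) (hρ1 : β⁻¹ ≤ ρ) (hρ2 : β * (1 / 2) ^ n ≤ ρ)
    (hK : 0 < K) (j k : ℕ) {t : ℝ} (ht : 0 < t) (htj : t ≤ (1 / 2) ^ j) :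
    β ^ j * (if k ≤ j then (K * (2 ^ k * t)) ^ n else 2 ^ n) ≤
      (K ^ n + 2 ^ n) * (ρ ^ ((j - k) + (k - j)) * β ^ k) := by
  have hβ0 : 0 < β := by linarith
  have hρ0 : 0 < ρ := (inv_pos.2 hβ0).trans_le hρ1
  have hK' : 0 < K ^ n := by positivity
  split_ifs with h
  · obtain ⟨i, rfl⟩ := Nat.exists_eq_add_of_le h
    have e1 : (k + i - k) + (k - (k + i)) = i := by omega
    have h1 : 2 ^ k * t ≤ (1 / 2) ^ i := by
      calc 2 ^ k * t ≤ 2 ^ k * (1 / 2) ^ (k + i) := by gcongr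
        _ = (1 / 2) ^ i := by
          rw [pow_add, ← mul_assoc, ← mul_pow]; norm_num
    rw [e1]
    calc β ^ (k + i) * (K * (2 ^ k * t)) ^ n ≤ β ^ (k + i) * (K * (1 / 2) ^ i) ^ n := by gcongr
      _ = K ^ n * ((β * (1 / 2) ^ n) ^ i * β ^ k) := by
        rw [mul_pow, mul_pow, ← pow_mul, ← pow_mul, mul_comm i n, pow_add]; ring
      _ ≤ K ^ n * (ρ ^ i * β ^ k) := by gcongr
      _ ≤ _ := by
        gcongr
        linarith [show (0 : ℝ) < 2 ^ n by positivity]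
  · obtain ⟨i, rfl⟩ := Nat.exists_eq_add_of_le (not_le.1 h).le
    have e1 : (j - (j + i)) + (j + i - j) = i := by omega
    rw [e1]
    calc β ^ j * 2 ^ n = 2 ^ n * (β⁻¹ ^ i * β ^ (j + i)) := by
          rw [pow_add, inv_pow]; field_simp
      _ ≤ 2 ^ n * (ρ ^ i * β ^ (j + i)) := by gcongr
      _ ≤ _ := by
        gcongr
        linarith

/-- The modulus of smoothness at dyadic scales is controlled by the Littlewood-Paley blocks. -/
theorem exists_modulus_le_tsum (φ : 𝓢(EuclideanSpace ℝ (Fin d), ℝ)) (hφ : IsLittlewoodPaley φ)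
    {α : ℝ} {n : ℕ} (hα : 0 < α) (hαn : α < n) :
    ∃ (ρ : ℝ≥0) (K : ℝ), ρ < 1 ∧ (2 : ℝ) ^ (-α) ≤ ρ ∧ 0 < K ∧
      ∀ (θ : Matrix (Fin d) (Fin d) ℝ) (p : ℝ≥0∞), 1 ≤ p → ∀ (x : Distribution θ) (j : ℕ),
        ENNReal.ofReal ((2 : ℝ) ^ ((j : ℝ) * α)) * modulus n p x ((1 / 2) ^ j) ≤
          ENNReal.ofReal K * ∑' k : ℕ, (ρ : ℝ≥0∞) ^ ((j - k) + (k - j)) *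
            (ENNReal.ofReal ((2 : ℝ) ^ ((k : ℝ) * α)) * lpENorm θ p (lpBlock φ k x)) := by
  obtain ⟨K, hK, h⟩ := exists_lpENorm_diff_lpBlock_le φ hφ n
  have hn : n ≠ 0 := by
    rintro rfl
    simp only [Nat.cast_zero] at hαn
    linarith
  set β : ℝ := 2 ^ α with hβ
  have hβ1 : 1 < β := Real.one_lt_rpow (by norm_num) hα
  have hβn : β * (1 / 2) ^ n < 1 := by
    have : β < 2 ^ n := by
      rw [hβ, ← Real.rpow_natCast]
      exact Real.rpow_lt_rpow_of_exponent_lt (by norm_num) hαn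
    rw [one_div, inv_pow, ← div_eq_mul_inv, div_lt_one (by positivity)]
    exact this
  have hβpow : ∀ j : ℕ, (2 : ℝ) ^ ((j : ℝ) * α) = β ^ j := by
    intro j
    rw [mul_comm, Real.rpow_mul (by norm_num), Real.rpow_natCast]
  have hρ0 : 0 ≤ max β⁻¹ (β * (1 / 2) ^ n) := le_max_of_le_left (by positivity)
  obtain ⟨ρ, hρ⟩ : ∃ ρ : ℝ≥0, (ρ : ℝ) = max β⁻¹ (β * (1 / 2) ^ n) := ⟨⟨_, hρ0⟩, rfl⟩
  refine ⟨ρ, K ^ n + 2 ^ n, ?_, ?_, by positivity, fun θ p hp x j => ?_⟩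
  · rw [← NNReal.coe_lt_coe, hρ]
    exact max_lt (inv_lt_one_of_one_lt₀ hβ1) hβn
  · rw [Real.rpow_neg (by norm_num), hρ]
    exact le_max_left _ _
  · rw [modulus, ENNReal.mul_iSup]
    refine iSup_le fun u => ?_
    rw [ENNReal.mul_iSup]
    refine iSup_le fun ⟨hu, huj⟩ => ?_
    refine (mul_le_mul_right (lpENorm_diffSeries_le_tsum hφ hn hp x u) _).trans ?_
    rw [← ENNReal.tsum_mul_left, ← ENNReal.tsum_mul_left]
    refine ENNReal.tsum_le_tsum fun k => ?_
    have hblock : lpENorm θ p (fun m => (phase u m - 1) ^ n * lpBlock φ k x m) ≤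
        ENNReal.ofReal (if k ≤ j then (K * (2 ^ k * ‖u‖)) ^ n else 2 ^ n) *
          lpENorm θ p (lpBlock φ k x) := by
      split_ifs with hkj
      -- The Bernstein inequality is available since `‖u‖ ≤ 2^{-j}` and `k ≤ j`; for `k > j` the
      -- trivial bound is used.
      · refine h θ p hp x k u hu ?_
        calc 2 ^ k * ‖u‖ ≤ 2 ^ j * (1 / 2) ^ j := by
              gcongr
              norm_num
          _ = 1 := by rw [← mul_pow]; norm_num
      · exact lpENorm_phase_sub_one_pow_mul_le hp n u _
    refine (mul_le_mul_right hblock _).trans ?_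
    rw [hβpow, hβpow]
    refine (mul_assoc _ _ _).symm.trans_le ((mul_le_mul' ?_ le_rfl).trans_eq
      ((mul_assoc _ _ _).trans (congrArg _ (mul_assoc _ _ _))))
    rw [← ENNReal.ofReal_coe_nnreal, hρ, ← ENNReal.ofReal_pow hρ0, ← ENNReal.ofReal_mul (by positivity),
      ← ENNReal.ofReal_mul (by positivity), ← ENNReal.ofReal_mul (by positivity)]
    exact ENNReal.ofReal_le_ofReal
      (weight_le hβ1 (le_max_left _ _) (le_max_right _ _) hK j k hu huj)

end QTorus
end

noncomputable section

namespace QTorus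

/-! ### Equivalence of the norms -/

variable {d : ℕ}

theorem ofReal_half_pow_succ_rpow_neg (α : ℝ) (j : ℕ) :
    ENNReal.ofReal (((1 / 2 : ℝ) ^ (j + 1)) ^ (-α)) =
      ENNReal.ofReal ((2 : ℝ) ^ α) * ENNReal.ofReal ((2 : ℝ) ^ ((j : ℝ) * α)) := by
  rw [ofReal_half_pow_rpow_neg, ← ENNReal.ofReal_mul (by positivity),
    ← Real.rpow_add (by norm_num)]
  congr 2
  push_cast
  ring

theorem ofReal_rpow_mul_mul_rpow {q : ℝ} (hq : 0 ≤ q) (s : ℝ) (N : ℝ≥0∞) :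
    ENNReal.ofReal ((2 : ℝ) ^ (q * s)) * N ^ q = (ENNReal.ofReal ((2 : ℝ) ^ s) * N) ^ q := by
  rw [ENNReal.mul_rpow_of_nonneg _ _ hq, ENNReal.ofReal_rpow_of_nonneg (by positivity) hq,
    ← Real.rpow_mul (by norm_num), mul_comm s q]

/-- Schur's test for the kernel `ρ^{|j-k|}`, whose row and column sums are at most `A = 2/(1 - ρ)`.
-/
theorem exists_differenceNorm_le_besovNorm (φ : 𝓢(EuclideanSpace ℝ (Fin d), ℝ))
    (hφ : IsLittlewoodPaley φ) {α : ℝ} {n : ℕ} (hα : 0 < α) (hαn : α < n) :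
    ∃ D : ℝ≥0, ∀ (θ : Matrix (Fin d) (Fin d) ℝ) (p q : ℝ≥0∞), 1 ≤ p → 1 ≤ q →
      ∀ x : Distribution θ, differenceNorm n α p q x ≤ D * besovNorm φ α p q x := by
  obtain ⟨ρ, K, hρ, -, hK, h⟩ := exists_modulus_le_tsum φ hφ hα hαn
  have hρ' : (1 - (ρ : ℝ≥0∞))⁻¹ ≠ ∞ := by
    simpa [tsub_eq_zero_iff_le] using hρ
  set A : ℝ≥0∞ := 2 * (1 - (ρ : ℝ≥0∞))⁻¹ with hA
  -- The factor `2^α` pays for evaluating the power at the left end of the dyadic interval and `ω`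
  -- at the right end.
  set L : ℝ≥0∞ := ENNReal.ofReal (2 ^ α) * ENNReal.ofReal K with hL
  have hD : max 1 (L * A) ≠ ∞ := by
    have : L * A ≠ ∞ := ENNReal.mul_ne_top
      (ENNReal.mul_ne_top ENNReal.ofReal_ne_top ENNReal.ofReal_ne_top)
      (ENNReal.mul_ne_top ENNReal.ofNat_ne_top hρ')
    exact (max_lt ENNReal.one_lt_top this.lt_top).ne
  refine ⟨(max 1 (L * A)).toNNReal, fun θ p q hp hq x => ?_⟩
  rw [ENNReal.coe_toNNReal hD]
  set b : ℕ → ℝ≥0∞ := fun k =>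
    ENNReal.ofReal ((2 : ℝ) ^ ((k : ℝ) * α)) * lpENorm θ p (lpBlock φ k x) with hb
  have hstep : ∀ j : ℕ,
      ENNReal.ofReal (((1 / 2 : ℝ) ^ (j + 1)) ^ (-α)) * modulus n p x ((1 / 2) ^ j) ≤
        L * ∑' k : ℕ, (ρ : ℝ≥0∞) ^ ((j - k) + (k - j)) * b k := by
    intro j
    rw [ofReal_half_pow_succ_rpow_neg, mul_assoc, hL, mul_assoc]
    exact mul_le_mul' le_rfl (h θ p hp x j)
  unfold differenceNorm besovNorm
  split_ifs with hq'
  · refine max_le (le_mul_of_one_le_of_le (le_max_left _ _) (le_max_left _ _))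
      (iSup₂_le fun ε hε => ?_)
    obtain ⟨j, hj⟩ := Set.mem_iUnion.1 (iUnion_Ioc_half_pow.symm ▸ (show ε ∈ Set.Ioc 0 1 from hε))
    calc ENNReal.ofReal (ε ^ (-α)) * modulus n p x ε
        ≤ ENNReal.ofReal (((1 / 2 : ℝ) ^ (j + 1)) ^ (-α)) * modulus n p x ((1 / 2) ^ j) :=
          mul_le_mul' (ofReal_rpow_neg_antitone hα (by positivity) hj.1.le)
            (modulus_mono n p x hj.2)
      _ ≤ L * ∑' k : ℕ, (ρ : ℝ≥0∞) ^ ((j - k) + (k - j)) * b k := hstep j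
      _ ≤ L * ∑' k : ℕ, (ρ : ℝ≥0∞) ^ ((j - k) + (k - j)) * ⨆ k, b k :=
          mul_le_mul' le_rfl
            (ENNReal.tsum_le_tsum fun k => mul_le_mul' le_rfl (le_iSup b k))
      _ ≤ L * (A * ⨆ k, b k) := by
          rw [ENNReal.tsum_mul_right]
          exact mul_le_mul' le_rfl (mul_le_mul' (tsum_pow_dist_le _ j) le_rfl)
      _ ≤ _ := by
          rw [← mul_assoc]
          exact mul_le_mul' (le_max_right _ _) (le_max_right _ _)
  · have hq1 := one_le_toReal hq hq'
    have hq0 : 0 ≤ q.toReal := ENNReal.toReal_nonneg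
    refine rpow_add_rpow_le hq1 (le_max_left _ _) ?_
    calc _ ≤ ∑' j : ℕ, (ENNReal.ofReal (((1 / 2 : ℝ) ^ (j + 1)) ^ (-α)) *
          modulus n p x ((1 / 2) ^ j)) ^ q.toReal :=
          lintegral_dyadic_le hα hq0 (modulus_mono n p x)
      _ ≤ ∑' j : ℕ, (L * ∑' k : ℕ, (ρ : ℝ≥0∞) ^ ((j - k) + (k - j)) * b k) ^ q.toReal :=
          ENNReal.tsum_le_tsum fun j => ENNReal.rpow_le_rpow (hstep j) hq0
      _ = L ^ q.toReal * ∑' j : ℕ,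
            (∑' k : ℕ, (ρ : ℝ≥0∞) ^ ((j - k) + (k - j)) * b k) ^ q.toReal := by
          simp only [ENNReal.mul_rpow_of_nonneg _ _ hq0, ENNReal.tsum_mul_left]
      _ ≤ L ^ q.toReal * (A ^ q.toReal * ∑' k, b k ^ q.toReal) := by
          refine mul_le_mul' le_rfl (tsum_rpow_tsum_mul_le hq1 _ _
            (fun j => tsum_pow_dist_le _ j) fun k => ?_)
          refine le_of_eq_of_le (tsum_congr fun j => ?_) (tsum_pow_dist_le (ρ : ℝ≥0∞) k)
          rw [add_comm]
      _ = (L * A) ^ q.toReal * ∑' k, b k ^ q.toReal := by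
          rw [ENNReal.mul_rpow_of_nonneg L A hq0, mul_assoc]
      _ ≤ _ := by
          refine mul_le_mul' (ENNReal.rpow_le_rpow (le_max_right _ _) hq0) (le_of_eq ?_)
          exact tsum_congr fun k => (ofReal_rpow_mul_mul_rpow hq0 _ _).symm

theorem exists_besovNorm_le_differenceNorm (φ : 𝓢(EuclideanSpace ℝ (Fin d), ℝ))
    (hφ : IsLittlewoodPaley φ) {α : ℝ} (n : ℕ) (hα : 0 < α) :
    ∃ D : ℝ≥0, ∀ (θ : Matrix (Fin d) (Fin d) ℝ) (p q : ℝ≥0∞), 1 ≤ p → 1 ≤ q →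
      ∀ x : Distribution θ, besovNorm φ α p q x ≤ D * differenceNorm n α p q x := by
  obtain ⟨K, hK, h⟩ := exists_lpENorm_lpBlock_le_modulus φ hφ n
  set L : ℝ≥0∞ := ENNReal.ofReal K with hL
  have hD : max 1 (2 * L) ≠ ∞ := by
    have : 2 * L ≠ ∞ := ENNReal.mul_ne_top ENNReal.ofNat_ne_top ENNReal.ofReal_ne_top
    exact (max_lt ENNReal.one_lt_top this.lt_top).ne
  refine ⟨(max 1 (2 * L)).toNNReal, fun θ p q hp hq x => ?_⟩
  rw [ENNReal.coe_toNNReal hD]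
  have hL2 : L ≤ max 1 (2 * L) :=
    le_max_of_le_right (le_mul_of_one_le_left zero_le one_le_two)
  -- The free index `i` fits both cases: `i = k + 2` matches a single scale for `q = ∞`, and `i = k
  -- + 1` matches the offset in `tsum_dyadic_le_lintegral`.
  have hstep : ∀ k i : ℕ, k ≤ i →
      ENNReal.ofReal ((2 : ℝ) ^ ((k : ℝ) * α)) * lpENorm θ p (lpBlock φ k x) ≤
        L * (ENNReal.ofReal (((1 / 2 : ℝ) ^ i) ^ (-α)) * modulus n p x ((1 / 2) ^ (k + 2))) := by
    intro k i hki
    rw [← ofReal_half_pow_rpow_neg, mul_left_comm]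
    refine mul_le_mul' (ofReal_rpow_neg_antitone hα (by positivity) ?_) (h θ p hp x k)
    exact pow_le_pow_of_le_one (by norm_num) (by norm_num) hki
  unfold differenceNorm besovNorm
  split_ifs with hq'
  · refine max_le (le_mul_of_one_le_of_le (le_max_left _ _) (le_max_left _ _))
      (iSup_le fun k => (hstep k (k + 2) (by omega)).trans ?_)
    refine mul_le_mul' hL2 (le_max_of_le_right ?_)
    exact le_iSup₂_of_le (f := fun (ε : ℝ) (_ : 0 < ε ∧ ε ≤ 1) =>
      ENNReal.ofReal (ε ^ (-α)) * modulus n p x ε) ((1 / 2) ^ (k + 2))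
      ⟨by positivity, pow_le_one₀ (by norm_num) (by norm_num)⟩ le_rfl
  · have hq1 := one_le_toReal hq hq'
    have hq0 : 0 ≤ q.toReal := ENNReal.toReal_nonneg
    refine rpow_add_rpow_le hq1 (le_max_left _ _) ?_
    set f : ℕ → ℝ≥0∞ := fun j => (ENNReal.ofReal (((1 / 2 : ℝ) ^ j) ^ (-α)) *
      modulus n p x ((1 / 2) ^ (j + 1))) ^ q.toReal with hf
    calc _ ≤ ∑' k : ℕ, L ^ q.toReal * f (k + 1) := by
          refine ENNReal.tsum_le_tsum fun k => ?_
          rw [ofReal_rpow_mul_mul_rpow hq0, hf, ← ENNReal.mul_rpow_of_nonneg _ _ hq0]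
          exact ENNReal.rpow_le_rpow (hstep k (k + 1) (by omega)) hq0
      _ ≤ L ^ q.toReal * ∑' k : ℕ, f k := by
          rw [ENNReal.tsum_mul_left]
          exact mul_le_mul' le_rfl
            (ENNReal.tsum_comp_le_tsum_of_injective (add_left_injective 1) f)
      _ ≤ L ^ q.toReal * (2 * _) :=
          mul_le_mul' le_rfl (tsum_dyadic_le_lintegral hα hq0 (modulus_mono n p x))
      -- Weakening `2` to `2 ^ q` keeps the final constant `2 * L` independent of `q`.
      _ ≤ L ^ q.toReal * (2 ^ q.toReal * _) := by
          refine mul_le_mul' le_rfl (mul_le_mul' ?_ le_rfl)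
          calc (2 : ℝ≥0∞) = 2 ^ (1 : ℝ) := (ENNReal.rpow_one _).symm
            _ ≤ 2 ^ q.toReal := ENNReal.rpow_le_rpow_of_exponent_le one_le_two hq1
      _ ≤ _ := by
          rw [← mul_assoc, ← ENNReal.mul_rpow_of_nonneg _ _ hq0, mul_comm L]
          exact mul_le_mul' (ENNReal.rpow_le_rpow (le_max_right _ _) hq0) le_rfl

theorem differenceNorm_top_le_zygmundNorm {θ : Matrix (Fin d) (Fin d) ℝ} {α : ℝ} (n : ℕ)
    (hα : 0 < α) (x : Distribution θ) : differenceNorm n α ∞ ∞ x ≤ zygmundNorm n α x := by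
  rw [differenceNorm, if_pos rfl, zygmundNorm]
  refine max_le (le_add_of_le_of_nonneg (enorm_le_lpENorm le_top _ 0) zero_le)
    (iSup₂_le fun ε hε => le_add_of_nonneg_of_le zero_le ?_)
  rw [modulus, ENNReal.mul_iSup]
  refine iSup_le fun u => ?_
  rw [ENNReal.mul_iSup]
  refine iSup_le fun hu => ?_
  exact le_iSup₂_of_le (f := fun (u : EuclideanSpace ℝ (Fin d)) (_ : u ≠ 0) =>
      ENNReal.ofReal (‖u‖ ^ (-α)) * lpENorm θ ∞ (diffSeries n u x)) u (norm_pos_iff.1 hu.1)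
    (mul_le_mul' (ofReal_rpow_neg_antitone hα hu.1 hu.2) le_rfl)

theorem lpENorm_fourierCoeff_le_tsum {φ : 𝓢(EuclideanSpace ℝ (Fin d), ℝ)}
    (hφ : IsLittlewoodPaley φ) {θ : Matrix (Fin d) (Fin d) ℝ} (x : Distribution θ) :
    lpENorm θ ∞ (fourierCoeff x) ≤
      ‖fourierCoeff x 0‖ₑ + ∑' k : ℕ, lpENorm θ ∞ (lpBlock φ k x) := by
  have hsplit : fourierCoeff x = fun m => (Pi.single 0 (fourierCoeff x 0) : (Fin d → ℤ) → ℂ) m +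
      if m = 0 then 0 else fourierCoeff x m := by
    ext m
    rcases eq_or_ne m 0 with rfl | hm
    · simp
    · simp [hm]
  calc lpENorm θ ∞ (fourierCoeff x) = lpENorm θ ∞ _ := congrArg _ hsplit
    _ ≤ _ := lpENorm_add_le le_top _ _
    _ ≤ _ := add_le_add (lpENorm_top_single_le _)
      (lpENorm_le_tsum_lpENorm le_top (hasSum_lpBlock hφ x))

/-- The blocks decay like `2^{-kα}`, so their sum bounds `‖x‖_∞`. Steps `‖u‖ ≤ 1` are covered by the
difference norm, longer ones by `2^n ‖x‖_∞` because `‖u‖^{-α} ≤ 1`. -/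
theorem exists_zygmundNorm_le_besovNorm (φ : 𝓢(EuclideanSpace ℝ (Fin d), ℝ))
    (hφ : IsLittlewoodPaley φ) {α : ℝ} {n : ℕ} (hα : 0 < α) (hαn : α < n) :
    ∃ D : ℝ≥0, ∀ (θ : Matrix (Fin d) (Fin d) ℝ) (x : Distribution θ),
      zygmundNorm n α x ≤ D * besovNorm φ α ∞ ∞ x := by
  obtain ⟨ρ, K, hρ, hαρ, hK, -⟩ := exists_modulus_le_tsum φ hφ hα hαn
  obtain ⟨D, hD⟩ := exists_differenceNorm_le_besovNorm φ hφ hα hαn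
  have hρ' : (1 - (ρ : ℝ≥0∞))⁻¹ ≠ ∞ := by
    simpa [tsub_eq_zero_iff_le] using hρ
  obtain ⟨R, hR⟩ : ∃ R : ℝ≥0, (R : ℝ≥0∞) = (1 - (ρ : ℝ≥0∞))⁻¹ :=
    ⟨_, ENNReal.coe_toNNReal hρ'⟩
  have hnorm : ∀ (θ : Matrix (Fin d) (Fin d) ℝ) (x : Distribution θ),
      lpENorm θ ∞ (fourierCoeff x) ≤ (1 + R : ℝ≥0) * besovNorm φ α ∞ ∞ x := by
    intro θ x
    refine (lpENorm_fourierCoeff_le_tsum hφ x).trans ?_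
    rw [besovNorm, if_pos rfl]
    set b : ℕ → ℝ≥0∞ := fun k =>
      ENNReal.ofReal ((2 : ℝ) ^ ((k : ℝ) * α)) * lpENorm θ ∞ (lpBlock φ k x) with hb
    have hblock : ∀ k, lpENorm θ ∞ (lpBlock φ k x) ≤ (ρ : ℝ≥0∞) ^ k * ⨆ k, b k := by
      intro k
      calc lpENorm θ ∞ (lpBlock φ k x) = ENNReal.ofReal (2 ^ (-α)) ^ k * b k := by
            rw [hb, ← mul_assoc, ← ENNReal.ofReal_pow (by positivity),
              ← ENNReal.ofReal_mul (by positivity), ← Real.rpow_natCast, ← Real.rpow_mul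
              (by norm_num), ← Real.rpow_add (by norm_num)]
            have : -α * k + k * α = 0 := by ring
            rw [this, Real.rpow_zero, ENNReal.ofReal_one, one_mul]
        _ ≤ _ := by
            refine mul_le_mul' (pow_le_pow_left' ?_ k) (le_iSup b k)
            rw [← ENNReal.ofReal_coe_nnreal]
            exact ENNReal.ofReal_le_ofReal hαρ
    rw [ENNReal.coe_add, ENNReal.coe_one, add_mul, one_mul]
    refine add_le_add (le_max_left _ _) ?_
    calc ∑' k, lpENorm θ ∞ (lpBlock φ k x) ≤ ∑' k : ℕ, (ρ : ℝ≥0∞) ^ k * ⨆ k, b k :=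
          ENNReal.tsum_le_tsum hblock
      _ = R * ⨆ k, b k := by rw [ENNReal.tsum_mul_right, ENNReal.tsum_geometric, hR]
      _ ≤ _ := mul_le_mul' le_rfl (le_max_right _ _)
  refine ⟨(1 + R) + (D + 2 ^ n * (1 + R)), fun θ x => ?_⟩
  rw [zygmundNorm, ENNReal.coe_add (1 + R), ENNReal.coe_add D, add_mul, add_mul]
  refine add_le_add (hnorm θ x) (iSup₂_le fun u hu => ?_)
  have hu0 : 0 < ‖u‖ := norm_pos_iff.2 hu
  rcases le_or_gt ‖u‖ 1 with hu1 | hu1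
  · refine le_add_of_le_of_nonneg (le_trans ?_ (hD θ ∞ ∞ le_top le_top x)) zero_le
    rw [differenceNorm, if_pos rfl]
    refine le_max_of_le_right (le_iSup₂_of_le (f := fun (ε : ℝ) (_ : 0 < ε ∧ ε ≤ 1) =>
      ENNReal.ofReal (ε ^ (-α)) * modulus n ∞ x ε) ‖u‖ ⟨hu0, hu1⟩ ?_)
    exact mul_le_mul' le_rfl (lpENorm_diffSeries_le_modulus n ∞ x hu0 le_rfl)
  · refine le_add_of_nonneg_of_le zero_le ?_
    have h1 : ENNReal.ofReal (‖u‖ ^ (-α)) ≤ 1 := by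
      rw [← ENNReal.ofReal_one]
      exact ENNReal.ofReal_le_ofReal (Real.rpow_le_one_of_one_le_of_nonpos hu1.le (by linarith))
    have h2 : ENNReal.ofReal ((2 : ℝ) ^ n) = ((2 ^ n : ℝ≥0) : ℝ≥0∞) := by
      rw [ENNReal.ofReal_pow (by norm_num)]
      simp
    calc _ ≤ 1 * (ENNReal.ofReal (2 ^ n) * lpENorm θ ∞ (fourierCoeff x)) :=
          mul_le_mul' h1 (lpENorm_phase_sub_one_pow_mul_le le_top n u _)
      _ ≤ _ := by
          rw [one_mul, h2, ENNReal.coe_mul, mul_assoc]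
          exact mul_le_mul' le_rfl (hnorm θ x)

theorem zygmundNorm_lt_top_iff {θ : Matrix (Fin d) (Fin d) ℝ} {α : ℝ} {n : ℕ} (hn : n ≠ 0)
    (x : Distribution θ) : zygmundNorm n α x < ∞ ↔ x ∈ zygmundClass θ n α := by
  rw [zygmundNorm, ENNReal.add_lt_top, ← memLp_iff]
  refine and_congr_right fun _ => ?_
  set S : ℝ≥0∞ := ⨆ (u : EuclideanSpace ℝ (Fin d)) (_ : u ≠ 0),
    ENNReal.ofReal (‖u‖ ^ (-α)) * lpENorm θ ∞ (diffSeries n u x) with hS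
  constructor
  · intro h
    refine ⟨S.toReal, fun u => ?_⟩
    -- The class also tests `u = 0`, which the supremum omits; there the difference is zero because
    -- `n ≠ 0`.
    rcases eq_or_ne u 0 with rfl | hu
    · have : diffSeries n 0 x = 0 := by
        ext m
        simp [diffSeries, hn]
      rw [this, lpENorm_zero le_top]
      exact zero_le
    · have hu0 : 0 < ‖u‖ := norm_pos_iff.2 hu
      have h1 : ENNReal.ofReal (‖u‖ ^ (-α)) * lpENorm θ ∞ (diffSeries n u x) ≤ S :=
        le_iSup₂_of_le (f := fun (u : EuclideanSpace ℝ (Fin d)) (_ : u ≠ 0) =>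
          ENNReal.ofReal (‖u‖ ^ (-α)) * lpENorm θ ∞ (diffSeries n u x)) u hu le_rfl
      have h2 : ENNReal.ofReal (‖u‖ ^ α) * ENNReal.ofReal (‖u‖ ^ (-α)) = 1 := by
        rw [← ENNReal.ofReal_mul (by positivity), ← Real.rpow_add hu0, add_neg_cancel,
          Real.rpow_zero, ENNReal.ofReal_one]
      calc lpENorm θ ∞ (diffSeries n u x)
          = ENNReal.ofReal (‖u‖ ^ α) *
              (ENNReal.ofReal (‖u‖ ^ (-α)) * lpENorm θ ∞ (diffSeries n u x)) := by
            rw [← mul_assoc, h2, one_mul]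
        _ ≤ ENNReal.ofReal (‖u‖ ^ α) * S := mul_le_mul' le_rfl h1
        _ = _ := by
            rw [mul_comm, ENNReal.ofReal_mul ENNReal.toReal_nonneg, ENNReal.ofReal_toReal h.ne]
  · rintro ⟨C, hC⟩
    refine lt_of_le_of_lt (iSup₂_le fun u hu => ?_) (ENNReal.ofReal_lt_top (r := C))
    have hu0 : 0 < ‖u‖ := norm_pos_iff.2 hu
    calc _ ≤ ENNReal.ofReal (‖u‖ ^ (-α)) * ENNReal.ofReal (C * ‖u‖ ^ α) :=
          mul_le_mul' le_rfl (hC u)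
      _ = ENNReal.ofReal C := by
          rw [← ENNReal.ofReal_mul (by positivity), mul_left_comm, ← Real.rpow_add hu0,
            neg_add_cancel, Real.rpow_zero, mul_one]

end QTorus
end

/-! ### The main theorem. -/

theorem mainTheorem8 (d : ℕ) (hd : 2 ≤ d) (φ : 𝓢(EuclideanSpace ℝ (Fin d), ℝ))
    (hφ : QTorus.IsLittlewoodPaley φ) (α : ℝ) (n : ℕ) (hα : 0 < α) (hαn : α < n) :
    ∃ C : ℝ≥0, 0 < C ∧
      ∀ θ : Matrix (Fin d) (Fin d) ℝ, θ.transpose = -θ →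
        (∀ p q : ℝ≥0∞, 1 ≤ p → 1 ≤ q → ∀ x : QTorus.Distribution θ,
          QTorus.besovNorm φ α p q x ≤ C * QTorus.differenceNorm n α p q x ∧
          QTorus.differenceNorm n α p q x ≤ C * QTorus.besovNorm φ α p q x) ∧
        QTorus.besovSpace θ φ α ∞ ∞ = QTorus.zygmundClass θ n α ∧
        (∀ x : QTorus.Distribution θ,
          QTorus.besovNorm φ α ∞ ∞ x ≤ C * QTorus.zygmundNorm n α x ∧
          QTorus.zygmundNorm n α x ≤ C * QTorus.besovNorm φ α ∞ ∞ x) := by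
  have hn : n ≠ 0 := by
    rintro rfl
    simp only [Nat.cast_zero] at hαn
    linarith
  obtain ⟨D₁, h₁⟩ := QTorus.exists_besovNorm_le_differenceNorm φ hφ n hα
  obtain ⟨D₂, h₂⟩ := QTorus.exists_differenceNorm_le_besovNorm φ hφ hα hαn
  obtain ⟨D₃, h₃⟩ := QTorus.exists_zygmundNorm_le_besovNorm φ hφ hα hαn
  have le₁ : (D₁ : ℝ≥0∞) ≤ (D₁ + D₂ + D₃ + 1 : ℝ≥0) := by
    rw [ENNReal.coe_le_coe, add_assoc, add_assoc]
    exact le_self_add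
  have le₂ : (D₂ : ℝ≥0∞) ≤ (D₁ + D₂ + D₃ + 1 : ℝ≥0) := by
    rw [ENNReal.coe_le_coe, add_assoc, add_right_comm]
    exact le_add_self
  have le₃ : (D₃ : ℝ≥0∞) ≤ (D₁ + D₂ + D₃ + 1 : ℝ≥0) := by
    rw [ENNReal.coe_le_coe, add_right_comm]
    exact le_add_self
  have h₄ : ∀ (θ : Matrix (Fin d) (Fin d) ℝ) (x : QTorus.Distribution θ),
      QTorus.besovNorm φ α ∞ ∞ x ≤ D₁ * QTorus.zygmundNorm n α x := fun θ x =>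
    (h₁ θ ∞ ∞ le_top le_top x).trans
      (mul_le_mul' le_rfl (QTorus.differenceNorm_top_le_zygmundNorm n hα x))
  refine ⟨D₁ + D₂ + D₃ + 1, by positivity, fun θ _ => ⟨fun p q hp hq x =>
    ⟨(h₁ θ p q hp hq x).trans (mul_le_mul' le₁ le_rfl),
      (h₂ θ p q hp hq x).trans (mul_le_mul' le₂ le_rfl)⟩, ?_, fun x =>
    ⟨(h₄ θ x).trans (mul_le_mul' le₁ le_rfl), (h₃ θ x).trans (mul_le_mul' le₃ le_rfl)⟩⟩⟩
  -- Equality of the two classes follows from comparability of the norms, both being finiteness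
  -- conditions.
  ext x
  rw [← QTorus.zygmundNorm_lt_top_iff hn]
  exact ⟨fun h => (h₃ θ x).trans_lt (ENNReal.mul_lt_top ENNReal.coe_lt_top h),
    fun h => (h₄ θ x).trans_lt (ENNReal.mul_lt_top ENNReal.coe_lt_top h)⟩
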